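/- Let $d\ge 2$ and let $n=n_1+n_2$ be a real function on $\mathbb R^d$ with $n>0$, where $n_2\in L^\infty(\mathbb R^d)$ and $n_1$ is measurable and, for some $c_0>0$, $$\big\| |n_1|^{1/2}\varphi\big\|_{L^2}\le (1-c_0)\,\|\nabla \varphi\|_{L^2}\qquad\text{for all }\varphi\in C_c^\infty(\mathbb R^d).$$ Assume that $n$ has a weak gradient $\nabla n\in L^1_{\rm loc}(\mathbb R^d\setminus\{0\})$ (for instance $n\in C^1(\mathbb R^d\setminus\{0\})$) and that $$2\sum_{j\in\mathbb Z}\ \sup_{C(j)}\frac{(x\cdot\nabla n(x))_-}{n(x)}<1,\qquad C(j)=\{x\in\mathbb R^d:\ 2^j\le |x|\le 2^{j+1}\},\qquad (a)_-=\max(-a,0),$$ where $\sup$ is the essential supremum and $n>0$ is meant almost everywhere. Let $u:\mathbb R^d\to\mathbb C$ be a distributional solution of $\Delta u+nu=0$ on $\mathbb R^d$ with $u$ and its weak gradient $\nabla u$ in $L^2_{\rm loc}(\mathbb R^d)$ and $nu\in L^1_{\rm loc}(\mathbb R^d)$ (the last condition only gives the equation its meaning). If $$\liminf_{r\to\infty}\int_{|x|=r}\big(|\nabla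 u|^2+|u|^2\big)\,d\sigma(x)=0,$$ where $\sigma$ is the surface measure and, since the spherical integral is defined for almost every $r$, the lower limit is the essential one (null sets of radii are ignored), then $u=0$ almost everywhere. -/

import Mathlib

open MeasureTheory Filter Set
open scoped ENNReal ContDiff Topology

namespace Helmholtz

/-- The Euclidean space `ℝ^d`. -/
abbrev E (d : ℕ) := EuclideanSpace ℝ (Fin d)

/-- `φ` is a real test function on `Ω`: smooth, with compact support contained in `Ω`. -/
def IsTestFunction {d : ℕ} (Ω : Set (E d)) (φ : E d → ℝ) : Prop :=
  ContDiff ℝ ∞ φ ∧ HasCompactSupport φ ∧ tsupport φ ⊆ Ω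

/-- The `i`-th partial derivative of a (smooth) function on `ℝ^d`. -/
noncomputable def partialDeriv {d : ℕ} (i : Fin d) (φ : E d → ℝ) (x : E d) : ℝ :=
  fderiv ℝ φ x (EuclideanSpace.single i (1 : ℝ))

/-- The `L¹_loc` functions `g 0, …, g (d-1)` are the distributional partial derivatives on the
open set `Ω` of the `L¹_loc` function `f`. -/
def HasWeakGradientOn {d : ℕ} {F : Type*} [NormedAddCommGroup F] [NormedSpace ℝ F]
    (Ω : Set (E d)) (f : E d → F) (g : Fin d → E d → F) : Prop :=
  LocallyIntegrableOn f Ω ∧ (∀ i, LocallyIntegrableOn (g i) Ω) ∧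
    ∀ φ : E d → ℝ, IsTestFunction Ω φ → ∀ i,
      ∫ x, partialDeriv i φ x • f x = -∫ x, φ x • g i x

/-- Membership in `L²_loc(ℝ^d)`. -/
def IsLocallyL2 {d : ℕ} (f : E d → ℂ) : Prop :=
  ∀ K : Set (E d), IsCompact K → MemLp f 2 (volume.restrict K)

/-- `u`, with weak gradient `Du`, solves `Δu + n u = 0` in the sense of distributions on `ℝ^d`.
(For `u` to be a distributional solution the product `n u` has to be a distribution; this is
recorded as its local integrability.) -/
def IsHelmholtzSolution {d : ℕ} (n : E d → ℝ) (u : E d → ℂ) (Du : Fin d → E d → ℂ) : Prop :=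
  LocallyIntegrable (fun x => n x • u x) ∧
    ∀ φ : E d → ℝ, IsTestFunction univ φ →
      -(∑ i, ∫ x, partialDeriv i φ x • Du i x) + ∫ x, φ x • (n x • u x) = 0

/-- The closed dyadic annulus `C(j) = {2^j ≤ |x| ≤ 2^(j+1)}`. -/
def annulus (d : ℕ) (j : ℤ) : Set (E d) :=
  {x | (2 : ℝ) ^ j ≤ ‖x‖ ∧ ‖x‖ ≤ (2 : ℝ) ^ (j + 1)}

/-- `(x · ∇n(x))₋ / n(x)`, where `(a)₋ = max (-a) 0`. -/
noncomputable def radialDecrease {d : ℕ} (n : E d → ℝ) (Dn : Fin d → E d → ℝ) (x : E d) : ℝ :=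
  max (-∑ i, x i * Dn i x) 0 / n x

/-- `β = 2 ∑_{j ∈ ℤ} sup_{C(j)} (x · ∇n)₋ / n`, with the supremum of an almost everywhere defined
function, i.e. the essential supremum. -/
noncomputable def betaConst {d : ℕ} (n : E d → ℝ) (Dn : Fin d → E d → ℝ) : ℝ≥0∞ :=
  2 * ∑' j : ℤ, essSup (fun x => ENNReal.ofReal (radialDecrease n Dn x))
    (volume.restrict (annulus d j))

/-- `∫_{|x| = r} (|∇u|² + |u|²) dσ`, with `σ` the surface measure, written on the unit sphere. -/
noncomputable def sphereEnergy {d : ℕ} (u : E d → ℂ) (Du : Fin d → E d → ℂ) (r : ℝ) : ℝ≥0∞ :=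
  ENNReal.ofReal (r ^ (d - 1)) *
    ∫⁻ y : Metric.sphere (0 : E d) 1,
      ((∑ i, ‖Du i (r • (y : E d))‖ₑ ^ 2) + ‖u (r • (y : E d))‖ₑ ^ 2)
      ∂(volume : Measure (E d)).toSphere

end Helmholtz

/-!
The proof compares `u` with a one-dimensional profile along rays. Throughout, `v` is the real or the
imaginary part of `u`, `β_j` is the essential supremum of `(x · ∇n)₋ / n` on `C(j)`, and `b` is the
step function of the radius equal to `β_j` on `[2^j, 2^(j+1))`; thus `∑ β_j < 1/2`, hence
`∫ b(r) dr / r ≤ 1/2`.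

**The potential is bounded.** For a nonnegative test function `φ` supported in an open dyadic
annulus, the decrease condition is a differential inequality in `s` for `∫ φ(x) n(s x) dx`. It makes
`n` increase along rays up to a factor: `n(x) ≤ 2 n(s x)` almost everywhere for `s ≥ 1`
(`ae_le_two_mul_comp_smul`). So the integral of `n` against `φ²` is controlled by that against the
dilates of `φ²`, for which the Dirichlet integral in the form bound on `n₁` becomes negligible as
`s → ∞`; what remains is the bound `2 ‖n₂‖_∞` on `n` (`ae_potential_le`). From here on all products
are locally integrable.

**Virial inequality.** Mollifications `w_k` of `v` satisfy `w_k → v`, `∇w_k → ∇v` and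
`Δw_k → -n v` in `L²_loc` (`smoothApprox_mollify`). Pohozaev's identity and the energy identity pass
to the limit, and together with the decrease condition they give `SmoothApprox.virial`, in which
neither second derivatives nor the gradient of `n` occur.

**Spherical integrals.** Let `q`, `K`, `F` be the integrals over `|x| = r` of `v²`, of the Pohozaev
boundary term and of the energy of the profile `r^((d-1)/2) v`. Testing with radial cut-offs gives,
weakly in `r`:

* `K(r) ≥ ∫_{|x| ≤ R} n v²` for `r > R` (`SmoothApprox.mass_le_sphereProfile`);
* `F' ≥ -(κ/r) F` with `κ = b + 1/r`, if the angular form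
  `(r/2) n v² + r² |∇_τ v|² + (d-1)(d-3) v² / 4` is nonnegative in the mean on large spheres
  (`SmoothApprox.profile_growth`);
* `q' = -2 (K - r F)` (`SmoothApprox.integral_deriv_mul_sq`).

Since `∫ κ dr / r ≤ 3/4` far out and `F` becomes small along the radii of the lower limit, a
Gronwall argument gives `F ≤ 0` (`SmoothApprox.sphereProfile_nonpos`). Then `q` decreases at least
linearly unless `n v²` has integral zero on every ball; as `q ≥ 0`, it has, and `v = 0` because
`n > 0` (`SmoothApprox.eq_zero_of_angular_nonneg`).

**The angular form.** For `d ≥ 3` it is pointwise nonnegative. For `d = 2` its last term is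
`-v² / 4`, and one needs the potential: since `n` increases along rays up to a factor, `(r/2) n ≥ 1`
on most of each large circle (`exists_circleDefect_le`), and a Poincaré inequality on the circle
bounds the integral of `v² / 4` (`circle_inequality`).
-/

namespace Helmholtz

/-! ### Local convergence in `L^p` -/

/-- Membership in `L^p_loc(ℝ^d)` of a real function, tested on balls. -/
def MemLpLoc {d : ℕ} (p : ℝ≥0∞) (f : E d → ℝ) : Prop :=
  ∀ R : ℝ, MemLp f p (volume.restrict (Metric.closedBall 0 R))

/-- Measurable functions that are essentially bounded on every ball; they act by multiplication
on `L^p_loc`. -/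
def LocBdd {d : ℕ} (c : E d → ℝ) : Prop :=
  AEStronglyMeasurable c volume ∧
    ∀ R : ℝ, ∃ C : ℝ, ∀ᵐ x ∂volume.restrict (Metric.closedBall (0 : E d) R), ‖c x‖ ≤ C

/-- Convergence of a sequence in `L^p_loc(ℝ^d)`. -/
structure ConvLoc {d : ℕ} (p : ℝ≥0∞) (F : ℕ → E d → ℝ) (f : E d → ℝ) : Prop where
  memLpLoc : ∀ k, MemLpLoc p (F k)
  memLpLoc_lim : MemLpLoc p f
  tendsto : ∀ R : ℝ, Tendsto
    (fun k => eLpNorm (F k - f) p (volume.restrict (Metric.closedBall 0 R))) atTop (𝓝 0)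

section
variable {d : ℕ}

theorem _root_.Continuous.locBdd {c : E d → ℝ} (hc : Continuous c) : LocBdd c := by
  refine ⟨hc.aestronglyMeasurable, fun R => ?_⟩
  obtain ⟨C, hC⟩ := (isCompact_closedBall (0 : E d) R).exists_bound_of_continuousOn hc.continuousOn
  exact ⟨C, (ae_restrict_mem measurableSet_closedBall).mono hC⟩

theorem LocBdd.mul {c e : E d → ℝ} (hc : LocBdd c) (he : LocBdd e) :
    LocBdd (fun x => c x * e x) := by
  refine ⟨hc.1.mul he.1, fun R => ?_⟩
  obtain ⟨C, hC⟩ := hc.2 R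
  obtain ⟨C', hC'⟩ := he.2 R
  refine ⟨C * C', ?_⟩
  filter_upwards [hC, hC'] with x h1 h2
  rw [norm_mul]
  exact mul_le_mul h1 h2 (norm_nonneg _) ((norm_nonneg _).trans h1)

theorem MemLpLoc.congr {p : ℝ≥0∞} {f g : E d → ℝ} (hf : MemLpLoc p f) (h : f =ᵐ[volume] g) :
    MemLpLoc p g := fun R => (hf R).ae_eq (ae_restrict_of_ae h)

theorem MemLpLoc.add {p : ℝ≥0∞} {f g : E d → ℝ} (hf : MemLpLoc p f) (hg : MemLpLoc p g) :
    MemLpLoc p (fun x => f x + g x) := fun R => (hf R).add (hg R)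

theorem MemLpLoc.neg {p : ℝ≥0∞} {f : E d → ℝ} (hf : MemLpLoc p f) :
    MemLpLoc p (fun x => -f x) := fun R => (hf R).neg

theorem MemLpLoc.sub {p : ℝ≥0∞} {f g : E d → ℝ} (hf : MemLpLoc p f) (hg : MemLpLoc p g) :
    MemLpLoc p (fun x => f x - g x) := fun R => (hf R).sub (hg R)

theorem MemLpLoc.sum {p : ℝ≥0∞} {ι : Type*} (s : Finset ι) {f : ι → E d → ℝ}
    (hf : ∀ i ∈ s, MemLpLoc p (f i)) : MemLpLoc p (fun x => ∑ i ∈ s, f i x) :=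
  fun R => memLp_finsetSum s (fun i hi => hf i hi R)

theorem MemLpLoc.bdd_mul {p : ℝ≥0∞} {c f : E d → ℝ} (hc : LocBdd c) (hf : MemLpLoc p f) :
    MemLpLoc p (fun x => c x * f x) := fun R => by
  obtain ⟨C, hC⟩ := hc.2 R
  refine (hf R).of_le_mul (c := C) (hc.1.restrict.mul (hf R).1) ?_
  filter_upwards [hC] with x hx
  rw [norm_mul]
  exact mul_le_mul_of_nonneg_right hx (norm_nonneg _)

theorem MemLpLoc.mul {f g : E d → ℝ} (hf : MemLpLoc 2 f) (hg : MemLpLoc 2 g) :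
    MemLpLoc 1 (fun x => f x * g x) := fun R => (hg R).mul' (hf R)

theorem _root_.Continuous.memLpLoc {p : ℝ≥0∞} {f : E d → ℝ} (hf : Continuous f) :
    MemLpLoc p f := fun R => by
  obtain ⟨C, hC⟩ := (isCompact_closedBall (0 : E d) R).exists_bound_of_continuousOn hf.continuousOn
  have : IsFiniteMeasure (volume.restrict (Metric.closedBall (0 : E d) R)) :=
    ⟨by simpa using measure_closedBall_lt_top⟩
  exact MemLp.of_bound hf.aestronglyMeasurable C
    ((ae_restrict_mem measurableSet_closedBall).mono hC)

theorem MemLpLoc.mono_exponent {f : E d → ℝ} (hf : MemLpLoc 2 f) : MemLpLoc 1 f := fun R => by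
  have : IsFiniteMeasure (volume.restrict (Metric.closedBall (0 : E d) R)) :=
    ⟨by simpa using measure_closedBall_lt_top⟩
  exact (hf R).mono_exponent (by norm_num)

theorem MemLpLoc.locallyIntegrable {f : E d → ℝ} (hf : MemLpLoc 1 f) : LocallyIntegrable f := by
  rw [locallyIntegrable_iff]
  intro K hK
  obtain ⟨R, hR⟩ := hK.isBounded.subset_closedBall 0
  exact IntegrableOn.mono_set (memLp_one_iff_integrable.1 (hf R)) hR

/-- A locally integrable function becomes integrable after multiplication by a locally bounded
function that vanishes off a ball. -/
theorem MemLpLoc.integrable_mul {c f : E d → ℝ} (hf : MemLpLoc 1 f) (hc : LocBdd c) {R : ℝ}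
    (hR : ∀ x, R < ‖x‖ → c x = 0) : Integrable (fun x => c x * f x) := by
  have h1 : IntegrableOn (fun x => c x * f x) (Metric.closedBall (0 : E d) R) :=
    memLp_one_iff_integrable.1 (hf.bdd_mul hc R)
  refine (integrableOn_iff_integrable_of_support_subset ?_).1 h1
  intro x hx
  by_contra h
  exact hx (by simp [hR x (by simpa using h)])

namespace ConvLoc
variable {p : ℝ≥0∞} {F G : ℕ → E d → ℝ} {f g : E d → ℝ}

theorem add (hp : 1 ≤ p) (hF : ConvLoc p F f) (hG : ConvLoc p G g) :
    ConvLoc p (fun k x => F k x + G k x) (fun x => f x + g x) := by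
  refine ⟨fun k => (hF.1 k).add (hG.1 k), hF.2.add hG.2, fun R => ?_⟩
  have := (hF.3 R).add (hG.3 R)
  rw [add_zero] at this
  refine tendsto_of_tendsto_of_tendsto_of_le_of_le tendsto_const_nhds this (fun _ => zero_le)
    fun k => ?_
  have e : (fun x => F k x + G k x) - (fun x => f x + g x) = (F k - f) + (G k - g) := by
    ext x; simp; ring
  simp only [e]
  exact eLpNorm_add_le ((hF.1 k R).1.sub (hF.2 R).1) ((hG.1 k R).1.sub (hG.2 R).1) hp

theorem bdd_mul {c : E d → ℝ} (hc : LocBdd c) (hF : ConvLoc p F f) :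
    ConvLoc p (fun k x => c x * F k x) (fun x => c x * f x) := by
  refine ⟨fun k => (hF.1 k).bdd_mul hc, hF.2.bdd_mul hc, fun R => ?_⟩
  obtain ⟨C, hC⟩ := hc.2 R
  have := ENNReal.Tendsto.const_mul (a := ENNReal.ofReal C) (hF.3 R) (Or.inr ENNReal.ofReal_ne_top)
  rw [mul_zero] at this
  refine tendsto_of_tendsto_of_tendsto_of_le_of_le tendsto_const_nhds this (fun _ => zero_le)
    fun k => ?_
  refine eLpNorm_le_mul_eLpNorm_of_ae_le_mul ?_ p
  filter_upwards [hC] with x hx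
  simp only [Pi.sub_apply, ← mul_sub, norm_mul]
  exact mul_le_mul_of_nonneg_right hx (norm_nonneg _)

theorem sum (hp : 1 ≤ p) {ι : Type*} (s : Finset ι) {F : ι → ℕ → E d → ℝ} {f : ι → E d → ℝ}
    (h : ∀ i ∈ s, ConvLoc p (F i) (f i)) :
    ConvLoc p (fun k x => ∑ i ∈ s, F i k x) (fun x => ∑ i ∈ s, f i x) := by
  classical
  induction s using Finset.induction_on with
  | empty =>
    simp only [Finset.sum_empty]
    refine ⟨fun _ => continuous_const.memLpLoc, continuous_const.memLpLoc, fun R => ?_⟩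
    simp
  | insert a s ha ih =>
    simp only [Finset.sum_insert ha]
    exact (h a (by simp)).add hp (ih fun i hi => h i (by simp [hi]))

theorem neg (hF : ConvLoc p F f) : ConvLoc p (fun k x => -F k x) (fun x => -f x) := by
  have := hF.bdd_mul (c := fun _ => -1) continuous_const.locBdd
  simpa using this

theorem sub (hp : 1 ≤ p) (hF : ConvLoc p F f) (hG : ConvLoc p G g) :
    ConvLoc p (fun k x => F k x - G k x) (fun x => f x - g x) := by
  simpa only [sub_eq_add_neg] using hF.add hp hG.neg

/-- Products of `L²_loc`-convergent sequences converge in `L¹_loc`. -/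
theorem mul (hF : ConvLoc 2 F f) (hG : ConvLoc 2 G g) :
    ConvLoc 1 (fun k x => F k x * G k x) (fun x => f x * g x) := by
  refine ⟨fun k => (hF.1 k).mul (hG.1 k), hF.2.mul hG.2, fun R => ?_⟩
  set μ := volume.restrict (Metric.closedBall (0 : E d) R)
  have t1 := ENNReal.Tendsto.mul_const (b := eLpNorm g 2 μ) (hF.3 R) (Or.inr (hG.2 R).2.ne)
  have t2 := ENNReal.Tendsto.const_mul (a := eLpNorm f 2 μ) (hG.3 R) (Or.inr (hF.2 R).2.ne)
  have t3 := ENNReal.Tendsto.mul (hF.3 R) (Or.inr ENNReal.zero_ne_top) (hG.3 R)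
    (Or.inr ENNReal.zero_ne_top)
  have := (t3.add t1).add t2
  simp only [zero_mul, mul_zero, add_zero] at this
  refine tendsto_of_tendsto_of_tendsto_of_le_of_le tendsto_const_nhds this (fun _ => zero_le)
    fun k => ?_
  have mF := (hF.1 k R).1.sub (hF.2 R).1
  have mG := (hG.1 k R).1.sub (hG.2 R).1
  have e : (fun x => F k x * G k x) - (fun x => f x * g x)
      = (F k - f) • (G k - g) + (F k - f) • g + f • (G k - g) := by
    ext x; simp; ring
  simp only [e]
  refine (eLpNorm_add_le ((mF.smul mG).add (mF.smul (hG.2 R).1)) ((hF.2 R).1.smul mG)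
    le_rfl).trans (add_le_add ((eLpNorm_add_le (mF.smul mG) (mF.smul (hG.2 R).1)
      le_rfl).trans (add_le_add ?_ ?_)) ?_)
  · exact eLpNorm_smul_le_mul_eLpNorm mG mF
  · exact eLpNorm_smul_le_mul_eLpNorm (hG.2 R).1 mF
  · exact eLpNorm_smul_le_mul_eLpNorm mG (hF.2 R).1

/-- The integral against a locally bounded function vanishing off a ball is continuous under
`L¹_loc` convergence. -/
theorem tendsto_integral_mul (hF : ConvLoc 1 F f) {c : E d → ℝ} (hc : LocBdd c) {R : ℝ}
    (hR : ∀ x, R < ‖x‖ → c x = 0) :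
    Tendsto (fun k => ∫ x, c x * F k x) atTop (𝓝 (∫ x, c x * f x)) := by
  refine tendsto_integral_of_L1' _ (hF.2.integrable_mul hc hR).1
    (Eventually.of_forall fun k => (hF.1 k).integrable_mul hc hR) ?_
  refine ((hF.bdd_mul hc).3 R).congr fun k => ?_
  rw [eLpNorm_restrict_eq_of_support_subset]
  intro x hx
  by_contra h
  exact hx (by simp [hR x (by simpa using h)])

end ConvLoc
end

/-! ### Mollification -/

section
variable {d : ℕ}

theorem eLpNorm_two_sq {α F : Type*} [MeasurableSpace α] [NormedAddCommGroup F] {μ : Measure α}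
    (f : α → F) :
    eLpNorm f 2 μ ^ 2 = ∫⁻ x, ‖f x‖ₑ ^ 2 ∂μ := by
  have := eLpNorm_nnreal_pow_eq_lintegral (f := f) (μ := μ) (p := 2) (by norm_num)
  norm_num at this
  exact_mod_cast this

/-- The bump functions whose normalizations form the mollifying sequence. -/
noncomputable def bump (d k : ℕ) : ContDiffBump (0 : E d) where
  rIn := 1 / (2 * (k + 1))
  rOut := 1 / (k + 1)
  rIn_pos := by positivity
  rIn_lt_rOut := by
    apply one_div_lt_one_div_of_lt <;> [positivity; skip]
    have : (0 : ℝ) ≤ k := k.cast_nonneg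
    linarith

/-- The mollifier `ρ_k`: nonnegative, smooth, supported in the ball of radius `1 / (k + 1)`, with
integral one. -/
noncomputable def mollifier (d k : ℕ) : E d → ℝ := (bump d k).normed volume

open Convolution in
/-- The mollification `ρ_k * f`. -/
noncomputable def mollify (k : ℕ) (f : E d → ℝ) : E d → ℝ :=
  mollifier d k ⋆[ContinuousLinearMap.lsmul ℝ ℝ, volume] f

theorem mollify_apply (k : ℕ) (f : E d → ℝ) (x : E d) :
    mollify k f x = ∫ t, mollifier d k t * f (x - t) := rfl

theorem mollifier_contDiff (k : ℕ) : ContDiff ℝ ∞ (mollifier d k) :=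
  (bump d k).contDiff_normed

theorem mollifier_hasCompactSupport (k : ℕ) : HasCompactSupport (mollifier d k) :=
  (bump d k).hasCompactSupport_normed

theorem mollifier_nonneg (k : ℕ) (x : E d) : 0 ≤ mollifier d k x :=
  (bump d k).nonneg_normed x

theorem mollifier_lintegral (k : ℕ) : ∫⁻ x, ‖mollifier d k x‖ₑ = 1 := by
  have h := ofReal_integral_eq_lintegral_ofReal ((bump d k).integrable_normed (μ := volume))
    (Eventually.of_forall fun x => mollifier_nonneg k x)
  rw [(bump d k).integral_normed, ENNReal.ofReal_one] at h
  rw [h]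
  refine lintegral_congr fun x => ?_
  exact Real.enorm_of_nonneg (mollifier_nonneg k x)

theorem mollifier_eq_zero {k : ℕ} {x : E d} (h : 1 / ((k : ℝ) + 1) ≤ ‖x‖) :
    mollifier d k x = 0 := by
  by_contra h0
  have : x ∈ Function.support ((bump d k).normed volume) := h0
  rw [ContDiffBump.support_normed_eq] at this
  have h2 : ‖x‖ < (bump d k).rOut := by simpa using this
  exact absurd h2 (not_lt.2 h)

theorem enorm_mollify_sq_le (k : ℕ) {h : E d → ℝ} (hh : AEStronglyMeasurable h volume) (x : E d) :
    ‖mollify k h x‖ₑ ^ 2 ≤ ∫⁻ t, ‖mollifier d k t‖ₑ * ‖h (x - t)‖ₑ ^ 2 := by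
  set P : Measure (E d) := volume.withDensity fun t => ‖mollifier d k t‖ₑ
  have hm : Measurable fun t => ‖mollifier d k t‖ₑ :=
    (mollifier_contDiff k).continuous.measurable.enorm
  have hP : IsProbabilityMeasure P := ⟨by
    rw [withDensity_apply _ MeasurableSet.univ, Measure.restrict_univ, mollifier_lintegral]⟩
  have hhx : AEStronglyMeasurable (fun t => h (x - t)) volume :=
    hh.comp_quasiMeasurePreserving
      (Measure.measurePreserving_sub_left volume x).quasiMeasurePreserving
  have hhP : AEStronglyMeasurable (fun t => h (x - t)) P :=
    hhx.mono_ac (withDensity_absolutelyContinuous _ _)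
  have h1 : ‖mollify k h x‖ₑ ≤ ∫⁻ t, ‖h (x - t)‖ₑ ∂P := by
    rw [lintegral_withDensity_eq_lintegral_mul₀' hm.aemeasurable hhP.enorm, mollify_apply]
    refine (enorm_integral_le_lintegral_enorm _).trans (lintegral_mono fun t => ?_)
    simp [enorm_mul]
  have h2 := eLpNorm_le_eLpNorm_of_exponent_le (p := 1) (q := 2) (by norm_num) hhP
  rw [eLpNorm_one_eq_lintegral_enorm] at h2
  calc _ ≤ (eLpNorm (fun t => h (x - t)) 2 P) ^ 2 := by gcongr; exact h1.trans h2
    _ = _ := by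
      rw [eLpNorm_two_sq, lintegral_withDensity_eq_lintegral_mul₀' hm.aemeasurable
        (hhP.enorm.pow_const 2)]
      rfl

/-- Young's inequality for mollification in `L²`. -/
theorem eLpNorm_mollify_le (k : ℕ) {h : E d → ℝ} (hh : AEStronglyMeasurable h volume) :
    eLpNorm (mollify k h) 2 volume ≤ eLpNorm h 2 volume := by
  have hm : Measurable fun t => ‖mollifier d k t‖ₑ :=
    (mollifier_contDiff k).continuous.measurable.enorm
  rw [← ENNReal.pow_le_pow_left_iff two_ne_zero, eLpNorm_two_sq, eLpNorm_two_sq]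
  calc _ ≤ ∫⁻ x, ∫⁻ t, ‖mollifier d k t‖ₑ * ‖h (x - t)‖ₑ ^ 2 :=
        lintegral_mono fun x => enorm_mollify_sq_le k hh x
    _ = ∫⁻ t, ∫⁻ x, ‖mollifier d k t‖ₑ * ‖h (x - t)‖ₑ ^ 2 := by
      rw [lintegral_lintegral_swap]
      refine (hm.comp measurable_snd).aemeasurable.mul (AEMeasurable.pow_const ?_ 2)
      exact (hh.comp_quasiMeasurePreserving
        (quasiMeasurePreserving_sub_of_right_invariant volume volume)).enorm
    _ = ∫⁻ t, ‖mollifier d k t‖ₑ * ∫⁻ x, ‖h x‖ₑ ^ 2 := by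
      refine lintegral_congr fun t => ?_
      rw [lintegral_const_mul' _ _ enorm_ne_top,
        lintegral_sub_right_eq_self (fun x => ‖h x‖ₑ ^ 2) t]
    _ = _ := by
      rw [lintegral_mul_const _ hm, mollifier_lintegral, one_mul]

theorem mollify_sub (k : ℕ) {f g : E d → ℝ} (hf : LocallyIntegrable f) (hg : LocallyIntegrable g) :
    mollify k (f - g) = mollify k f - mollify k g := by
  have e : ∀ f : E d → ℝ, LocallyIntegrable f → ConvolutionExists (mollifier d k) f
      (ContinuousLinearMap.lsmul ℝ ℝ) volume := fun f hf =>
    (mollifier_hasCompactSupport k).convolutionExists_left _ (mollifier_contDiff k).continuous hf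
  ext x
  simp only [Pi.sub_apply, mollify_apply]
  rw [← integral_sub]
  · simp [mul_sub]
  · exact e f hf x
  · exact e g hg x

theorem mollify_sub_tendsto_of_continuous {g : E d → ℝ} (hg : Continuous g)
    (hgs : HasCompactSupport g) :
    Tendsto (fun k => eLpNorm (mollify k g - g) 2 volume) atTop (𝓝 0) := by
  obtain ⟨R, hR⟩ := hgs.isCompact.isBounded.subset_closedBall 0
  have hsupp : ∀ x, R < ‖x‖ → g x = 0 := fun x hx => by
    by_contra h
    have := hR (subset_tsupport g h)
    simp at this
    linarith
  have hmeas : volume (Metric.closedBall (0 : E d) (R + 1)) ≠ ⊤ := measure_closedBall_lt_top.ne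
  set V := volume (Metric.closedBall (0 : E d) (R + 1)) ^ (1 / (2 : ℝ≥0∞).toReal)
  have hV : V ≠ ⊤ := ENNReal.rpow_ne_top_of_nonneg (by positivity) hmeas
  have huc : UniformContinuous g := hgs.uniformContinuous_of_continuous hg
  -- a uniform bound of the difference, which is supported in a fixed ball
  have key : ∀ ε > (0 : ℝ), ∀ᶠ k in atTop,
      eLpNorm (mollify k g - g) 2 volume ≤ V * ENNReal.ofReal ε := by
    intro ε hε
    obtain ⟨δ, hδ, hu⟩ := Metric.uniformContinuous_iff.1 huc ε hε
    filter_upwards [(tendsto_one_div_add_atTop_nhds_zero_nat (𝕜 := ℝ)).eventually_lt_const hδ]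
      with k hk
    have h1 : ∀ x, ‖mollify k g x - g x‖ ≤ ε := by
      intro x
      rw [← dist_eq_norm]
      refine ContDiffBump.dist_normed_convolution_le hg.aestronglyMeasurable fun y hy => ?_
      refine (hu ?_).le
      exact (Metric.mem_ball.1 hy).trans hk
    have h2 : ∀ x, R + 1 < ‖x‖ → mollify k g x - g x = 0 := by
      intro x hx
      rw [hsupp x (by linarith), sub_zero, mollify_apply]
      refine integral_eq_zero_of_ae (Eventually.of_forall fun t => ?_)
      by_cases ht : 1 / ((k : ℝ) + 1) ≤ ‖t‖
      · simp [mollifier_eq_zero ht]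
      · have h3 : 1 / ((k : ℝ) + 1) ≤ 1 := by
          rw [div_le_one (by positivity)]; linarith [(k.cast_nonneg : (0 : ℝ) ≤ k)]
        have h4 := norm_sub_norm_le x t
        simp only [Pi.zero_apply]
        rw [hsupp (x - t) (by push Not at ht; linarith), mul_zero]
    have h3 : eLpNorm (mollify k g - g) 2 volume
        = eLpNorm (mollify k g - g) 2 (volume.restrict (Metric.closedBall 0 (R + 1))) := by
      rw [eLpNorm_restrict_eq_of_support_subset]
      intro x hx
      by_contra h
      exact hx (h2 x (by simpa using h))
    rw [h3]
    refine (eLpNorm_le_of_ae_bound (C := ε) (Eventually.of_forall h1)).trans ?_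
    simp [V]
  rw [ENNReal.tendsto_nhds_zero]
  intro η hη
  obtain ⟨ε, hε, hε'⟩ : ∃ ε > (0 : ℝ), V * ENNReal.ofReal ε ≤ η := by
    rcases eq_or_ne η ⊤ with rfl | hη'
    · exact ⟨1, one_pos, le_top⟩
    have hη0 : 0 < η.toReal := ENNReal.toReal_pos hη.ne' hη'
    refine ⟨η.toReal / (V.toReal + 1), by positivity, ?_⟩
    rw [← ENNReal.ofReal_toReal hV, ← ENNReal.ofReal_mul ENNReal.toReal_nonneg,
      ENNReal.toReal_ofReal ENNReal.toReal_nonneg]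
    refine ENNReal.ofReal_le_of_le_toReal ?_
    rw [mul_div_assoc', div_le_iff₀ (by positivity)]
    nlinarith [ENNReal.toReal_nonneg (a := V)]
  exact (key ε hε).mono fun k hk => hk.trans hε'

theorem mollify_tendsto_of_memLp {f : E d → ℝ} (hf : MemLp f 2 volume) :
    Tendsto (fun k => eLpNorm (mollify k f - f) 2 volume) atTop (𝓝 0) := by
  rw [ENNReal.tendsto_nhds_zero]
  intro η hη
  have hη3 : η / 3 ≠ 0 := (ENNReal.div_pos hη.ne' (by norm_num)).ne'
  obtain ⟨g, hgs, hfg, hgc, hg⟩ := hf.exists_hasCompactSupport_eLpNorm_sub_le (by norm_num) hη3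
  have := (ENNReal.tendsto_nhds_zero.1 (mollify_sub_tendsto_of_continuous hgc hgs)) (η / 3)
    (pos_iff_ne_zero.2 hη3)
  filter_upwards [this] with k hk
  have hfl : LocallyIntegrable f := hf.locallyIntegrable (by norm_num)
  have hgl : LocallyIntegrable g := hgc.locallyIntegrable
  have hmc : ∀ f : E d → ℝ, LocallyIntegrable f → AEStronglyMeasurable (mollify k f) volume :=
    fun f hf => ((mollifier_hasCompactSupport k).contDiff_convolution_left _
      (mollifier_contDiff k) hf).continuous.aestronglyMeasurable
  have e : mollify k f - f = (mollify k (f - g) + (mollify k g - g)) + (g - f) := by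
    rw [mollify_sub k hfl hgl]; ring
  rw [e]
  refine (eLpNorm_add_le (((hmc _ (hfl.sub hgl)).add ((hmc _ hgl).sub hg.1))) (hg.1.sub hf.1)
    (by norm_num)).trans ?_
  refine (add_le_add_left (eLpNorm_add_le (hmc _ (hfl.sub hgl)) ((hmc _ hgl).sub hg.1)
    (by norm_num)) _).trans ?_
  calc _ ≤ (η / 3 + η / 3) + η / 3 := by
        gcongr
        · exact (eLpNorm_mollify_le k (hf.1.sub hg.1)).trans hfg
        · rw [eLpNorm_sub_comm]; exact hfg
    _ = η := ENNReal.add_thirds η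

theorem mollify_contDiff (k : ℕ) {f : E d → ℝ} (hf : LocallyIntegrable f) :
    ContDiff ℝ ∞ (mollify k f) :=
  (mollifier_hasCompactSupport k).contDiff_convolution_left _ (mollifier_contDiff k) hf

/-- Mollifications converge in `L²_loc`. -/
theorem convLoc_mollify {f : E d → ℝ} (hf : MemLpLoc 2 f) :
    ConvLoc 2 (fun k => mollify k f) f := by
  have hfl := hf.mono_exponent.locallyIntegrable
  refine ⟨fun k => (mollify_contDiff k hfl).continuous.memLpLoc, hf, fun R => ?_⟩
  set B := Metric.closedBall (0 : E d) (R + 1)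
  have hB : MemLp (B.indicator f) 2 volume :=
    (memLp_indicator_iff_restrict measurableSet_closedBall).2 (hf (R + 1))
  refine tendsto_of_tendsto_of_tendsto_of_le_of_le tendsto_const_nhds
    (mollify_tendsto_of_memLp hB) (fun _ => zero_le) fun k => ?_
  refine le_trans (le_of_eq ?_) (eLpNorm_mono_measure (mollify k (B.indicator f) - B.indicator f)
    (Measure.restrict_le_self (s := Metric.closedBall (0 : E d) R)))
  refine eLpNorm_congr_ae ?_
  filter_upwards [ae_restrict_mem measurableSet_closedBall] with x hx
  have hx' : ‖x‖ ≤ R := by simpa using hx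
  have h1 : B.indicator f x = f x := indicator_of_mem (by simp [B]; linarith) f
  simp only [Pi.sub_apply, h1, mollify_apply]
  congr 1
  refine integral_congr_ae (Eventually.of_forall fun t => ?_)
  by_cases ht : 1 / ((k : ℝ) + 1) ≤ ‖t‖
  · simp [mollifier_eq_zero ht]
  · have h3 : 1 / ((k : ℝ) + 1) ≤ 1 := by
      rw [div_le_one (by positivity)]; linarith [(k.cast_nonneg : (0 : ℝ) ≤ k)]
    have h4 := norm_sub_le x t
    have : x - t ∈ B := by simp only [B, Metric.mem_closedBall, dist_zero_right]; push Not at ht; linarith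
    simp only [indicator_of_mem this]

theorem mollifier_reflect_isTestFunction (k : ℕ) (x : E d) :
    IsTestFunction univ (fun y => mollifier d k (x - y)) := by
  refine ⟨(mollifier_contDiff k).comp (contDiff_const.sub contDiff_id), ?_, subset_univ _⟩
  exact (mollifier_hasCompactSupport k).comp_homeomorph (Homeomorph.subLeft x)

theorem partialDeriv_mollifier_reflect (k : ℕ) (x y : E d) (i : Fin d) :
    partialDeriv i (fun y => mollifier d k (x - y)) y = -partialDeriv i (mollifier d k) (x - y) := by
  unfold partialDeriv
  have h1 : HasFDerivAt (mollifier d k) (fderiv ℝ (mollifier d k) (x - y)) (x - y) :=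
    ((mollifier_contDiff k).differentiable (by norm_num) _).hasFDerivAt
  have h2 : HasFDerivAt (fun y => x - y) (-ContinuousLinearMap.id ℝ (E d)) y :=
    (hasFDerivAt_id y).const_sub x
  have := h1.comp y h2
  rw [show (fun y => mollifier d k (x - y)) = mollifier d k ∘ fun y => x - y from rfl, this.fderiv]
  simp

/-- The partial derivatives of a mollification, with the derivative on the test function. -/
theorem partialDeriv_mollify (k : ℕ) {f : E d → ℝ} (hf : LocallyIntegrable f) (i : Fin d)
    (x : E d) : partialDeriv i (mollify k f) x
      = -∫ y, partialDeriv i (fun y => mollifier d k (x - y)) y * f y := by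
  have h := (mollifier_hasCompactSupport k).hasFDerivAt_convolution_left
    (ContinuousLinearMap.lsmul ℝ ℝ) ((mollifier_contDiff k).of_le (by norm_num)) hf x
  unfold partialDeriv mollify
  rw [h.fderiv]
  have hex : ConvolutionExistsAt (fderiv ℝ (mollifier d k)) f x
      (ContinuousLinearMap.precompL (E d) (ContinuousLinearMap.lsmul ℝ ℝ)) volume :=
    ((mollifier_hasCompactSupport k).fderiv ℝ).convolutionExists_left _
      ((mollifier_contDiff k).continuous_fderiv (by norm_num)) hf x
  rw [convolution_def, ContinuousLinearMap.integral_apply hex, ← integral_neg,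
    ← integral_sub_left_eq_self _ volume x]
  refine integral_congr_ae (Eventually.of_forall fun y => ?_)
  have := partialDeriv_mollifier_reflect k x y i
  unfold partialDeriv at this
  simp only [this]
  simp

end

/-! ### Integral identities for smooth functions and their limits -/

/-- The radial component `x · G(x)` of a vector field. -/
def radialPart {d : ℕ} (G : Fin d → E d → ℝ) (x : E d) : ℝ := ∑ i, x i * G i x

/-- The pointwise scalar product of two vector fields. -/
def dotProd {d : ℕ} (G H : Fin d → E d → ℝ) (x : E d) : ℝ := ∑ i, G i x * H i x

/-- The gradient of a real function, as the family of its partial derivatives. -/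
noncomputable def grad {d : ℕ} (w : E d → ℝ) : Fin d → E d → ℝ := fun i => partialDeriv i w

/-- The Laplacian of a smooth real function. -/
noncomputable def lap {d : ℕ} (w : E d → ℝ) (x : E d) : ℝ :=
  ∑ i, partialDeriv i (partialDeriv i w) x

/-- A sequence of smooth functions `w k` tending to `v` in `L²_loc`, with gradients tending to `Dv`
and Laplacians tending to `g` in `L²_loc`. -/
structure SmoothApprox {d : ℕ} (w : ℕ → E d → ℝ) (v : E d → ℝ) (Dv : Fin d → E d → ℝ)
    (g : E d → ℝ) : Prop where
  smooth : ∀ k, ContDiff ℝ ∞ (w k)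
  conv : ConvLoc 2 w v
  conv_grad : ∀ i, ConvLoc 2 (fun k => grad (w k) i) (Dv i)
  conv_lap : ConvLoc 2 (fun k => lap (w k)) g

section
variable {d : ℕ}

theorem ConvLoc.tendsto_integral {F : ℕ → E d → ℝ} {f : E d → ℝ} (hF : ConvLoc 1 F f) {R : ℝ}
    (hFR : ∀ k x, R < ‖x‖ → F k x = 0) (hfR : ∀ x, R < ‖x‖ → f x = 0) :
    Tendsto (fun k => ∫ x, F k x) atTop (𝓝 (∫ x, f x)) := by
  set B := Metric.closedBall (0 : E d) R
  have hind : LocBdd (B.indicator fun _ => (1 : ℝ)) := by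
    refine ⟨(measurable_const.indicator measurableSet_closedBall).aestronglyMeasurable,
      fun _ => ⟨1, Eventually.of_forall fun x => ?_⟩⟩
    by_cases hx : x ∈ B <;> simp [hx]
  have e : ∀ f : E d → ℝ, (∀ x, R < ‖x‖ → f x = 0) →
      (fun x => B.indicator (fun _ => (1 : ℝ)) x * f x) = f := by
    intro f hf
    ext x
    by_cases hx : x ∈ B
    · simp [hx]
    · rw [hf x (by simpa [B] using hx), mul_zero]
  have := hF.tendsto_integral_mul hind (R := R) fun x hx => by simp [B, hx]
  rw [e f hfR] at this
  simpa only [e _ (hFR _)] using this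

theorem MemLpLoc.integrable {f : E d → ℝ} (hf : MemLpLoc 1 f) {R : ℝ}
    (hR : ∀ x, R < ‖x‖ → f x = 0) : Integrable f := by
  refine (integrableOn_iff_integrable_of_support_subset ?_).1 (memLp_one_iff_integrable.1 (hf R))
  intro x hx
  by_contra h
  exact hx (by simp [hR x (by simpa using h)])

theorem _root_.HasCompactSupport.exists_radius {φ : E d → ℝ} (h : HasCompactSupport φ) :
    ∃ R : ℝ, ∀ x, R < ‖x‖ → x ∉ tsupport φ := by
  obtain ⟨R, hR⟩ := h.isCompact.isBounded.subset_closedBall 0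
  refine ⟨R, fun x hx hxs => ?_⟩
  have := hR hxs
  simp at this
  linarith

theorem partialDeriv_eq_zero_of_notMem {φ : E d → ℝ} {x : E d} (hx : x ∉ tsupport φ) (i : Fin d) :
    partialDeriv i φ x = 0 := by
  have : fderiv ℝ φ x = 0 := by
    by_contra h
    exact hx (support_fderiv_subset ℝ h)
  simp [partialDeriv, this]

theorem _root_.ContDiff.partialDeriv {w : E d → ℝ} (hw : ContDiff ℝ ∞ w) (i : Fin d) :
    ContDiff ℝ ∞ (partialDeriv i w) :=
  (hw.fderiv_right (m := ∞) (by norm_num)).clm_apply contDiff_const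

theorem contDiff_coord {m : ℕ∞ω} (i : Fin d) : ContDiff ℝ m (fun x : E d => x i) := by
  fun_prop

theorem partialDeriv_mul {f g : E d → ℝ} (hf : ContDiff ℝ ∞ f) (hg : ContDiff ℝ ∞ g) (i : Fin d)
    (x : E d) : partialDeriv i (fun y => f y * g y) x
      = f x * partialDeriv i g x + partialDeriv i f x * g x := by
  unfold partialDeriv
  rw [fderiv_fun_mul (hf.differentiable (by norm_num) x) (hg.differentiable (by norm_num) x)]
  simp only [add_apply, smul_apply, smul_eq_mul]
  ring

theorem partialDeriv_sum {ι : Type*} (s : Finset ι) {f : ι → E d → ℝ}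
    (hf : ∀ j, ContDiff ℝ ∞ (f j)) (i : Fin d) (x : E d) :
    partialDeriv i (fun y => ∑ j ∈ s, f j y) x = ∑ j ∈ s, partialDeriv i (f j) x := by
  unfold partialDeriv
  rw [fderiv_fun_sum fun j _ => (hf j).differentiable (by norm_num) x]
  simp

theorem partialDeriv_sub {f g : E d → ℝ} (hf : ContDiff ℝ ∞ f) (hg : ContDiff ℝ ∞ g) (i : Fin d)
    (x : E d) : partialDeriv i (fun y => f y - g y) x
      = partialDeriv i f x - partialDeriv i g x := by
  unfold partialDeriv
  rw [fderiv_fun_sub (hf.differentiable (by norm_num) x) (hg.differentiable (by norm_num) x)]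
  simp

theorem partialDeriv_coord (i j : Fin d) (x : E d) :
    partialDeriv i (fun y : E d => y j) x = if j = i then 1 else 0 := by
  have h : HasFDerivAt (fun y : E d => y j) (EuclideanSpace.proj (𝕜 := ℝ) j : E d →L[ℝ] ℝ) x :=
    (EuclideanSpace.proj (𝕜 := ℝ) j : E d →L[ℝ] ℝ).hasFDerivAt
  unfold partialDeriv
  rw [h.fderiv]
  simp

theorem partialDeriv_comm {w : E d → ℝ} (hw : ContDiff ℝ ∞ w) (i j : Fin d) (x : E d) :
    partialDeriv i (partialDeriv j w) x = partialDeriv j (partialDeriv i w) x := by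
  have hs : IsSymmSndFDerivAt ℝ w x := hw.contDiffAt.isSymmSndFDerivAt (by
    rw [minSmoothness_of_isRCLikeNormedField]
    exact WithTop.coe_le_coe.2 le_top)
  have hd : DifferentiableAt ℝ (fderiv ℝ w) x :=
    (hw.fderiv_right (m := ∞) (by norm_num)).differentiable (by norm_num) x
  have key : ∀ a b : Fin d, partialDeriv a (partialDeriv b w) x
      = fderiv ℝ (fderiv ℝ w) x (EuclideanSpace.single a 1) (EuclideanSpace.single b 1) := by
    intro a b
    change fderiv ℝ (fun y => fderiv ℝ w y (EuclideanSpace.single b 1)) x _ = _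
    rw [fderiv_clm_apply hd (differentiableAt_const _)]
    simp
  rw [key, key]
  exact hs.eq _ _

theorem integral_partialDeriv_eq_zero {h : E d → ℝ} (hh : ContDiff ℝ ∞ h)
    (hs : HasCompactSupport h) (i : Fin d) : ∫ x, partialDeriv i h x = 0 := by
  have hc : Continuous (partialDeriv i h) := (hh.partialDeriv i).continuous
  have hcs : HasCompactSupport (partialDeriv i h) :=
    hs.mono' fun x hx => by
      by_contra hx'
      exact hx (partialDeriv_eq_zero_of_notMem hx' i)
  have := integral_mul_fderiv_eq_neg_fderiv_mul_of_integrable (μ := volume) (f := fun _ : E d => (1 : ℝ))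
    (g := h) (v := EuclideanSpace.single i (1 : ℝ)) (by simp)
    (by simpa [partialDeriv] using! hc.integrable_of_hasCompactSupport hcs)
    (by simpa using hh.continuous.integrable_of_hasCompactSupport hs)
    (fun _ _ => differentiableAt_const _) (fun x _ => hh.differentiable (by norm_num) x)
  simpa [partialDeriv] using this

/-- The divergence theorem for a smooth vector field times a test function. -/
theorem integral_div_eq_zero {χ : E d → ℝ} (hχ : IsTestFunction univ χ) {Y : Fin d → E d → ℝ}
    (hY : ∀ i, ContDiff ℝ ∞ (Y i)) :
    ∫ x, (χ x * ∑ i, partialDeriv i (Y i) x + dotProd (grad χ) Y x) = 0 := by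
  have h1 : ∀ i, ∫ x, partialDeriv i (fun y => χ y * Y i y) x = 0 := fun i =>
    integral_partialDeriv_eq_zero (hχ.1.mul (hY i)) hχ.2.1.mul_right i
  have h2 : ∀ i, Integrable (partialDeriv i (fun y => χ y * Y i y)) := fun i => by
    refine ((hχ.1.mul (hY i)).partialDeriv i).continuous.integrable_of_hasCompactSupport ?_
    refine (hχ.2.1.mul_right (f' := Y i)).mono' fun x hx => ?_
    by_contra hx'
    exact hx (partialDeriv_eq_zero_of_notMem hx' i)
  calc _ = ∫ x, ∑ i, partialDeriv i (fun y => χ y * Y i y) x := by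
        refine integral_congr_ae (Eventually.of_forall fun x => ?_)
        simp only [partialDeriv_mul hχ.1 (hY _), dotProd, grad, Finset.sum_add_distrib,
          Finset.mul_sum]
    _ = 0 := by
        rw [integral_finsetSum _ fun i _ => h2 i]
        simp [h1]

theorem contDiff_radialPart_grad {w : E d → ℝ} (hw : ContDiff ℝ ∞ w) :
    ContDiff ℝ ∞ (radialPart (grad w)) :=
  ContDiff.sum fun i _ => (contDiff_coord i).mul (hw.partialDeriv i)

theorem contDiff_dotProd_grad {w : E d → ℝ} (hw : ContDiff ℝ ∞ w) :
    ContDiff ℝ ∞ (dotProd (grad w) (grad w)) :=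
  ContDiff.sum fun i _ => (hw.partialDeriv i).mul (hw.partialDeriv i)

/-- The divergence of the Pohozaev (Rellich) vector field `(x · ∇w) ∇w - |∇w|² x / 2`. -/
theorem div_pohozaev {w : E d → ℝ} (hw : ContDiff ℝ ∞ w) (x : E d) :
    ∑ i, partialDeriv i (fun y => radialPart (grad w) y * grad w i y
        - y i * (dotProd (grad w) (grad w) y / 2)) x
      = radialPart (grad w) x * lap w x + (1 - d / 2) * dotProd (grad w) (grad w) x := by
  have hp : ∀ i, ContDiff ℝ ∞ (grad w i) := hw.partialDeriv
  have hX := contDiff_radialPart_grad hw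
  have hS := contDiff_dotProd_grad hw
  have hS2 : ContDiff ℝ ∞ (fun y => dotProd (grad w) (grad w) y / 2) := hS.div_const 2
  have dX : ∀ i, partialDeriv i (radialPart (grad w)) x
      = grad w i x + ∑ j, x j * partialDeriv i (grad w j) x := by
    intro i
    unfold radialPart
    rw [partialDeriv_sum _ fun j => (contDiff_coord j).mul (hp j)]
    simp only [partialDeriv_mul (contDiff_coord _) (hp _), partialDeriv_coord,
      Finset.sum_add_distrib]
    simp [add_comm]
  have dS : ∀ i, partialDeriv i (fun y => dotProd (grad w) (grad w) y / 2) x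
      = ∑ j, grad w j x * partialDeriv i (grad w j) x := by
    intro i
    have : (fun y => dotProd (grad w) (grad w) y / 2)
        = fun y => ∑ j, (fun _ : E d => (1 / 2 : ℝ)) y * (grad w j y * grad w j y) := by
      ext y; simp only [dotProd, Finset.sum_div]; exact Finset.sum_congr rfl fun _ _ => by ring
    rw [this, partialDeriv_sum _ fun j => contDiff_const.mul ((hp j).mul (hp j))]
    refine Finset.sum_congr rfl fun j _ => ?_
    rw [partialDeriv_mul contDiff_const ((hp j).mul (hp j)), partialDeriv_mul (hp j) (hp j)]
    simp [partialDeriv]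
    ring
  have e : ∀ i, partialDeriv i (fun y => radialPart (grad w) y * grad w i y
        - y i * (dotProd (grad w) (grad w) y / 2)) x
      = radialPart (grad w) x * partialDeriv i (partialDeriv i w) x + grad w i x * grad w i x
        + ∑ j, x j * grad w i x * partialDeriv i (grad w j) x
        - ∑ j, x i * grad w j x * partialDeriv i (grad w j) x
        - dotProd (grad w) (grad w) x / 2 := by
    intro i
    rw [partialDeriv_sub (hX.mul (hp i)) ((contDiff_coord i).mul hS2),
      partialDeriv_mul hX (hp i), partialDeriv_mul (contDiff_coord i) hS2, dX, dS,
      partialDeriv_coord]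
    have e1 : ∑ j, x j * grad w i x * partialDeriv i (grad w j) x
        = (∑ j, x j * partialDeriv i (grad w j) x) * grad w i x := by
      rw [Finset.sum_mul]; exact Finset.sum_congr rfl fun _ _ => by ring
    have e2 : ∑ j, x i * grad w j x * partialDeriv i (grad w j) x
        = x i * ∑ j, grad w j x * partialDeriv i (grad w j) x := by
      rw [Finset.mul_sum]; exact Finset.sum_congr rfl fun _ _ => by ring
    rw [e1, e2]
    simp only [if_true, grad]
    ring
  simp only [e, Finset.sum_sub_distrib, Finset.sum_add_distrib]
  have sw : ∑ i, ∑ j, x j * grad w i x * partialDeriv i (grad w j) x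
      = ∑ i, ∑ j, x i * grad w j x * partialDeriv i (grad w j) x := by
    rw [Finset.sum_comm]
    refine Finset.sum_congr rfl fun i _ => Finset.sum_congr rfl fun j _ => ?_
    rw [show partialDeriv j (grad w i) x = partialDeriv i (grad w j) x from
      partialDeriv_comm hw j i x]
  rw [sw]
  rw [← Finset.mul_sum, show ∑ i, grad w i x * grad w i x = dotProd (grad w) (grad w) x from rfl,
    show ∑ i, partialDeriv i (partialDeriv i w) x = lap w x from rfl]
  simp only [Finset.sum_const, Finset.card_univ, Fintype.card_fin, nsmul_eq_mul]
  ring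

theorem div_mul_grad {w : E d → ℝ} (hw : ContDiff ℝ ∞ w) (x : E d) :
    ∑ i, partialDeriv i (fun y => w y * grad w i y) x
      = w x * lap w x + dotProd (grad w) (grad w) x := by
  simp only [grad, partialDeriv_mul hw (hw.partialDeriv _), lap, dotProd, Finset.sum_add_distrib,
    Finset.mul_sum]

theorem ConvLoc.radialPart {G : ℕ → Fin d → E d → ℝ} {g : Fin d → E d → ℝ}
    (h : ∀ i, ConvLoc 2 (fun k => G k i) (g i)) :
    ConvLoc 2 (fun k => radialPart (G k)) (radialPart g) :=
  ConvLoc.sum (by norm_num) _ fun i _ => (h i).bdd_mul (contDiff_coord (m := ∞) i).continuous.locBdd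

theorem ConvLoc.dotProd {G : ℕ → Fin d → E d → ℝ} {g : Fin d → E d → ℝ}
    (h : ∀ i, ConvLoc 2 (fun k => G k i) (g i)) :
    ConvLoc 1 (fun k => dotProd (G k) (G k)) (dotProd g g) :=
  ConvLoc.sum le_rfl _ fun i _ => (h i).mul (h i)

theorem ConvLoc.dotProd_left {H : Fin d → E d → ℝ} (hH : ∀ i, Continuous (H i)) {p : ℝ≥0∞}
    (hp : 1 ≤ p) {G : ℕ → Fin d → E d → ℝ} {g : Fin d → E d → ℝ}
    (h : ∀ i, ConvLoc p (fun k => G k i) (g i)) :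
    ConvLoc p (fun k => Helmholtz.dotProd H (G k)) (Helmholtz.dotProd H g) :=
  ConvLoc.sum hp _ fun i _ => (h i).bdd_mul (hH i).locBdd

theorem dotProd_grad_eq_zero {χ : E d → ℝ} {x : E d} (hx : x ∉ tsupport χ) (G : Fin d → E d → ℝ) :
    dotProd (grad χ) G x = 0 :=
  Finset.sum_eq_zero fun i _ => by simp [grad, partialDeriv_eq_zero_of_notMem hx i]

theorem IsTestFunction.grad_continuous {Ω : Set (E d)} {χ : E d → ℝ} (hχ : IsTestFunction Ω χ)
    (i : Fin d) : Continuous (grad χ i) := (hχ.1.partialDeriv i).continuous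

namespace SmoothApprox
variable {w : ℕ → E d → ℝ} {v g : E d → ℝ} {Dv : Fin d → E d → ℝ}

theorem memLpLoc (h : SmoothApprox w v Dv g) : MemLpLoc 2 v := h.conv.2
theorem memLpLoc_grad (h : SmoothApprox w v Dv g) (i : Fin d) : MemLpLoc 2 (Dv i) :=
  (h.conv_grad i).2

/-- `∇(v²) = 2 v ∇v` in the sense of distributions. -/
theorem integral_sq (h : SmoothApprox w v Dv g) {ψ : E d → ℝ} (hψ : IsTestFunction univ ψ)
    (i : Fin d) :
    ∫ x, (2 * ψ x * (v x * Dv i x) + partialDeriv i ψ x * (v x * v x)) = 0 := by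
  obtain ⟨R, hR⟩ := hψ.2.1.exists_radius
  have hψ0 : ∀ x, R < ‖x‖ → ψ x = 0 := fun x hx => image_eq_zero_of_notMem_tsupport (hR x hx)
  have hψ1 : ∀ x, R < ‖x‖ → partialDeriv i ψ x = 0 := fun x hx =>
    partialDeriv_eq_zero_of_notMem (hR x hx) i
  have c1 : Continuous fun x => 2 * ψ x := continuous_const.mul hψ.1.continuous
  have conv := ((h.conv.mul (h.conv_grad i)).bdd_mul c1.locBdd).add le_rfl
    ((h.conv.mul h.conv).bdd_mul (hψ.grad_continuous i).locBdd)
  refine tendsto_nhds_unique (conv.tendsto_integral (R := R) (fun k x hx => ?_) fun x hx => ?_) ?_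
  · simp [hψ0 x hx, grad, hψ1 x hx]
  · simp [hψ0 x hx, grad, hψ1 x hx]
  · refine tendsto_const_nhds.congr fun k => ?_
    have hw := h.smooth k
    rw [← integral_partialDeriv_eq_zero (hψ.1.mul (hw.mul hw)) hψ.2.1.mul_right i]
    refine integral_congr_ae (Eventually.of_forall fun x => ?_)
    simp only [partialDeriv_mul hψ.1 (hw.mul hw), partialDeriv_mul hw hw, grad]
    ring

/-- The local energy identity, i.e. the equation tested against `χ v`. -/
theorem integral_energy (h : SmoothApprox w v Dv g) {χ : E d → ℝ} (hχ : IsTestFunction univ χ) :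
    ∫ x, (χ x * (v x * g x + dotProd Dv Dv x) + v x * dotProd (grad χ) Dv x) = 0 := by
  obtain ⟨R, hR⟩ := hχ.2.1.exists_radius
  have hχ0 : ∀ x, R < ‖x‖ → χ x = 0 := fun x hx => image_eq_zero_of_notMem_tsupport (hR x hx)
  have conv := (((h.conv.mul h.conv_lap).add le_rfl (ConvLoc.dotProd h.conv_grad)).bdd_mul
    hχ.1.continuous.locBdd).add le_rfl (h.conv.mul
      (ConvLoc.dotProd_left hχ.grad_continuous (by norm_num) h.conv_grad))
  refine tendsto_nhds_unique (conv.tendsto_integral (R := R) (fun k x hx => ?_) fun x hx => ?_) ?_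
  · simp [hχ0 x hx, dotProd_grad_eq_zero (hR x hx)]
  · simp [hχ0 x hx, dotProd_grad_eq_zero (hR x hx)]
  · refine tendsto_const_nhds.congr fun k => ?_
    have hw := h.smooth k
    rw [← integral_div_eq_zero hχ (Y := fun i y => w k y * grad (w k) i y)
      fun i => hw.mul (hw.partialDeriv i)]
    refine integral_congr_ae (Eventually.of_forall fun x => ?_)
    simp only [div_mul_grad hw]
    congr 1
    simp only [dotProd, Finset.mul_sum]
    exact Finset.sum_congr rfl fun _ _ => by ring

/-- The Pohozaev (Rellich) identity with cut-off `χ`. -/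
theorem integral_pohozaev (h : SmoothApprox w v Dv g) {χ : E d → ℝ}
    (hχ : IsTestFunction univ χ) :
    ∫ x, (χ x * (radialPart Dv x * g x + (1 - d / 2) * dotProd Dv Dv x)
      + (radialPart Dv x * dotProd (grad χ) Dv x
        - radialPart (grad χ) x / 2 * dotProd Dv Dv x)) = 0 := by
  obtain ⟨R, hR⟩ := hχ.2.1.exists_radius
  have hχ0 : ∀ x, R < ‖x‖ → χ x = 0 := fun x hx => image_eq_zero_of_notMem_tsupport (hR x hx)
  have hχr : ∀ x, R < ‖x‖ → radialPart (grad χ) x = 0 := fun x hx =>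
    Finset.sum_eq_zero fun i _ => by simp [grad, partialDeriv_eq_zero_of_notMem (hR x hx) i]
  have cr : Continuous fun x => radialPart (grad χ) x / 2 :=
    (contDiff_radialPart_grad hχ.1).continuous.div_const 2
  have cX := ConvLoc.radialPart h.conv_grad
  have cS := ConvLoc.dotProd h.conv_grad
  have conv := (((cX.mul h.conv_lap).add le_rfl (cS.bdd_mul
    (continuous_const (y := (1 - d / 2 : ℝ))).locBdd)).bdd_mul hχ.1.continuous.locBdd).add le_rfl
    ((cX.mul (ConvLoc.dotProd_left hχ.grad_continuous (by norm_num) h.conv_grad)).sub le_rfl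
      (cS.bdd_mul cr.locBdd))
  refine tendsto_nhds_unique (conv.tendsto_integral (R := R) (fun k x hx => ?_) fun x hx => ?_) ?_
  · simp [hχ0 x hx, hχr x hx, dotProd_grad_eq_zero (hR x hx)]
  · simp [hχ0 x hx, hχr x hx, dotProd_grad_eq_zero (hR x hx)]
  · refine tendsto_const_nhds.congr fun k => ?_
    have hw := h.smooth k
    rw [← integral_div_eq_zero hχ (Y := fun i y => radialPart (grad (w k)) y * grad (w k) i y
        - y i * (dotProd (grad (w k)) (grad (w k)) y / 2))
      fun i => ((contDiff_radialPart_grad hw).mul (hw.partialDeriv i)).sub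
        ((contDiff_coord i).mul ((contDiff_dotProd_grad hw).div_const 2))]
    refine integral_congr_ae (Eventually.of_forall fun x => ?_)
    simp only [div_pohozaev hw]
    congr 1
    have e1 : dotProd (grad χ) (fun i y => radialPart (grad (w k)) y * grad (w k) i y
        - y i * (dotProd (grad (w k)) (grad (w k)) y / 2)) x
        = ∑ i, (radialPart (grad (w k)) x * (grad χ i x * grad (w k) i x)
          - x i * grad χ i x * (dotProd (grad (w k)) (grad (w k)) x / 2)) :=
      Finset.sum_congr rfl fun _ _ => by ring
    rw [e1, Finset.sum_sub_distrib, ← Finset.mul_sum, ← Finset.sum_mul]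
    simp only [radialPart, dotProd]
    ring

end SmoothApprox
end

/-! ### Smooth approximation of weak solutions -/

section
variable {d : ℕ}

theorem integral_mollifier_reflect (k : ℕ) (f : E d → ℝ) (x : E d) :
    ∫ y, mollifier d k (x - y) * f y = mollify k f x := by
  rw [mollify_apply, ← integral_sub_left_eq_self _ volume x]
  simp

theorem partialDeriv_mollify_of_weak (k : ℕ) {v : E d → ℝ} {Dv : Fin d → E d → ℝ}
    (h : HasWeakGradientOn univ v Dv) (i : Fin d) :
    partialDeriv i (mollify k v) = mollify k (Dv i) := by
  ext x
  rw [partialDeriv_mollify k (locallyIntegrableOn_univ.1 h.1)]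
  have := h.2.2 _ (mollifier_reflect_isTestFunction k x) i
  simp only [smul_eq_mul] at this
  rw [this, neg_neg, integral_mollifier_reflect]

/-- Mollification provides smooth approximations of a weak solution of `Δv = g`. -/
theorem smoothApprox_mollify {v g : E d → ℝ} {Dv : Fin d → E d → ℝ} (hv : MemLpLoc 2 v)
    (hDv : ∀ i, MemLpLoc 2 (Dv i)) (hg : MemLpLoc 2 g) (hw : HasWeakGradientOn univ v Dv)
    (heq : ∀ φ : E d → ℝ, IsTestFunction univ φ →
      ∑ i, ∫ x, partialDeriv i φ x * Dv i x = -∫ x, φ x * g x) :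
    SmoothApprox (fun k => mollify k v) v Dv g := by
  have hl := fun i => (hDv i).mono_exponent.locallyIntegrable
  have e1 : ∀ k i, grad (mollify k v) i = mollify k (Dv i) := fun k i =>
    partialDeriv_mollify_of_weak k hw i
  refine ⟨fun k => mollify_contDiff k hv.mono_exponent.locallyIntegrable, convLoc_mollify hv,
    fun i => ?_, ?_⟩
  · simp only [e1]
    exact convLoc_mollify (hDv i)
  · have e2 : ∀ k, lap (mollify k v) = mollify k g := by
      intro k
      ext x
      have h1 : ∀ i, partialDeriv i (partialDeriv i (mollify k v)) x
          = -∫ y, partialDeriv i (fun y => mollifier d k (x - y)) y * Dv i y := by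
        intro i
        rw [show partialDeriv i (mollify k v) = mollify k (Dv i) from e1 k i,
          partialDeriv_mollify k (hl i)]
      simp only [lap, h1, Finset.sum_neg_distrib]
      rw [heq _ (mollifier_reflect_isTestFunction k x), neg_neg, integral_mollifier_reflect]
    simp only [e2]
    exact convLoc_mollify hg

/-! ### The radial decrease of the potential -/

/-- The essential supremum `β_j` of `(x · ∇n)₋ / n` on the annulus `C(j)`, as a real number. -/
noncomputable def annulusDecrease (n : E d → ℝ) (Dn : Fin d → E d → ℝ) (j : ℤ) : ℝ :=
  (essSup (fun x => ENNReal.ofReal (radialDecrease n Dn x)) (volume.restrict (annulus d j))).toReal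

/-- The step function of the radius with value `β_j` on `[2^j, 2^(j+1))`. -/
noncomputable def decreaseRate (n : E d → ℝ) (Dn : Fin d → E d → ℝ) (r : ℝ) : ℝ :=
  annulusDecrease n Dn ⌊Real.logb 2 r⌋

theorem annulusDecrease_nonneg (n : E d → ℝ) (Dn : Fin d → E d → ℝ) (j : ℤ) :
    0 ≤ annulusDecrease n Dn j := ENNReal.toReal_nonneg

theorem decreaseRate_nonneg (n : E d → ℝ) (Dn : Fin d → E d → ℝ) (r : ℝ) :
    0 ≤ decreaseRate n Dn r := annulusDecrease_nonneg _ _ _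

theorem measurable_decreaseRate (n : E d → ℝ) (Dn : Fin d → E d → ℝ) :
    Measurable (decreaseRate n Dn) :=
  (measurable_from_top (f := annulusDecrease n Dn)).comp
    (Int.measurable_floor.comp (Real.measurable_log.div_const _))

theorem floor_logb_eq_iff {r : ℝ} (hr : 0 < r) (j : ℤ) :
    ⌊Real.logb 2 r⌋ = j ↔ (2 : ℝ) ^ j ≤ r ∧ r < (2 : ℝ) ^ (j + 1) := by
  rw [Int.floor_eq_iff, Real.le_logb_iff_rpow_le one_lt_two hr, Real.rpow_intCast,
    show (j : ℝ) + 1 = ((j + 1 : ℤ) : ℝ) by push_cast; ring,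
    Real.logb_lt_iff_lt_rpow one_lt_two hr, Real.rpow_intCast]

theorem decreaseRate_of_mem {r : ℝ} (n : E d → ℝ) (Dn : Fin d → E d → ℝ) {j : ℤ}
    (h1 : (2 : ℝ) ^ j ≤ r) (h2 : r < (2 : ℝ) ^ (j + 1)) :
    decreaseRate n Dn r = annulusDecrease n Dn j := by
  rw [decreaseRate, (floor_logb_eq_iff (lt_of_lt_of_le (by positivity) h1) j).2 ⟨h1, h2⟩]

variable {n : E d → ℝ} {Dn : Fin d → E d → ℝ}

theorem annulusDecrease_tsum_lt (hβ : betaConst n Dn < 1) :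
    Summable (annulusDecrease n Dn) ∧ ∑' j, annulusDecrease n Dn j < 1 / 2 := by
  unfold betaConst at hβ
  set e : ℤ → ℝ≥0∞ := fun j => essSup (fun x => ENNReal.ofReal (radialDecrease n Dn x))
    (volume.restrict (annulus d j))
  have h1 : ∑' j, e j < 1 / 2 := by
    rw [ENNReal.lt_div_iff_mul_lt (by simp) (by simp), mul_comm]
    exact hβ
  have h2 : ∑' j, e j ≠ ⊤ := (h1.trans_le le_top).ne
  refine ⟨ENNReal.summable_toReal h2, ?_⟩
  have h3 : ∑' j, annulusDecrease n Dn j = (∑' j, e j).toReal :=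
    (ENNReal.tsum_toReal_eq (ENNReal.ne_top_of_tsum_ne_top h2)).symm
  rw [h3]
  have := (ENNReal.toReal_lt_toReal h2 (by simp)).2 h1
  simpa using this

theorem annulusDecrease_le (hβ : betaConst n Dn < 1) (j : ℤ) : annulusDecrease n Dn j ≤ 1 / 2 :=
  ((annulusDecrease_tsum_lt hβ).1.le_tsum j fun _ _ => annulusDecrease_nonneg _ _ _).trans
    (annulusDecrease_tsum_lt hβ).2.le

theorem decreaseRate_le (hβ : betaConst n Dn < 1) (r : ℝ) : decreaseRate n Dn r ≤ 1 / 2 :=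
  annulusDecrease_le hβ _

theorem ae_ne_zero [NeZero d] : ∀ᵐ x : E d, x ≠ 0 := by
  simp [ae_iff]

/-- The bound `(x · ∇n)₋ ≤ b(|x|) n`, without the quotient and with `b` a function of the radius. -/
theorem ae_radial_lower_bound [NeZero d] (hpos : ∀ᵐ x : E d, 0 < n x) (hβ : betaConst n Dn < 1) :
    ∀ᵐ x : E d, -radialPart Dn x ≤ decreaseRate n Dn ‖x‖ * n x := by
  have hfin : ∀ j, essSup (fun x => ENNReal.ofReal (radialDecrease n Dn x))
      (volume.restrict (annulus d j)) ≠ ⊤ := by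
    intro j hj
    unfold betaConst at hβ
    rw [ENNReal.tsum_eq_top_of_eq_top ⟨j, hj⟩] at hβ
    simp at hβ
  have hmeas : ∀ j, MeasurableSet (annulus d j) := fun j =>
    (measurableSet_le measurable_const measurable_norm).inter
      (measurableSet_le measurable_norm measurable_const)
  have h1 : ∀ᵐ x : E d, ∀ j : ℤ, x ∈ annulus d j →
      radialDecrease n Dn x ≤ annulusDecrease n Dn j := by
    rw [ae_all_iff]
    intro j
    rw [← ae_restrict_iff' (hmeas j)]
    filter_upwards [ENNReal.ae_le_essSup (μ := volume.restrict (annulus d j))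
      (fun x => ENNReal.ofReal (radialDecrease n Dn x))] with x hx
    exact (ENNReal.ofReal_le_iff_le_toReal (hfin j)).1 hx
  filter_upwards [h1, hpos, ae_ne_zero] with x hx hx0 hxne
  have hr : 0 < ‖x‖ := norm_pos_iff.2 hxne
  have h3 := (floor_logb_eq_iff hr ⌊Real.logb 2 ‖x‖⌋).1 rfl
  have h2 := hx ⌊Real.logb 2 ‖x‖⌋ ⟨h3.1, h3.2.le⟩
  unfold radialDecrease at h2
  rw [div_le_iff₀ hx0] at h2
  exact (le_max_left _ _).trans h2

end

section
variable {d : ℕ} {n : E d → ℝ} {Dn : Fin d → E d → ℝ}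

theorem integrable_mul_of_locallyIntegrableOn {Ω : Set (E d)} {c g : E d → ℝ} (hc : Continuous c)
    (hcs : HasCompactSupport c) (hcΩ : tsupport c ⊆ Ω) (hg : LocallyIntegrableOn g Ω) :
    Integrable (fun x => c x * g x) := by
  have h1 : IntegrableOn (fun x => c x * g x) (tsupport c) :=
    (hg.integrableOn_compact_subset hcΩ hcs.isCompact).continuousOn_mul hc.continuousOn
      hcs.isCompact
  refine (integrableOn_iff_integrable_of_support_subset ?_).1 h1
  intro x hx
  exact subset_tsupport _ (left_ne_zero_of_mul hx)

theorem tsupport_partialDeriv_subset (φ : E d → ℝ) (i : Fin d) :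
    tsupport (partialDeriv i φ) ⊆ tsupport φ := by
  refine closure_minimal (fun x hx => ?_) (isClosed_tsupport φ)
  by_contra h
  exact hx (partialDeriv_eq_zero_of_notMem h i)

theorem tsupport_radialPart_grad_subset (φ : E d → ℝ) :
    tsupport (radialPart (grad φ)) ⊆ tsupport φ := by
  refine closure_minimal (fun x hx => ?_) (isClosed_tsupport φ)
  by_contra h
  exact hx (Finset.sum_eq_zero fun i _ => by simp [grad, partialDeriv_eq_zero_of_notMem h i])

theorem IsTestFunction.radialPart_hasCompactSupport {Ω : Set (E d)} {φ : E d → ℝ}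
    (h : IsTestFunction Ω φ) : HasCompactSupport (radialPart (grad φ)) :=
  h.2.1.mono' fun _ hx => tsupport_radialPart_grad_subset φ (subset_tsupport _ hx)

/-- The condition on `(x · ∇n)₋ / n`, tested against a nonnegative test function supported away
from the origin. -/
theorem integral_mul_div_le_of_notMem [NeZero d] (hpos : ∀ᵐ x : E d, 0 < n x)
    (hβ : betaConst n Dn < 1) (hDn : HasWeakGradientOn {0}ᶜ n Dn) {f : E d → ℝ}
    (hf : IsTestFunction {0}ᶜ f) (hf0 : ∀ x, 0 ≤ f x) :
    ∫ x, (d * f x + radialPart (grad f) x) * n x ≤ ∫ x, decreaseRate n Dn ‖x‖ * (f x * n x) := by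
  have hψ : ∀ i : Fin d, IsTestFunction {0}ᶜ (fun x : E d => x i * f x) := fun i =>
    ⟨(contDiff_coord i).mul hf.1, hf.2.1.mul_left,
      (tsupport_mul_subset_right (f := fun x : E d => x i)).trans hf.2.2⟩
  have hI : ∀ i : Fin d, Integrable (fun x => partialDeriv i (fun x : E d => x i * f x) x * n x) :=
    fun i => integrable_mul_of_locallyIntegrableOn ((hψ i).1.partialDeriv i).continuous
      ((hψ i).2.1.mono' fun _ hx => tsupport_partialDeriv_subset _ i (subset_tsupport _ hx))
      ((tsupport_partialDeriv_subset _ i).trans (hψ i).2.2) hDn.1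
  have hJ : ∀ i : Fin d, Integrable (fun x => x i * f x * Dn i x) := fun i =>
    integrable_mul_of_locallyIntegrableOn (hψ i).1.continuous (hψ i).2.1 (hψ i).2.2 (hDn.2.1 i)
  have hfn : Integrable (fun x => f x * n x) :=
    integrable_mul_of_locallyIntegrableOn hf.1.continuous hf.2.1 hf.2.2 hDn.1
  calc ∫ x, (d * f x + radialPart (grad f) x) * n x
      = ∑ i, ∫ x, partialDeriv i (fun x : E d => x i * f x) x * n x := by
        rw [← integral_finsetSum _ fun i _ => hI i]
        refine integral_congr_ae (Eventually.of_forall fun x => ?_)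
        simp only [partialDeriv_mul (contDiff_coord _) hf.1, partialDeriv_coord, ← Finset.sum_mul,
          Finset.sum_add_distrib, radialPart, grad]
        simp only [if_true, Finset.sum_const, Finset.card_univ, Fintype.card_fin,
          nsmul_eq_mul]
        ring
    _ = ∑ i, -∫ x, x i * f x * Dn i x := by
        refine Finset.sum_congr rfl fun i _ => ?_
        simpa only [smul_eq_mul] using hDn.2.2 _ (hψ i) i
    _ = ∫ x, f x * -radialPart Dn x := by
        rw [Finset.sum_neg_distrib, ← integral_finsetSum _ fun i _ => hJ i, ← integral_neg]
        refine integral_congr_ae (Eventually.of_forall fun x => ?_)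
        simp only [radialPart, mul_neg, Finset.mul_sum]
        congr 1
        exact Finset.sum_congr rfl fun _ _ => by ring
    _ ≤ _ := by
        refine integral_mono_ae ?_ ?_ ?_
        · have : Integrable fun x => -∑ i, x i * f x * Dn i x :=
            (integrable_finsetSum _ fun i _ => hJ i).neg
          refine this.congr (Eventually.of_forall fun x => ?_)
          simp only [radialPart, mul_neg, Finset.mul_sum]
          congr 1
          exact Finset.sum_congr rfl fun _ _ => by ring
        · refine hfn.bdd_mul (c := 1 / 2) ?_ (Eventually.of_forall fun x => ?_)
          · exact ((measurable_decreaseRate n Dn).comp measurable_norm).aestronglyMeasurable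
          · rw [Real.norm_of_nonneg (decreaseRate_nonneg _ _ _)]
            exact decreaseRate_le hβ _
        · filter_upwards [ae_radial_lower_bound hpos hβ] with x hx
          nlinarith [mul_le_mul_of_nonneg_left hx (hf0 x)]

/-! ### The potential is quasi-increasing along rays -/

/-- The interior of the annulus `C(j)`. -/
def openAnnulus (d : ℕ) (j : ℤ) : Set (E d) := {x | (2 : ℝ) ^ j < ‖x‖ ∧ ‖x‖ < (2 : ℝ) ^ (j + 1)}

theorem isOpen_openAnnulus (j : ℤ) : IsOpen (openAnnulus d j) :=
  (isOpen_lt continuous_const continuous_norm).inter (isOpen_lt continuous_norm continuous_const)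

theorem zero_notMem_openAnnulus (j : ℤ) : (0 : E d) ∉ openAnnulus d j := by
  intro h
  have h1 : (2 : ℝ) ^ j < ‖(0 : E d)‖ := h.1
  have : (0 : ℝ) < (2 : ℝ) ^ j := by positivity
  rw [norm_zero] at h1
  linarith

theorem tsupport_comp_smul {φ : E d → ℝ} {c : ℝ} (hc : c ≠ 0) :
    tsupport (fun y => φ (c • y)) = (fun y => c • y) ⁻¹' tsupport φ :=
  (tsupport_comp_eq_preimage φ (Homeomorph.smulOfNeZero c hc))

theorem IsTestFunction.comp_smul {Ω Ω' : Set (E d)} {φ : E d → ℝ} (h : IsTestFunction Ω φ) {c : ℝ}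
    (hc : c ≠ 0) (hΩ : ∀ y, c • y ∈ Ω → y ∈ Ω') : IsTestFunction Ω' (fun y => φ (c • y)) := by
  refine ⟨h.1.comp (contDiff_const_smul c), h.2.1.comp_homeomorph (Homeomorph.smulOfNeZero c hc),
    ?_⟩
  rw [tsupport_comp_smul hc]
  exact fun y hy => hΩ y (h.2.2 hy)

theorem partialDeriv_comp_smul {φ : E d → ℝ} (h : ContDiff ℝ ∞ φ) (c : ℝ) (i : Fin d) (y : E d) :
    partialDeriv i (fun y => φ (c • y)) y = c * partialDeriv i φ (c • y) := by
  have h1 : HasFDerivAt φ (fderiv ℝ φ (c • y)) (c • y) :=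
    (h.differentiable (by norm_num) _).hasFDerivAt
  have h2 : HasFDerivAt (fun y : E d => c • y) (c • ContinuousLinearMap.id ℝ (E d)) y :=
    (hasFDerivAt_id y).const_smul c
  have := h1.comp y h2
  unfold partialDeriv
  rw [show (fun y => φ (c • y)) = φ ∘ (fun y => c • y) from rfl, this.fderiv]
  simp

theorem radialPart_grad_comp_smul {φ : E d → ℝ} (h : ContDiff ℝ ∞ φ) (c : ℝ) (y : E d) :
    radialPart (grad fun y => φ (c • y)) y = radialPart (grad φ) (c • y) := by
  simp only [radialPart, grad, partialDeriv_comp_smul h]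
  exact Finset.sum_congr rfl fun i _ => by simp; ring

theorem sum_coord_mul_apply (L : E d →L[ℝ] ℝ) (y : E d) :
    ∑ i, y i * L (EuclideanSpace.single i 1) = L y := by
  have hy : y = ∑ i, y i • EuclideanSpace.single i (1 : ℝ) := by
    ext j
    simp [Finset.sum_apply, Pi.single_apply]
  conv_rhs => rw [hy]
  simp only [map_sum, map_smul, smul_eq_mul]

theorem hasDerivAt_comp_inv_smul {φ : E d → ℝ} (h : ContDiff ℝ ∞ φ) (y : E d) {s : ℝ}
    (hs : s ≠ 0) : HasDerivAt (fun s => φ (s⁻¹ • y)) (-(s⁻¹ * radialPart (grad φ) (s⁻¹ • y))) s := by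
  have h1 : HasFDerivAt φ (fderiv ℝ φ (s⁻¹ • y)) (s⁻¹ • y) :=
    (h.differentiable (by norm_num) _).hasFDerivAt
  have h2 : HasDerivAt (fun s : ℝ => s⁻¹ • y) ((-(s ^ 2)⁻¹) • y) s :=
    (hasDerivAt_inv hs).smul_const y
  have h3 := h1.comp_hasDerivAt s h2
  have h4 : radialPart (grad φ) (s⁻¹ • y) = s⁻¹ * fderiv ℝ φ (s⁻¹ • y) y := by
    rw [← smul_eq_mul, ← map_smul, ← sum_coord_mul_apply]
    rfl
  refine h3.congr_deriv ?_
  rw [h4, map_smul, smul_eq_mul]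
  field_simp

/-- The derivative in the dilation parameter of `s ↦ ∫ φ(y / s) n(y) dy`. -/
theorem hasDerivAt_integral_dilation {j : ℤ} {φ : E d → ℝ} (hφ : IsTestFunction (openAnnulus d j) φ)
    (hn : LocallyIntegrableOn n {0}ᶜ) {s : ℝ} (hs : 0 < s) :
    HasDerivAt (fun s => ∫ y, φ (s⁻¹ • y) * n y)
      (-(s⁻¹ * ∫ y, radialPart (grad φ) (s⁻¹ • y) * n y)) s := by
  have hrc := (contDiff_radialPart_grad hφ.1).continuous
  have hrs := hφ.radialPart_hasCompactSupport
  obtain ⟨C, hC⟩ := hrs.exists_bound_of_continuous hrc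
  -- a compact set off the origin containing the supports for all parameters near `s`
  set K : Set (E d) := {y | s / 2 * 2 ^ j ≤ ‖y‖ ∧ ‖y‖ ≤ 2 * s * 2 ^ (j + 1)} with hK
  have hKc : IsCompact K := by
    refine (isCompact_closedBall (0 : E d) (2 * s * 2 ^ (j + 1))).of_isClosed_subset
      ((isClosed_le continuous_const continuous_norm).inter
        (isClosed_le continuous_norm continuous_const)) fun y hy => by simpa using hy.2
  have hK0 : K ⊆ {0}ᶜ := fun y hy h0 => by
    rw [mem_singleton_iff] at h0
    have h1 := hy.1
    rw [h0, norm_zero] at h1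
    have : 0 < s / 2 * (2 : ℝ) ^ j := by positivity
    linarith
  have hKn := hn.integrableOn_compact_subset hK0 hKc
  have hmemK : ∀ t ∈ Metric.ball s (s / 2), ∀ y, t⁻¹ • y ∈ openAnnulus d j → y ∈ K := by
    intro t ht y hy
    rw [Metric.mem_ball, Real.dist_eq, abs_lt] at ht
    have ht0 : 0 < t := by linarith [ht.1]
    have hy1 : (2 : ℝ) ^ j < ‖t⁻¹ • y‖ := hy.1
    have hy2 : ‖t⁻¹ • y‖ < (2 : ℝ) ^ (j + 1) := hy.2
    rw [norm_smul, norm_inv, Real.norm_of_nonneg ht0.le] at hy1 hy2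
    rw [inv_mul_eq_div, lt_div_iff₀ ht0] at hy1
    rw [inv_mul_eq_div, div_lt_iff₀ ht0] at hy2
    have p1 : (0 : ℝ) < 2 ^ j := by positivity
    have p2 : (0 : ℝ) < 2 ^ (j + 1) := by positivity
    exact ⟨by nlinarith [ht.1], by nlinarith [ht.2]⟩
  have hint : ∀ c : E d → ℝ, Continuous c → HasCompactSupport c → tsupport c ⊆ tsupport φ →
      ∀ t : ℝ, 0 < t → Integrable fun y => c (t⁻¹ • y) * n y := by
    intro c hc hcs hsub t ht
    refine integrable_mul_of_locallyIntegrableOn (Ω := {0}ᶜ) (hc.comp (continuous_const_smul _))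
      (hcs.comp_homeomorph (Homeomorph.smulOfNeZero t⁻¹ (inv_ne_zero ht.ne'))) ?_ hn
    rw [tsupport_comp_smul (inv_ne_zero ht.ne')]
    intro y hy h0
    rw [mem_singleton_iff] at h0
    have : t⁻¹ • y ∈ openAnnulus d j := hφ.2.2 (hsub hy)
    rw [h0, smul_zero] at this
    exact zero_notMem_openAnnulus j this
  have hball : Metric.ball s (s / 2) ∈ 𝓝 s := Metric.ball_mem_nhds s (by positivity)
  have key := (hasDerivAt_integral_of_dominated_loc_of_deriv_le (μ := volume)
    (F := fun t y => φ (t⁻¹ • y) * n y)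
    (F' := fun t y => -(t⁻¹ * radialPart (grad φ) (t⁻¹ • y)) * n y)
    (bound := K.indicator fun y => 2 / s * C * ‖n y‖) (x₀ := s) (s := Metric.ball s (s / 2)) hball
    ?_ (hint φ hφ.1.continuous hφ.2.1 subset_rfl s hs) ?_ ?_ ?_ ?_).2
  · refine key.congr_deriv ?_
    rw [← integral_const_mul, ← integral_neg]
    exact integral_congr_ae (Eventually.of_forall fun y => by ring)
  · filter_upwards [hball] with t ht
    rw [Metric.mem_ball, Real.dist_eq, abs_lt] at ht
    exact (hint φ hφ.1.continuous hφ.2.1 subset_rfl t (by linarith [ht.1])).1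
  · have := (hint _ hrc hrs (tsupport_radialPart_grad_subset φ) s hs).1.const_mul (-s⁻¹)
    refine this.congr (Eventually.of_forall fun y => ?_)
    simp only; ring
  · refine Eventually.of_forall fun y t ht => ?_
    by_cases hy : y ∈ K
    · rw [indicator_of_mem hy, norm_mul, norm_neg, norm_mul]
      rw [Metric.mem_ball, Real.dist_eq, abs_lt] at ht
      have ht0 : s / 2 < t := by linarith [ht.1]
      gcongr
      · rw [norm_inv, Real.norm_of_nonneg (by linarith), inv_eq_one_div,
          div_le_div_iff₀ (by linarith) hs]
        linarith
      · exact hC _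
    · have : t⁻¹ • y ∉ tsupport (radialPart (grad φ)) := fun h =>
        hy (hmemK t ht y (hφ.2.2 (tsupport_radialPart_grad_subset φ h)))
      simp [image_eq_zero_of_notMem_tsupport this, hy]
  · exact (IntegrableOn.integrable_indicator (hKn.norm.const_mul _) hKc.measurableSet)
  · refine Eventually.of_forall fun y t ht => ?_
    rw [Metric.mem_ball, Real.dist_eq, abs_lt] at ht
    exact (hasDerivAt_comp_inv_smul hφ.1 y (by linarith [ht.1])).mul_const (n y)

end

section
variable {d : ℕ} {n : E d → ℝ} {Dn : Fin d → E d → ℝ}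

/-- The exponents lost over successive dyadic ranges of dilations add up to at most `1`: each `β_j`
occurs at most twice. -/
theorem sum_annulusDecrease_le (hβ : betaConst n Dn < 1) (j : ℤ) (M : ℕ) :
    ∑ i ∈ Finset.range M, (annulusDecrease n Dn (j + i) + annulusDecrease n Dn (j + i + 1)) ≤ 1 := by
  have h : ∀ j : ℤ, ∑ i ∈ Finset.range M, annulusDecrease n Dn (j + i) ≤ 1 / 2 := by
    intro j
    have hinj : Function.Injective fun i : ℕ => j + (i : ℤ) := fun a b h => by simpa using h
    rw [← Finset.sum_image (f := annulusDecrease n Dn) (s := Finset.range M)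
      (g := fun i : ℕ => j + (i : ℤ)) fun a _ b _ h => hinj h]
    exact ((annulusDecrease_tsum_lt hβ).1.sum_le_tsum _
      fun _ _ => annulusDecrease_nonneg _ _ _).trans (annulusDecrease_tsum_lt hβ).2.le
  rw [Finset.sum_add_distrib]
  have h2 := h (j + 1)
  simp only [add_right_comm j 1] at h2
  linarith [h j]

/-- The integral of `n` against the dilate by the factor `s` of a test function, normalized so
that it equals `∫ φ(x) n(s x) dx`. -/
noncomputable def dilationIntegral (n φ : E d → ℝ) (s : ℝ) : ℝ :=
  s ^ (-d : ℝ) * ∫ y, φ (s⁻¹ • y) * n y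

theorem dilationIntegral_nonneg (hpos : ∀ᵐ x : E d, 0 < n x) {φ : E d → ℝ} (hφ0 : ∀ x, 0 ≤ φ x)
    {s : ℝ} (hs : 0 < s) : 0 ≤ dilationIntegral n φ s := by
  refine mul_nonneg (Real.rpow_nonneg hs.le _) (integral_nonneg_of_ae ?_)
  filter_upwards [hpos] with y hy
  exact mul_nonneg (hφ0 _) hy.le

theorem dilationIntegral_eq (φ : E d → ℝ) {s : ℝ} (hs : 0 < s) :
    dilationIntegral n φ s = ∫ x, φ x * n (s • x) := by
  have h := Measure.integral_comp_smul (volume : Measure (E d)) (fun y => φ (s⁻¹ • y) * n y) s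
  simp only [smul_smul, inv_mul_cancel₀ hs.ne', one_smul] at h
  rw [h, dilationIntegral, Real.rpow_neg hs.le, Real.rpow_natCast, abs_of_nonneg (by positivity)]
  simp

/-- Within the dyadic range `[2^m, 2^(m+1)]` of dilations, `dilationIntegral` loses at most a
factor governed by the two annuli which the dilated support meets. -/
theorem dilationIntegral_step [NeZero d] (hpos : ∀ᵐ x : E d, 0 < n x)
    (hβ : betaConst n Dn < 1) (hDn : HasWeakGradientOn {0}ᶜ n Dn) {j : ℤ} {φ : E d → ℝ}
    (hφ : IsTestFunction (openAnnulus d j) φ) (hφ0 : ∀ x, 0 ≤ φ x) (m : ℕ) {s : ℝ}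
    (h1 : (2 : ℝ) ^ m ≤ s) (h2 : s ≤ 2 ^ (m + 1)) :
    dilationIntegral n φ (2 ^ m)
      * 2 ^ (-(annulusDecrease n Dn (j + m) + annulusDecrease n Dn (j + m + 1)))
      ≤ dilationIntegral n φ s := by
  set B := annulusDecrease n Dn (j + m) + annulusDecrease n Dn (j + m + 1) with hB
  have hB0 : 0 ≤ B := add_nonneg (annulusDecrease_nonneg _ _ _) (annulusDecrease_nonneg _ _ _)
  have hm0 : (0 : ℝ) < 2 ^ m := by positivity
  set I : ℝ → ℝ := fun s => ∫ y, φ (s⁻¹ • y) * n y with hI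
  set I' : ℝ → ℝ := fun s => -(s⁻¹ * ∫ y, radialPart (grad φ) (s⁻¹ • y) * n y) with hI'
  have hd : ∀ s, 0 < s → HasDerivAt I (I' s) s := fun s hs =>
    hasDerivAt_integral_dilation hφ hDn.1 hs
  have hds : ∀ s, 0 < s → HasDerivAt (fun s => s ^ (B - d) * I s)
      ((B - d) * s ^ (B - d - 1) * I s + s ^ (B - d) * I' s) s := fun s hs =>
    ((Real.hasDerivAt_rpow_const (Or.inl hs.ne')).mul (hd s hs))
  -- the differential inequality: `s` times the derivative of `I` is at least `(d - B) I`
  have hineq : ∀ s, (2 : ℝ) ^ m ≤ s → s ≤ 2 ^ (m + 1) → -(s⁻¹ * ((B - d) * I s)) ≤ I' s := by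
    intro s hs1 hs2
    have hs : 0 < s := hm0.trans_le hs1
    have hf : IsTestFunction {0}ᶜ (fun y => φ (s⁻¹ • y)) := hφ.comp_smul (inv_ne_zero hs.ne')
      fun y hy h0 => by
        rw [mem_singleton_iff] at h0
        rw [h0, smul_zero] at hy
        exact zero_notMem_openAnnulus j hy
    have hfn : Integrable (fun y => φ (s⁻¹ • y) * n y) :=
      integrable_mul_of_locallyIntegrableOn hf.1.continuous hf.2.1 hf.2.2 hDn.1
    have hrn : Integrable (fun y => radialPart (grad φ) (s⁻¹ • y) * n y) := by
      have := integrable_mul_of_locallyIntegrableOn (contDiff_radialPart_grad hf.1).continuous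
        hf.radialPart_hasCompactSupport ((tsupport_radialPart_grad_subset _).trans hf.2.2) hDn.1
      simpa only [radialPart_grad_comp_smul hφ.1] using this
    have key := integral_mul_div_le_of_notMem hpos hβ hDn hf fun y => hφ0 _
    simp only [radialPart_grad_comp_smul hφ.1, add_mul, mul_assoc] at key
    rw [integral_add (hfn.const_mul _) hrn, integral_const_mul] at key
    have hup : ∫ y, decreaseRate n Dn ‖y‖ * (φ (s⁻¹ • y) * n y) ≤ B * I s := by
      rw [hI, ← integral_const_mul]
      refine integral_mono_ae ?_ (hfn.const_mul _) ?_
      · refine hfn.bdd_mul (c := 1 / 2)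
          ((measurable_decreaseRate n Dn).comp measurable_norm).aestronglyMeasurable
          (Eventually.of_forall fun x => ?_)
        rw [Real.norm_of_nonneg (decreaseRate_nonneg _ _ _)]
        exact decreaseRate_le hβ _
      · filter_upwards [hpos] with y hy
        by_cases hys : s⁻¹ • y ∈ tsupport φ
        · refine mul_le_mul_of_nonneg_right ?_ (mul_nonneg (hφ0 _) hy.le)
          have hyA := hφ.2.2 hys
          have hy1 : (2 : ℝ) ^ j < ‖s⁻¹ • y‖ := hyA.1
          have hy2 : ‖s⁻¹ • y‖ < (2 : ℝ) ^ (j + 1) := hyA.2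
          rw [norm_smul, norm_inv, Real.norm_of_nonneg hs.le] at hy1 hy2
          rw [inv_mul_eq_div, lt_div_iff₀ hs] at hy1
          rw [inv_mul_eq_div, div_lt_iff₀ hs] at hy2
          have p1 : (0 : ℝ) < 2 ^ j := by positivity
          have p2 : (0 : ℝ) < 2 ^ (j + 1) := by positivity
          have e1 : (2 : ℝ) ^ (j + m) = 2 ^ j * 2 ^ m := by
            rw [zpow_add₀ two_ne_zero, zpow_natCast]
          have e2 : (2 : ℝ) ^ (j + m + 1 + 1) = 2 ^ (j + 1) * 2 ^ (m + 1) := by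
            rw [show j + m + 1 + 1 = (j + 1) + ((m + 1 : ℕ) : ℤ) by push_cast; ring,
              zpow_add₀ two_ne_zero, zpow_natCast]
          have q1 : (2 : ℝ) ^ (j + m) ≤ ‖y‖ := by rw [e1]; nlinarith
          have q2 : ‖y‖ < (2 : ℝ) ^ (j + m + 1 + 1) := by rw [e2]; nlinarith
          rcases lt_or_ge ‖y‖ ((2 : ℝ) ^ (j + m + 1)) with h | h
          · rw [decreaseRate_of_mem n Dn q1 h]
            linarith [annulusDecrease_nonneg n Dn (j + m + 1)]
          · rw [decreaseRate_of_mem n Dn h q2]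
            linarith [annulusDecrease_nonneg n Dn (j + m)]
        · simp [image_eq_zero_of_notMem_tsupport hys]
    have h3 : ∫ y, radialPart (grad φ) (s⁻¹ • y) * n y ≤ (B - d) * I s := by
      rw [sub_mul]
      linarith
    rw [hI']
    exact neg_le_neg (mul_le_mul_of_nonneg_left h3 (inv_nonneg.2 hs.le))
  -- so `s^(B-d) I(s)`, which is `s^B` times the dilation integral, is nondecreasing
  have hmono : MonotoneOn (fun s => s ^ (B - d) * I s) (Icc ((2 : ℝ) ^ m) (2 ^ (m + 1))) := by
    refine monotoneOn_of_deriv_nonneg (convex_Icc _ _) ?_ ?_ ?_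
    · exact fun s hs => (hds s (hm0.trans_le hs.1)).continuousAt.continuousWithinAt
    · intro s hs
      rw [interior_Icc] at hs
      exact (hds s (hm0.trans hs.1)).differentiableAt.differentiableWithinAt
    · intro s hs
      rw [interior_Icc] at hs
      have hs0 : 0 < s := hm0.trans hs.1
      rw [(hds s hs0).deriv, Real.rpow_sub_one hs0.ne']
      have := mul_le_mul_of_nonneg_left (hineq s hs.1.le hs.2.le)
        (Real.rpow_nonneg hs0.le (B - d))
      have e : (B - d) * (s ^ (B - d) / s) * I s = -(s ^ (B - d) * -(s⁻¹ * ((B - d) * I s))) := by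
        field_simp
      rw [e]
      linarith
  have hfin := hmono ⟨le_rfl, by gcongr <;> norm_num⟩ ⟨h1, h2⟩ h1
  have hs0 : 0 < s := hm0.trans_le h1
  simp only [sub_eq_add_neg B (d : ℝ), Real.rpow_add hm0, Real.rpow_add hs0, mul_assoc] at hfin
  have hfin' : ((2 : ℝ) ^ m) ^ B * dilationIntegral n φ (2 ^ m) ≤ s ^ B * dilationIntegral n φ s :=
    hfin
  have h4 : s ^ B ≤ ((2 : ℝ) ^ m) ^ B * 2 ^ B := by
    rw [← Real.mul_rpow hm0.le (by norm_num)]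
    exact Real.rpow_le_rpow hs0.le (by rw [← pow_succ]; exact h2) hB0
  have h5 := hfin'.trans (mul_le_mul_of_nonneg_right h4
    (dilationIntegral_nonneg hpos hφ0 hs0))
  rw [mul_assoc] at h5
  have h6 := le_of_mul_le_mul_left h5 (Real.rpow_pos_of_pos hm0 B)
  rw [Real.rpow_neg (by norm_num), ← div_eq_mul_inv, div_le_iff₀ (by positivity), mul_comm]
  exact h6

/-- Iteration of `dilationIntegral_step`: the factors lost multiply to at least `1/2`. -/
theorem dilationIntegral_le [NeZero d] (hpos : ∀ᵐ x : E d, 0 < n x)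
    (hβ : betaConst n Dn < 1) (hDn : HasWeakGradientOn {0}ᶜ n Dn) {j : ℤ} {φ : E d → ℝ}
    (hφ : IsTestFunction (openAnnulus d j) φ) (hφ0 : ∀ x, 0 ≤ φ x) {s : ℝ} (hs : 1 ≤ s) :
    dilationIntegral n φ 1 ≤ 2 * dilationIntegral n φ s := by
  set B : ℕ → ℝ := fun m => annulusDecrease n Dn (j + m) + annulusDecrease n Dn (j + m + 1)
  have hJ1 := dilationIntegral_nonneg hpos hφ0 one_pos
  have hpow : ∀ m : ℕ, dilationIntegral n φ 1 * 2 ^ (-∑ i ∈ Finset.range m, B i)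
      ≤ dilationIntegral n φ (2 ^ m) := by
    intro m
    induction m with
    | zero => simp
    | succ m ih =>
      refine le_trans ?_ (dilationIntegral_step hpos hβ hDn hφ hφ0 m
        (s := 2 ^ (m + 1)) (by gcongr <;> norm_num) le_rfl)
      rw [Finset.sum_range_succ, neg_add, Real.rpow_add two_pos, ← mul_assoc]
      exact mul_le_mul_of_nonneg_right ih (by positivity)
  obtain ⟨m, hm1, hm2⟩ := exists_nat_pow_near hs one_lt_two
  have h1 := dilationIntegral_step hpos hβ hDn hφ hφ0 m hm1 hm2.le
  have h2 := (mul_le_mul_of_nonneg_right (hpow m) (by positivity :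
    (0 : ℝ) ≤ 2 ^ (-(annulusDecrease n Dn (j + m) + annulusDecrease n Dn (j + m + 1))))).trans h1
  rw [mul_assoc, ← Real.rpow_add two_pos, ← neg_add] at h2
  -- the total exponent is at most `1`, including the last, incomplete dyadic range
  have h3 : ∑ i ∈ Finset.range m, B i
      + (annulusDecrease n Dn (j + m) + annulusDecrease n Dn (j + m + 1)) ≤ 1 := by
    have := sum_annulusDecrease_le hβ j (m + 1)
    rwa [Finset.sum_range_succ] at this
  have h4 : (1 / 2 : ℝ) ≤ 2 ^ (-(∑ i ∈ Finset.range m, B i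
      + (annulusDecrease n Dn (j + m) + annulusDecrease n Dn (j + m + 1)))) := by
    have : (1 / 2 : ℝ) = 2 ^ (-1 : ℝ) := by rw [Real.rpow_neg_one]; norm_num
    rw [this]
    exact Real.rpow_le_rpow_of_exponent_le one_le_two (by linarith)
  have h5 := mul_le_mul_of_nonneg_left h4 hJ1
  linarith

/-! ### Pointwise consequences of integral inequalities -/

theorem ae_mollify_tendsto {g : E d → ℝ} (hg : LocallyIntegrable g) :
    ∀ᵐ x, Tendsto (fun k => mollify k g x) atTop (𝓝 (g x)) := by
  refine ContDiffBump.ae_convolution_tendsto_right_of_locallyIntegrable (K := 2) ?_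
    (Eventually.of_forall fun k => ?_) hg
  · exact tendsto_one_div_add_atTop_nhds_zero_nat
  · simp only [bump]
    apply le_of_eq
    field_simp

/-- A locally integrable function whose integrals against nonnegative test functions are
nonnegative is nonnegative almost everywhere. -/
theorem ae_nonneg_of_integral_mul_nonneg {U : Set (E d)} (hU : IsOpen U) {g : E d → ℝ}
    (hg : LocallyIntegrableOn g U)
    (h : ∀ φ : E d → ℝ, IsTestFunction U φ → (∀ x, 0 ≤ φ x) → 0 ≤ ∫ x, φ x * g x) :
    ∀ᵐ x, x ∈ U → 0 ≤ g x := by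
  rw [ae_iff]
  refine measure_null_of_locally_null _ fun x₀ hx₀ => ?_
  have hx₀U : x₀ ∈ U := by
    simp only [mem_ofPred_eq, not_forall] at hx₀
    exact hx₀.1
  obtain ⟨r, hr, hrU⟩ := Metric.nhds_basis_closedBall.mem_iff.1 (hU.mem_nhds hx₀U)
  set G := (Metric.closedBall x₀ r).indicator g
  have hG : LocallyIntegrable G :=
    (IntegrableOn.integrable_indicator (hg.integrableOn_compact_subset hrU
      (isCompact_closedBall _ _)) measurableSet_closedBall).locallyIntegrable
  have h1 : ∀ᵐ x, x ∈ Metric.ball x₀ (r / 2) → 0 ≤ g x := by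
    filter_upwards [ae_mollify_tendsto hG] with x hx hxb
    rw [Metric.mem_ball] at hxb
    have hGx : G x = g x := indicator_of_mem (by
      rw [Metric.mem_closedBall]; linarith) g
    rw [← hGx]
    refine ge_of_tendsto hx ?_
    filter_upwards [(tendsto_one_div_add_atTop_nhds_zero_nat (𝕜 := ℝ)).eventually_lt_const
      (half_pos hr)] with k hk
    have hsub : Metric.closedBall x (1 / ((k : ℝ) + 1)) ⊆ Metric.closedBall x₀ r := by
      refine Metric.closedBall_subset_closedBall' ?_
      linarith
    have hsupp : tsupport (fun y => mollifier d k (x - y))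
        ⊆ Metric.closedBall x (1 / ((k : ℝ) + 1)) := by
      refine closure_minimal (fun y hy => ?_) Metric.isClosed_closedBall
      by_contra hy'
      refine hy (mollifier_eq_zero ?_)
      rw [Metric.mem_closedBall, dist_comm, dist_eq_norm, not_le] at hy'
      exact hy'.le
    have hT := mollifier_reflect_isTestFunction k x
    have := h _ ⟨hT.1, hT.2.1, hsupp.trans (hsub.trans hrU)⟩ fun y => mollifier_nonneg k _
    rw [← integral_mollifier_reflect]
    refine this.trans_eq (integral_congr_ae (Eventually.of_forall fun y => ?_))
    by_cases hy : y ∈ Metric.closedBall x₀ r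
    · simp [G, hy]
    · have : y ∉ tsupport (fun y => mollifier d k (x - y)) := fun h => hy (hsub (hsupp h))
      have h0 : mollifier d k (x - y) = 0 :=
        image_eq_zero_of_notMem_tsupport (f := fun y => mollifier d k (x - y)) this
      simp [h0]
  refine ⟨{x | ¬(x ∈ Metric.ball x₀ (r / 2) → 0 ≤ g x)}, ?_, ae_iff.1 h1⟩
  rw [mem_nhdsWithin]
  refine ⟨Metric.ball x₀ (r / 2), Metric.isOpen_ball, Metric.mem_ball_self (half_pos hr), ?_⟩
  intro x hx
  have := hx.2
  simp only [mem_ofPred_eq, not_forall] at this ⊢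
  exact ⟨hx.1, this.2⟩

theorem IsTestFunction.sq {U : Set (E d)} {φ : E d → ℝ} (hφ : IsTestFunction U φ) :
    IsTestFunction U (fun x => φ x ^ 2) := by
  have hs : Function.support (fun x => φ x ^ 2) ⊆ Function.support φ := fun x hx h0 =>
    hx (by simp [h0])
  exact ⟨hφ.1.pow 2, hφ.2.1.mono hs, (closure_mono hs).trans hφ.2.2⟩

theorem integrable_sq_mul_of_locallyIntegrableOn {U : Set (E d)} {φ g : E d → ℝ}
    (hφ : IsTestFunction U φ) (hg : LocallyIntegrableOn g U) :
    Integrable (fun x => φ x ^ 2 * g x) :=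
  integrable_mul_of_locallyIntegrableOn hφ.sq.1.continuous hφ.sq.2.1 hφ.sq.2.2 hg

/-- Squares of test functions suffice in `ae_nonneg_of_integral_mul_nonneg`, because a nonnegative
test function `ψ` is the limit of the squares of `√(ψ + ε) - √ε`. -/
theorem ae_nonneg_of_integral_sq_mul_nonneg {U : Set (E d)} (hU : IsOpen U) {g : E d → ℝ}
    (hg : LocallyIntegrableOn g U)
    (h : ∀ φ : E d → ℝ, IsTestFunction U φ → 0 ≤ ∫ x, φ x ^ 2 * g x) :
    ∀ᵐ x, x ∈ U → 0 ≤ g x := by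
  refine ae_nonneg_of_integral_mul_nonneg hU hg fun ψ hψ hψ0 => ?_
  set ε : ℕ → ℝ := fun k => 1 / ((k : ℝ) + 1)
  have hε : ∀ k, 0 < ε k := fun k => by positivity
  set φ : ℕ → E d → ℝ := fun k x => √(ψ x + ε k) - √(ε k)
  have hφ0 : ∀ k x, ψ x = 0 → φ k x = 0 := fun k x hx => by simp [φ, hx]
  have hφT : ∀ k, IsTestFunction U (φ k) := by
    intro k
    have hs : Function.support (φ k) ⊆ Function.support ψ := fun x hx h0 => hx (hφ0 k x h0)
    refine ⟨?_, hψ.2.1.mono hs, (closure_mono hs).trans hψ.2.2⟩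
    exact ((hψ.1.add contDiff_const).sqrt fun x => by linarith [hψ0 x, hε k]).sub contDiff_const
  have hint : Integrable (fun x => ψ x * g x) :=
    integrable_mul_of_locallyIntegrableOn hψ.1.continuous hψ.2.1 hψ.2.2 hg
  have hsq : ∀ k x, φ k x ^ 2 = ψ x + 2 * ε k - 2 * (√(ε k) * √(ψ x + ε k)) := by
    intro k x
    have h1 := Real.sq_sqrt (hε k).le
    have h2 := Real.sq_sqrt (by linarith [hψ0 x, hε k] : 0 ≤ ψ x + ε k)
    simp only [φ]
    ring_nf
    rw [h1, h2]
    ring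
  have hlim : Tendsto (fun k => ∫ x, φ k x ^ 2 * g x) atTop (𝓝 (∫ x, ψ x * g x)) := by
    refine tendsto_integral_of_dominated_convergence (fun x => ‖ψ x * g x‖) (fun k => ?_)
      hint.norm (fun k => Eventually.of_forall fun x => ?_) (Eventually.of_forall fun x => ?_)
    · exact (integrable_sq_mul_of_locallyIntegrableOn (hφT k) hg).1
    · rw [norm_mul, norm_mul]
      refine mul_le_mul_of_nonneg_right ?_ (norm_nonneg _)
      rw [Real.norm_of_nonneg (sq_nonneg _), Real.norm_of_nonneg (hψ0 x), hsq]
      have : ε k ≤ √(ε k) * √(ψ x + ε k) := by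
        rw [← Real.sqrt_mul (hε k).le]
        refine Real.le_sqrt_of_sq_le ?_
        nlinarith [hψ0 x, hε k]
      linarith
    · have hε0 : Tendsto ε atTop (𝓝 0) := tendsto_one_div_add_atTop_nhds_zero_nat
      have : Tendsto (fun k => φ k x ^ 2) atTop (𝓝 ((√(ψ x + 0) - √0) ^ 2)) :=
        (((hε0.const_add (ψ x)).sqrt).sub hε0.sqrt).pow 2
      rw [add_zero, Real.sqrt_zero, sub_zero, Real.sq_sqrt (hψ0 x)] at this
      exact this.mul_const _
  exact ge_of_tendsto' hlim fun k => h _ (hφT k)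

end

/-! ### Boundedness of the potential -/

section
variable {d : ℕ} {n n₁ n₂ : E d → ℝ} {Dn : Fin d → E d → ℝ} {c₀ : ℝ}

theorem ae_mem_openAnnulus [NeZero d] : ∀ᵐ x : E d, ∃ j, x ∈ openAnnulus d j := by
  have h : ∀ᵐ x : E d, ∀ j : ℤ, ‖x‖ ≠ 2 ^ j := by
    rw [ae_all_iff]
    intro j
    rw [ae_iff]
    have : {x : E d | ¬‖x‖ ≠ 2 ^ j} = Metric.sphere 0 (2 ^ j) := by
      ext x; simp
    rw [this]
    exact Measure.addHaar_sphere _ _ _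
  filter_upwards [h, ae_ne_zero] with x hx hx0
  have h3 := (floor_logb_eq_iff (norm_pos_iff.2 hx0) ⌊Real.logb 2 ‖x‖⌋).1 rfl
  exact ⟨_, lt_of_le_of_ne h3.1 (hx _).symm, h3.2⟩

theorem ae_of_forall_openAnnulus [NeZero d] {p : E d → Prop}
    (h : ∀ j : ℤ, ∀ᵐ x, x ∈ openAnnulus d j → p x) : ∀ᵐ x, p x := by
  filter_upwards [ae_all_iff.2 h, ae_mem_openAnnulus] with x hx ⟨j, hj⟩
  exact hx j hj

theorem openAnnulus_subset (j : ℤ) : openAnnulus d j ⊆ {0}ᶜ := fun x hx h0 => by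
  rw [mem_singleton_iff] at h0
  exact zero_notMem_openAnnulus j (h0 ▸ hx)

theorem locallyIntegrableOn_comp_smul (hn : LocallyIntegrableOn n {0}ᶜ) {s : ℝ} (hs : s ≠ 0) :
    LocallyIntegrableOn (fun x => n (s • x)) {0}ᶜ := by
  rw [locallyIntegrableOn_iff isOpen_compl_singleton.isLocallyClosed]
  intro K hK hKc
  have hsK : IsCompact ((fun x : E d => s • x) '' K) := hKc.image (continuous_const_smul s)
  have h0 : (fun x : E d => s • x) '' K ⊆ {0}ᶜ := by
    rintro _ ⟨x, hx, rfl⟩ h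
    exact hK hx (by simpa [hs] using h)
  have h1 := ((hn.integrableOn_compact_subset h0 hsK).integrable_indicator
    hsK.measurableSet).comp_smul hs
  refine (integrable_indicator_iff hKc.measurableSet).1 (h1.congr (Eventually.of_forall fun x => ?_))
  beta_reduce
  by_cases hx : x ∈ K
  · rw [indicator_of_mem hx, indicator_of_mem (mem_image_of_mem (fun x : E d => s • x) hx)]
  · rw [indicator_of_notMem hx, indicator_of_notMem]
    rintro ⟨y, hy, hyx⟩
    exact hx ((smul_right_injective (E d) hs) hyx ▸ hy)

/-- Along rays the potential increases up to a factor `2`. -/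
theorem ae_le_two_mul_comp_smul [NeZero d] (hpos : ∀ᵐ x : E d, 0 < n x)
    (hβ : betaConst n Dn < 1) (hDn : HasWeakGradientOn {0}ᶜ n Dn) {s : ℝ} (hs : 1 ≤ s) :
    ∀ᵐ x, n x ≤ 2 * n (s • x) := by
  have hs0 : 0 < s := one_pos.trans_le hs
  refine ae_of_forall_openAnnulus fun j => ?_
  have hli := locallyIntegrableOn_comp_smul hDn.1 hs0.ne'
  have := ae_nonneg_of_integral_mul_nonneg (isOpen_openAnnulus (d := d) j)
    (g := fun x => 2 * n (s • x) - n x)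
    (((hli.smul (2 : ℝ)).sub hDn.1).mono_set (openAnnulus_subset j)) fun φ hφ hφ0 => ?_
  · filter_upwards [this] with x hx hxj
    linarith [hx hxj]
  have h := dilationIntegral_le hpos hβ hDn hφ hφ0 hs
  rw [dilationIntegral_eq φ hs0, dilationIntegral_eq φ one_pos] at h
  simp only [one_smul] at h
  have i1 : Integrable fun x => φ x * n x := integrable_mul_of_locallyIntegrableOn hφ.1.continuous
    hφ.2.1 (hφ.2.2.trans (openAnnulus_subset j)) hDn.1
  have i2 : Integrable fun x => φ x * n (s • x) := integrable_mul_of_locallyIntegrableOn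
    hφ.1.continuous hφ.2.1 (hφ.2.2.trans (openAnnulus_subset j)) hli
  have e : (fun x => φ x * (2 * n (s • x) - n x))
      = fun x => 2 * (φ x * n (s • x)) - φ x * n x := by ext x; ring
  rw [e, integral_sub (i2.const_mul 2) i1, integral_const_mul]
  linarith

theorem integrable_norm_fderiv_sq {Ω : Set (E d)} {φ : E d → ℝ} (hφ : IsTestFunction Ω φ) :
    Integrable fun x => ‖fderiv ℝ φ x‖ ^ 2 := by
  have hfd : Continuous fun x => ‖fderiv ℝ φ x‖ ^ 2 :=
    (hφ.1.continuous_fderiv (by norm_num)).norm.pow 2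
  refine hfd.integrable_of_hasCompactSupport ?_
  refine (hφ.2.1.fderiv ℝ).mono fun x hx h0 => hx ?_
  simp [h0]

theorem ae_abs_le_eLpNorm_top (hn₂ : MemLp n₂ ⊤ volume) :
    ∀ᵐ x, |n₂ x| ≤ (eLpNorm n₂ ⊤ volume).toReal := by
  have h2 : eLpNormEssSup n₂ volume ≠ ⊤ := by
    rw [← eLpNorm_exponent_top]; exact hn₂.2.ne
  filter_upwards [ae_le_eLpNormEssSup (f := n₂) (μ := volume)] with x hx
  rw [eLpNorm_exponent_top]
  have := ENNReal.toReal_mono h2 hx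
  simpa using this

/-- The form bound on `n₁` controls `n = n₁ + n₂` on squares of test functions. -/
theorem integral_sq_mul_le (hn : n =ᵐ[volume] fun x => n₁ x + n₂ x) (hn₂ : MemLp n₂ ⊤ volume)
    (hpos : ∀ᵐ x : E d, 0 < n x) (hc₀ : 0 < c₀)
    (hform : ∀ φ : E d → ℝ, IsTestFunction univ φ →
      eLpNorm (fun x => Real.sqrt |n₁ x| * φ x) 2 volume
        ≤ ENNReal.ofReal (1 - c₀) * eLpNorm (fun x => fderiv ℝ φ x) 2 volume)
    {φ : E d → ℝ} (hφ : IsTestFunction univ φ) (hi : Integrable fun x => φ x ^ 2 * n x) :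
    ∫ x, φ x ^ 2 * n x
      ≤ (∫ x, ‖fderiv ℝ φ x‖ ^ 2) + (eLpNorm n₂ ⊤ volume).toReal * ∫ x, φ x ^ 2 := by
  set M := (eLpNorm n₂ ⊤ volume).toReal
  have hM : ∀ᵐ x, |n₂ x| ≤ M := ae_abs_le_eLpNorm_top hn₂
  have i1 := integrable_norm_fderiv_sq hφ
  have i2 : Integrable fun x => φ x ^ 2 :=
    hφ.sq.1.continuous.integrable_of_hasCompactSupport hφ.sq.2.1
  have h1 : ∫⁻ x, ‖Real.sqrt |n₁ x| * φ x‖ₑ ^ 2 ≤ ∫⁻ x, ‖fderiv ℝ φ x‖ₑ ^ 2 := by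
    rw [← eLpNorm_two_sq, ← eLpNorm_two_sq]
    gcongr
    refine (hform φ hφ).trans ?_
    calc _ ≤ 1 * eLpNorm (fun x => fderiv ℝ φ x) 2 volume := by
          gcongr
          rw [← ENNReal.ofReal_one]
          exact ENNReal.ofReal_le_ofReal (by linarith)
      _ = _ := one_mul _
  have h2 : ENNReal.ofReal (∫ x, φ x ^ 2 * n x)
      ≤ ENNReal.ofReal ((∫ x, ‖fderiv ℝ φ x‖ ^ 2) + M * ∫ x, φ x ^ 2) := by
    have h3 : 0 ≤ ∫ x, ‖fderiv ℝ φ x‖ ^ 2 := integral_nonneg fun x => sq_nonneg _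
    have h4 : 0 ≤ ∫ x, φ x ^ 2 := integral_nonneg fun x => sq_nonneg _
    have hφn : ∀ᵐ x, 0 ≤ φ x ^ 2 * n x := by
      filter_upwards [hpos] with x hx using mul_nonneg (sq_nonneg _) hx.le
    rw [ofReal_integral_eq_lintegral_ofReal hi hφn,
      ENNReal.ofReal_add h3 (mul_nonneg ENNReal.toReal_nonneg h4),
      ← integral_const_mul, ofReal_integral_eq_lintegral_ofReal i1
        (Eventually.of_forall fun x => sq_nonneg _),
      ofReal_integral_eq_lintegral_ofReal (i2.const_mul M)
        (Eventually.of_forall fun x => mul_nonneg ENNReal.toReal_nonneg (sq_nonneg _))]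
    have e1 : ∫⁻ x, ENNReal.ofReal (‖fderiv ℝ φ x‖ ^ 2) = ∫⁻ x, ‖fderiv ℝ φ x‖ₑ ^ 2 := by
      refine lintegral_congr fun x => ?_
      rw [ENNReal.ofReal_pow (norm_nonneg _), ofReal_norm]
    rw [e1]
    refine le_trans ?_ (add_le_add_left h1 _)
    rw [← lintegral_add_right' _ ((i2.const_mul M).1.aemeasurable.ennreal_ofReal)]
    refine lintegral_mono_ae ?_
    filter_upwards [hM, hn] with x hx hnx
    have e2 : ‖Real.sqrt |n₁ x| * φ x‖ₑ ^ 2 = ENNReal.ofReal (|n₁ x| * φ x ^ 2) := by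
      rw [← ofReal_norm, ← ENNReal.ofReal_pow (norm_nonneg _), Real.norm_eq_abs, sq_abs, mul_pow,
        Real.sq_sqrt (abs_nonneg _)]
    rw [e2, ← ENNReal.ofReal_add (by positivity)
      (mul_nonneg ENNReal.toReal_nonneg (sq_nonneg _)), hnx]
    refine ENNReal.ofReal_le_ofReal ?_
    nlinarith [mul_le_mul_of_nonneg_left (le_abs_self (n₁ x)) (sq_nonneg (φ x)),
      mul_le_mul_of_nonneg_left ((le_abs_self (n₂ x)).trans hx) (sq_nonneg (φ x))]
  have h3 : 0 ≤ ∫ x, ‖fderiv ℝ φ x‖ ^ 2 := integral_nonneg fun x => sq_nonneg _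
  have h4 : 0 ≤ ∫ x, φ x ^ 2 := integral_nonneg fun x => sq_nonneg _
  have hM0 : 0 ≤ M := ENNReal.toReal_nonneg
  refine (ENNReal.ofReal_le_ofReal_iff ?_).1 h2
  positivity

/-- The potential is bounded: being quasi-increasing along rays it is dominated by its dilates, and
under large dilations the form-bounded part `n₁` is negligible. -/
theorem ae_potential_le [NeZero d] (hn : n =ᵐ[volume] fun x => n₁ x + n₂ x)
    (hn₂ : MemLp n₂ ⊤ volume) (hpos : ∀ᵐ x : E d, 0 < n x) (hc₀ : 0 < c₀)
    (hform : ∀ φ : E d → ℝ, IsTestFunction univ φ →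
      eLpNorm (fun x => Real.sqrt |n₁ x| * φ x) 2 volume
        ≤ ENNReal.ofReal (1 - c₀) * eLpNorm (fun x => fderiv ℝ φ x) 2 volume)
    (hβ : betaConst n Dn < 1) (hDn : HasWeakGradientOn {0}ᶜ n Dn) :
    ∀ᵐ x, n x ≤ 2 * (eLpNorm n₂ ⊤ volume).toReal := by
  set M := (eLpNorm n₂ ⊤ volume).toReal
  refine ae_of_forall_openAnnulus fun j => ?_
  have hc : LocallyIntegrableOn (fun _ : E d => 2 * M) (openAnnulus d j) :=
    (continuous_const.locallyIntegrable).locallyIntegrableOn _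
  have hnj : LocallyIntegrableOn n (openAnnulus d j) := hDn.1.mono_set (openAnnulus_subset j)
  have := ae_nonneg_of_integral_sq_mul_nonneg (isOpen_openAnnulus (d := d) j)
    (g := fun x => 2 * M - n x) (hc.sub hnj) fun φ hφ => ?_
  · filter_upwards [this] with x hx hxj
    linarith [hx hxj]
  have i1 := integrable_sq_mul_of_locallyIntegrableOn hφ hnj
  have i2 : Integrable fun x => φ x ^ 2 :=
    hφ.sq.1.continuous.integrable_of_hasCompactSupport hφ.sq.2.1
  set A := ∫ x, ‖fderiv ℝ φ x‖ ^ 2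
  set Q := ∫ x, φ x ^ 2
  have key : ∀ s : ℝ, 1 ≤ s → ∫ x, φ x ^ 2 * n x ≤ 2 * ((s ^ 2)⁻¹ * A + M * Q) := by
    intro s hs
    have hs0 : 0 < s := one_pos.trans_le hs
    have h := dilationIntegral_le hpos hβ hDn hφ.sq (fun x => sq_nonneg _) hs
    rw [dilationIntegral_eq _ one_pos] at h
    simp only [one_smul] at h
    refine h.trans (mul_le_mul_of_nonneg_left ?_ (by norm_num))
    have hψ : IsTestFunction {0}ᶜ (fun y => φ (s⁻¹ • y)) := hφ.comp_smul (inv_ne_zero hs0.ne')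
      fun y hy h0 => by
        rw [mem_singleton_iff] at h0
        rw [h0, smul_zero] at hy
        exact zero_notMem_openAnnulus j hy
    have h1 := integral_sq_mul_le hn hn₂ hpos hc₀ hform
      (φ := fun y => φ (s⁻¹ • y)) ⟨hψ.1, hψ.2.1, subset_univ _⟩
      (integrable_sq_mul_of_locallyIntegrableOn hψ hDn.1)
    -- a dilation by `s` gains `s⁻²` in the Dirichlet integral relative to the `L²` norm
    have e1 : ∀ y, ‖fderiv ℝ (fun y => φ (s⁻¹ • y)) y‖ ^ 2
        = (s ^ 2)⁻¹ * ‖fderiv ℝ φ (s⁻¹ • y)‖ ^ 2 := by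
      intro y
      rw [fderiv_comp_smul, norm_smul, norm_inv, Real.norm_of_nonneg hs0.le, mul_pow, inv_pow]
    simp only [e1] at h1
    rw [integral_const_mul, Measure.integral_comp_inv_smul volume (fun y => ‖fderiv ℝ φ y‖ ^ 2),
      Measure.integral_comp_inv_smul volume (fun y => φ y ^ 2)] at h1
    rw [abs_of_nonneg (by positivity)] at h1
    simp only [finrank_euclideanSpace, Fintype.card_fin, smul_eq_mul] at h1
    rw [dilationIntegral, Real.rpow_neg hs0.le, Real.rpow_natCast, inv_mul_le_iff₀ (by positivity)]
    refine h1.trans_eq ?_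
    simp only [A, Q, M]
    ring
  -- as `s → ∞` the Dirichlet integral disappears and only the bounded part `n₂` is left
  have hlim : Tendsto (fun s : ℝ => 2 * ((s ^ 2)⁻¹ * A + M * Q)) atTop
      (𝓝 (2 * (0 * A + M * Q))) :=
    (((tendsto_inv_atTop_zero.comp (tendsto_pow_atTop two_ne_zero)).mul_const A).add_const
      _).const_mul _
  have h2 := ge_of_tendsto hlim ((eventually_ge_atTop 1).mono key)
  have e : (fun x => φ x ^ 2 * (2 * M - n x)) = fun x => 2 * M * φ x ^ 2 - φ x ^ 2 * n x := by
    ext x; ring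
  rw [e, integral_sub (i2.const_mul _) i1, integral_const_mul]
  simp only [zero_mul, zero_add] at h2
  linarith

/-! ### The potential as a multiplier of radial fields -/

theorem radialPart_grad_mul {f g : E d → ℝ} (hf : ContDiff ℝ ∞ f) (hg : ContDiff ℝ ∞ g) (x : E d) :
    radialPart (grad fun y => f y * g y) x
      = f x * radialPart (grad g) x + radialPart (grad f) x * g x := by
  simp only [radialPart, grad, partialDeriv_mul hf hg, Finset.mul_sum, Finset.sum_mul,
    ← Finset.sum_add_distrib]
  exact Finset.sum_congr rfl fun _ _ => by ring

/-- `integral_mul_div_le_of_notMem` without the restriction on the support at the origin, for a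
locally bounded potential. -/
theorem integral_mul_div_le [NeZero d] (hpos : ∀ᵐ x : E d, 0 < n x)
    (hβ : betaConst n Dn < 1) (hDn : HasWeakGradientOn {0}ᶜ n Dn) (hnb : LocBdd n) {f : E d → ℝ}
    (hf : IsTestFunction univ f) (hf0 : ∀ x, 0 ≤ f x) :
    ∫ x, (d * f x + radialPart (grad f) x) * n x ≤ ∫ x, decreaseRate n Dn ‖x‖ * (f x * n x) := by
  have hnl : LocallyIntegrable n := by
    have := (continuous_const (y := (1 : ℝ)) (X := E d)).memLpLoc (p := 1)
    simpa using (this.bdd_mul hnb).locallyIntegrable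
  have hnlu : LocallyIntegrableOn n univ := locallyIntegrableOn_univ.2 hnl
  -- `ζ k` cuts off the origin at the scale `1 / (k + 1)`; as `x · ∇` is invariant under dilations,
  -- `x · ∇ζ_k` is bounded uniformly in `k`, and dominated convergence applies
  set b : ContDiffBump (0 : E d) := ⟨1, 2, one_pos, one_lt_two⟩
  have hbr := (contDiff_radialPart_grad (w := b) b.contDiff).continuous
  have hbT : IsTestFunction univ b := ⟨b.contDiff, b.hasCompactSupport, subset_univ _⟩
  obtain ⟨C, hC⟩ := hbT.radialPart_hasCompactSupport.exists_bound_of_continuous hbr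
  set ζ : ℕ → E d → ℝ := fun k x => 1 - b (((k : ℝ) + 1) • x) with hζ
  have hζc : ∀ k, ContDiff ℝ ∞ (ζ k) := fun k =>
    contDiff_const.sub (b.contDiff.comp (contDiff_const_smul _))
  have hζr : ∀ k x, radialPart (grad (ζ k)) x = -radialPart (grad b) (((k : ℝ) + 1) • x) := by
    intro k x
    rw [← radialPart_grad_comp_smul b.contDiff]
    simp only [radialPart, grad, ← Finset.sum_neg_distrib, ← mul_neg]
    refine Finset.sum_congr rfl fun i _ => ?_
    congr 1
    simp only [partialDeriv, hζ]
    rw [fderiv_const_sub]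
    rfl
  have hζ0 : ∀ k x, 0 ≤ ζ k x := fun k x => sub_nonneg.2 b.le_one
  have hζ1 : ∀ k x, ζ k x ≤ 1 := fun k x => sub_le_self _ b.nonneg
  have hT : ∀ k, IsTestFunction {0}ᶜ (fun x => f x * ζ k x) := by
    intro k
    refine ⟨hf.1.mul (hζc k), hf.2.1.mul_right, ?_⟩
    intro x hx h0
    rw [mem_singleton_iff] at h0
    rw [h0] at hx
    refine (notMem_tsupport_iff_eventuallyEq.2 ?_) hx
    have hball : Metric.ball (0 : E d) (1 / ((k : ℝ) + 1)) ∈ 𝓝 (0 : E d) :=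
      Metric.ball_mem_nhds _ (by positivity)
    filter_upwards [hball] with y hy
    have : b (((k : ℝ) + 1) • y) = 1 := b.one_of_mem_closedBall (by
      rw [mem_ball_zero_iff, lt_div_iff₀ (by positivity)] at hy
      rw [mem_closedBall_zero_iff, norm_smul, Real.norm_of_nonneg (by positivity), mul_comm]
      exact hy.le)
    simp [hζ, this]
  have hlim0 : ∀ x : E d, x ≠ 0 → ∀ᶠ k : ℕ in atTop, 2 < ‖((k : ℝ) + 1) • x‖ := by
    intro x hx
    have hx' : 0 < ‖x‖ := norm_pos_iff.2 hx
    filter_upwards [eventually_ge_atTop ⌈2 / ‖x‖⌉₊] with k hk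
    rw [norm_smul, Real.norm_of_nonneg (by positivity), ← div_lt_iff₀ hx']
    have := Nat.ceil_le.1 hk
    linarith
  have hbz : ∀ y : E d, 2 < ‖y‖ → b y = 0 ∧ radialPart (grad b) y = 0 := by
    intro y hy
    have : y ∉ tsupport b := by rw [b.tsupport_eq]; simpa [b] using hy
    exact ⟨image_eq_zero_of_notMem_tsupport this,
      Finset.sum_eq_zero fun i _ => by simp [grad, partialDeriv_eq_zero_of_notMem this i]⟩
  have hfr := (contDiff_radialPart_grad hf.1).continuous
  have if1 : Integrable fun x => f x * n x :=
    integrable_mul_of_locallyIntegrableOn hf.1.continuous hf.2.1 (subset_univ _) hnlu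
  have if2 : Integrable fun x => radialPart (grad f) x * n x :=
    integrable_mul_of_locallyIntegrableOn hfr hf.radialPart_hasCompactSupport (subset_univ _) hnlu
  have hζlim : ∀ x : E d, x ≠ 0 → ∀ᶠ k in atTop, ζ k x = 1 ∧ radialPart (grad (ζ k)) x = 0 := by
    intro x hx
    filter_upwards [hlim0 x hx] with k hk
    rw [hζr, (hbz _ hk).2]
    simp [hζ, (hbz _ hk).1]
  have lim1 : Tendsto (fun k => ∫ x, (d * (f x * ζ k x)
      + radialPart (grad fun y => f y * ζ k y) x) * n x) atTop
      (𝓝 (∫ x, (d * f x + radialPart (grad f) x) * n x)) := by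
    refine tendsto_integral_of_dominated_convergence
      (fun x => (d + C) * ‖f x * n x‖ + ‖radialPart (grad f) x * n x‖) (fun k => ?_)
      ((if1.norm.const_mul _).add if2.norm) (fun k => Eventually.of_forall fun x => ?_) ?_
    · exact (((continuous_const.mul (hT k).1.continuous).add
        (contDiff_radialPart_grad (hT k).1).continuous).aestronglyMeasurable).mul hnl.aestronglyMeasurable
    · rw [radialPart_grad_mul hf.1 (hζc k), hζr]
      have e : (d * (f x * ζ k x) + (f x * -radialPart (grad b) (((k : ℝ) + 1) • x)
          + radialPart (grad f) x * ζ k x)) * n x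
          = (d * ζ k x - radialPart (grad b) (((k : ℝ) + 1) • x)) * (f x * n x)
            + ζ k x * (radialPart (grad f) x * n x) := by ring
      rw [e]
      refine (norm_add_le _ _).trans (add_le_add ?_ ?_)
      · rw [norm_mul]
        refine mul_le_mul_of_nonneg_right ((norm_sub_le _ _).trans (add_le_add ?_ (hC _)))
          (norm_nonneg _)
        rw [norm_mul, Real.norm_of_nonneg (hζ0 k x), Real.norm_natCast]
        exact mul_le_of_le_one_right (Nat.cast_nonneg _) (hζ1 k x)
      · rw [norm_mul, Real.norm_of_nonneg (hζ0 k x)]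
        exact mul_le_of_le_one_left (norm_nonneg _) (hζ1 k x)
    · filter_upwards [ae_ne_zero] with x hx
      refine tendsto_const_nhds.congr' ?_
      filter_upwards [hζlim x hx] with k hk
      rw [radialPart_grad_mul hf.1 (hζc k), hk.1, hk.2]
      ring
  have hbm : Measurable fun x : E d => decreaseRate n Dn ‖x‖ :=
    (measurable_decreaseRate n Dn).comp measurable_norm
  have lim2 : Tendsto (fun k => ∫ x, decreaseRate n Dn ‖x‖ * (f x * ζ k x * n x)) atTop
      (𝓝 (∫ x, decreaseRate n Dn ‖x‖ * (f x * n x))) := by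
    refine tendsto_integral_of_dominated_convergence (fun x => ‖f x * n x‖) (fun k => ?_)
      if1.norm (fun k => Eventually.of_forall fun x => ?_) ?_
    · exact hbm.aestronglyMeasurable.mul ((hT k).1.continuous.aestronglyMeasurable.mul hnl.aestronglyMeasurable)
    · rw [norm_mul, show f x * ζ k x * n x = ζ k x * (f x * n x) by ring, norm_mul (ζ k x),
        Real.norm_of_nonneg (decreaseRate_nonneg _ _ _), Real.norm_of_nonneg (hζ0 k x)]
      have h1 := (decreaseRate_le hβ ‖x‖)
      have h2 := decreaseRate_nonneg n Dn ‖x‖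
      have h3 := hζ1 k x
      have h4 := hζ0 k x
      rw [← mul_assoc]
      exact mul_le_of_le_one_left (norm_nonneg _) (by nlinarith)
    · filter_upwards [ae_ne_zero] with x hx
      refine tendsto_const_nhds.congr' ?_
      filter_upwards [hζlim x hx] with k hk
      rw [hk.1, mul_one]
  exact le_of_tendsto_of_tendsto' lim1 lim2 fun k =>
    integral_mul_div_le_of_notMem hpos hβ hDn (hT k) fun x => mul_nonneg (hf0 x) (hζ0 k x)

end

/-! ### The virial inequality -/

section
variable {d : ℕ} {n v : E d → ℝ} {Dn Dv : Fin d → E d → ℝ} {w : ℕ → E d → ℝ}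

theorem MemLpLoc.radialPart (h : ∀ i, MemLpLoc 2 (Dv i)) : MemLpLoc 2 (radialPart Dv) :=
  MemLpLoc.sum _ fun i _ => (h i).bdd_mul (contDiff_coord (m := ∞) i).continuous.locBdd

theorem MemLpLoc.dotProd (h : ∀ i, MemLpLoc 2 (Dv i)) : MemLpLoc 1 (dotProd Dv Dv) :=
  MemLpLoc.sum _ fun i _ => (h i).mul (h i)

theorem MemLpLoc.dotProd_left {H : Fin d → E d → ℝ} (hH : ∀ i, Continuous (H i))
    (h : ∀ i, MemLpLoc 2 (Dv i)) : MemLpLoc 2 (Helmholtz.dotProd H Dv) :=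
  MemLpLoc.sum _ fun i _ => (h i).bdd_mul (hH i).locBdd

theorem integral_linear_combination {f₁ f₂ f₃ f₄ : E d → ℝ} (h₁ : Integrable f₁)
    (h₂ : Integrable f₂) (h₃ : Integrable f₃) (h₄ : Integrable f₄) (a b : ℝ) :
    ∫ x, (a * f₁ x + b * f₂ x + (f₃ x - f₄ x))
      = a * (∫ x, f₁ x) + b * (∫ x, f₂ x) + ((∫ x, f₃ x) - ∫ x, f₄ x) := by
  have e₁ : Integrable fun x => a * f₁ x + b * f₂ x := (h₁.const_mul a).add (h₂.const_mul b)
  have e₂ : Integrable fun x => f₃ x - f₄ x := h₃.sub h₄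
  rw [integral_add e₁ e₂, integral_add (h₁.const_mul a) (h₂.const_mul b), integral_sub h₃ h₄,
    integral_const_mul, integral_const_mul]

/-- `integral_mul_div_le` with the multiplier `χ v²`, whose radial derivative is computed from the
weak gradient of `v`. -/
theorem SmoothApprox.integral_mul_div_le [NeZero d] {g : E d → ℝ} (h : SmoothApprox w v Dv g)
    (hpos : ∀ᵐ x : E d, 0 < n x) (hβ : betaConst n Dn < 1) (hDn : HasWeakGradientOn {0}ᶜ n Dn)
    (hnb : LocBdd n) {χ : E d → ℝ} (hχ : IsTestFunction univ χ) (hχ0 : ∀ x, 0 ≤ χ x) :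
    ∫ x, n x * ((d * χ x + radialPart (grad χ) x) * (v x * v x)
        + 2 * χ x * (v x * radialPart Dv x))
      ≤ ∫ x, decreaseRate n Dn ‖x‖ * χ x * n x * (v x * v x) := by
  obtain ⟨R, hR⟩ := hχ.2.1.exists_radius
  have hz : ∀ x, R < ‖x‖ → χ x = 0 := fun x hx => image_eq_zero_of_notMem_tsupport (hR x hx)
  have hχr : ∀ x, R < ‖x‖ → radialPart (grad χ) x = 0 := fun x hx =>
    Finset.sum_eq_zero fun i _ => by simp [grad, partialDeriv_eq_zero_of_notMem (hR x hx) i]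
  have hbm : Measurable fun x : E d => decreaseRate n Dn ‖x‖ :=
    (measurable_decreaseRate n Dn).comp measurable_norm
  have hb : LocBdd fun x : E d => decreaseRate n Dn ‖x‖ := ⟨hbm.aestronglyMeasurable, fun _ =>
    ⟨1 / 2, Eventually.of_forall fun x => by
      rw [Real.norm_of_nonneg (decreaseRate_nonneg _ _ _)]; exact decreaseRate_le hβ _⟩⟩
  have c1 : Continuous fun x => d * χ x + radialPart (grad χ) x :=
    (continuous_const.mul hχ.1.continuous).add (contDiff_radialPart_grad hχ.1).continuous
  have c2 : Continuous fun x => 2 * χ x := continuous_const.mul hχ.1.continuous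
  have conv1 := (((h.conv.mul h.conv).bdd_mul c1.locBdd).add le_rfl
    ((h.conv.mul (ConvLoc.radialPart h.conv_grad)).bdd_mul c2.locBdd)).bdd_mul hnb
  have conv2 := (h.conv.mul h.conv).bdd_mul ((hb.mul hχ.1.continuous.locBdd).mul hnb)
  refine le_of_tendsto_of_tendsto' (conv1.tendsto_integral (R := R) (fun k x hx => ?_) fun x hx => ?_)
    (conv2.tendsto_integral (R := R) (fun k x hx => ?_) fun x hx => ?_) fun k => ?_
  any_goals simp [hz x hx, hχr x hx]
  have hw := h.smooth k
  have hT : IsTestFunction univ (fun x => χ x * (w k x * w k x)) :=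
    ⟨hχ.1.mul (hw.mul hw), hχ.2.1.mul_right, subset_univ _⟩
  have := Helmholtz.integral_mul_div_le hpos hβ hDn hnb hT
    fun x => mul_nonneg (hχ0 x) (mul_self_nonneg _)
  refine le_of_eq_of_le (integral_congr_ae (Eventually.of_forall fun x => ?_))
    (this.trans_eq (integral_congr_ae (Eventually.of_forall fun x => ?_)))
  · simp only [radialPart_grad_mul hχ.1 (hw.mul hw), radialPart_grad_mul hw hw]
    ring
  · simp only; ring

/-- The virial inequality: Pohozaev's identity combined with the local energy identity and the
condition on the radial decrease of `n`. -/
theorem SmoothApprox.virial [NeZero d] (h : SmoothApprox w v Dv fun x => -(n x * v x))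
    (hpos : ∀ᵐ x : E d, 0 < n x) (hβ : betaConst n Dn < 1) (hDn : HasWeakGradientOn {0}ᶜ n Dn)
    (hnb : LocBdd n) {χ : E d → ℝ} (hχ : IsTestFunction univ χ) (hχ0 : ∀ x, 0 ≤ χ x) :
    ∫ x, (2 * (radialPart Dv x * dotProd (grad χ) Dv x)
        - radialPart (grad χ) x * dotProd Dv Dv x
        + (d - 2) * (v x * dotProd (grad χ) Dv x)
        + radialPart (grad χ) x * (n x * (v x * v x))
        + (2 - decreaseRate n Dn ‖x‖) * χ x * (n x * (v x * v x))) ≤ 0 := by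
  obtain ⟨R, hR⟩ := hχ.2.1.exists_radius
  have hz : ∀ x, R < ‖x‖ → χ x = 0 := fun x hx => image_eq_zero_of_notMem_tsupport (hR x hx)
  have hχr : ∀ x, R < ‖x‖ → radialPart (grad χ) x = 0 := fun x hx =>
    Finset.sum_eq_zero fun i _ => by simp [grad, partialDeriv_eq_zero_of_notMem (hR x hx) i]
  have hχd : ∀ x, R < ‖x‖ → dotProd (grad χ) Dv x = 0 := fun x hx =>
    dotProd_grad_eq_zero (hR x hx) _
  have hbm : Measurable fun x : E d => decreaseRate n Dn ‖x‖ :=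
    (measurable_decreaseRate n Dn).comp measurable_norm
  have hb : LocBdd fun x : E d => decreaseRate n Dn ‖x‖ := ⟨hbm.aestronglyMeasurable, fun _ =>
    ⟨1 / 2, Eventually.of_forall fun x => by
      rw [Real.norm_of_nonneg (decreaseRate_nonneg _ _ _)]; exact decreaseRate_le hβ _⟩⟩
  have mv := h.memLpLoc
  have mX := MemLpLoc.radialPart h.memLpLoc_grad
  have mS := MemLpLoc.dotProd h.memLpLoc_grad
  have mT := MemLpLoc.dotProd_left hχ.grad_continuous h.memLpLoc_grad
  have mnv := mv.bdd_mul hnb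
  have mχ : LocBdd χ := hχ.1.continuous.locBdd
  have mρ : LocBdd (radialPart (grad χ)) := (contDiff_radialPart_grad hχ.1).continuous.locBdd
  have iXT : Integrable fun x => radialPart Dv x * dotProd (grad χ) Dv x :=
    (mX.mul mT).integrable (R := R) fun x hx => by simp [hχd x hx]
  have ivT : Integrable fun x => v x * dotProd (grad χ) Dv x :=
    (mv.mul mT).integrable (R := R) fun x hx => by simp [hχd x hx]
  have iρS : Integrable fun x => radialPart (grad χ) x * dotProd Dv Dv x :=
    (mS.bdd_mul mρ).integrable (R := R) fun x hx => by simp [hχr x hx]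
  have iχS : Integrable fun x => χ x * dotProd Dv Dv x :=
    (mS.bdd_mul mχ).integrable (R := R) fun x hx => by simp [hz x hx]
  have mnvv : MemLpLoc 1 fun x => n x * (v x * v x) := (mv.mul mv).bdd_mul hnb
  have mnvX : MemLpLoc 1 fun x => n x * (v x * radialPart Dv x) := (mv.mul mX).bdd_mul hnb
  have iχn : Integrable fun x => χ x * (n x * (v x * v x)) :=
    (mnvv.bdd_mul mχ).integrable (R := R) fun x hx => by simp [hz x hx]
  have iρn : Integrable fun x => radialPart (grad χ) x * (n x * (v x * v x)) :=
    (mnvv.bdd_mul mρ).integrable (R := R) fun x hx => by simp [hχr x hx]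
  have iχX : Integrable fun x => χ x * (n x * (v x * radialPart Dv x)) :=
    (mnvX.bdd_mul mχ).integrable (R := R) fun x hx => by simp [hz x hx]
  have ibn : Integrable fun x => decreaseRate n Dn ‖x‖ * (χ x * (n x * (v x * v x))) :=
    ((mnvv.bdd_mul mχ).bdd_mul hb).integrable (R := R) fun x hx => by simp [hz x hx]
  have iP : Integrable fun x => χ x * (radialPart Dv x * -(n x * v x)
      + (1 - d / 2) * dotProd Dv Dv x) + (radialPart Dv x * dotProd (grad χ) Dv x
        - radialPart (grad χ) x / 2 * dotProd Dv Dv x) :=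
    (((iχX.const_mul (-1)).add (iχS.const_mul (1 - d / 2))).add
      (iXT.sub (iρS.const_mul (1 / 2)))).congr (Eventually.of_forall fun x => by
        simp only [Pi.add_apply, Pi.sub_apply]; ring)
  have iV : Integrable fun x => χ x * (v x * -(n x * v x) + dotProd Dv Dv x)
      + v x * dotProd (grad χ) Dv x :=
    (((iχn.const_mul (-1)).add iχS).add ivT).congr (Eventually.of_forall fun x => by
        simp only [Pi.add_apply]; ring)
  have iN : Integrable fun x => n x * ((d * χ x + radialPart (grad χ) x) * (v x * v x)
        + 2 * χ x * (v x * radialPart Dv x)) :=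
    (((iχn.const_mul d).add iρn).add (iχX.const_mul 2)).congr (Eventually.of_forall fun x => by
        simp only [Pi.add_apply]; ring)
  have iN' : Integrable fun x => decreaseRate n Dn ‖x‖ * χ x * n x * (v x * v x) :=
    ibn.congr (Eventually.of_forall fun x => by simp only; ring)
  -- twice Pohozaev's identity plus `d - 2` times the energy identity, which removes `χ |∇v|²`; the
  -- decrease condition replaces `χ n v (x · ∇v)`
  have hP := h.integral_pohozaev hχ
  have hV := h.integral_energy hχ
  have hN := h.integral_mul_div_le hpos hβ hDn hnb hχ hχ0
  have key := integral_linear_combination iP iV iN iN' 2 (d - 2)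
  rw [hP, hV] at key
  refine le_trans (le_of_eq ?_) (key.trans_le (by linarith))
  refine integral_congr_ae (Eventually.of_forall fun x => ?_)
  simp only
  ring

/-! ### Radial cut-offs -/

/-- Smooth functions of the radius that are constant near the origin and vanish for large radii;
composed with the norm they are test functions. -/
structure IsRadialCutoff (η : ℝ → ℝ) : Prop where
  smooth : ContDiff ℝ ∞ η
  const : ∃ δ > 0, ∀ r < δ, η r = η 0
  bdd : ∃ R, ∀ r, R < r → η r = 0

theorem hasFDerivAt_norm_euclidean {x : E d} (hx : x ≠ 0) :
    HasFDerivAt (fun y : E d => ‖y‖) (‖x‖⁻¹ • innerSL ℝ x) x := by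
  have h1 := (hasStrictFDerivAt_norm_sq x).hasFDerivAt
  have hx2 : ‖x‖ ^ 2 ≠ 0 := by simpa using hx
  have h2 := h1.sqrt hx2
  simp only [Real.sqrt_sq (norm_nonneg _)] at h2
  refine h2.congr_fderiv ?_
  ext y
  have : ‖x‖ ≠ 0 := norm_ne_zero_iff.2 hx
  simp
  field_simp

theorem IsRadialCutoff.partialDeriv {η : ℝ → ℝ} (hη : IsRadialCutoff η) (i : Fin d) (x : E d) :
    partialDeriv i (fun y => η ‖y‖) x = deriv η ‖x‖ * (x i / ‖x‖) := by
  rcases eq_or_ne x 0 with rfl | hx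
  · obtain ⟨δ, hδ, h⟩ := hη.const
    have : (fun y : E d => η ‖y‖) =ᶠ[𝓝 0] fun _ => η 0 := by
      filter_upwards [Metric.ball_mem_nhds (0 : E d) hδ] with y hy
      exact h _ (by simpa using hy)
    simp [Helmholtz.partialDeriv, this.fderiv_eq]
  · have h1 : HasDerivAt η (deriv η ‖x‖) ‖x‖ :=
      (hη.smooth.differentiable (by norm_num) _).hasDerivAt
    have h2 := h1.comp_hasFDerivAt x (hasFDerivAt_norm_euclidean hx)
    unfold Helmholtz.partialDeriv
    rw [show (fun y : E d => η ‖y‖) = η ∘ fun y : E d => ‖y‖ from rfl, h2.fderiv]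
    simp [EuclideanSpace.inner_single_right]
    left
    field_simp

theorem IsRadialCutoff.isTestFunction {η : ℝ → ℝ} (hη : IsRadialCutoff η) :
    IsTestFunction univ (fun x : E d => η ‖x‖) := by
  refine ⟨?_, ?_, subset_univ _⟩
  · rw [contDiff_iff_contDiffAt]
    intro x
    rcases eq_or_ne x 0 with rfl | hx
    · obtain ⟨δ, hδ, h⟩ := hη.const
      have : (fun y : E d => η ‖y‖) =ᶠ[𝓝 0] fun _ => η 0 := by
        filter_upwards [Metric.ball_mem_nhds (0 : E d) hδ] with y hy
        exact h _ (by simpa using hy)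
      exact contDiffAt_const.congr_of_eventuallyEq this
    · exact hη.smooth.contDiffAt.comp x (contDiffAt_norm ℝ hx)
  · obtain ⟨R, hR⟩ := hη.bdd
    refine HasCompactSupport.intro (isCompact_closedBall (0 : E d) R) fun x hx => hR _ ?_
    simpa using hx

theorem IsRadialCutoff.dotProd {η : ℝ → ℝ} (hη : IsRadialCutoff η) (G : Fin d → E d → ℝ) (x : E d) :
    dotProd (grad fun y => η ‖y‖) G x = deriv η ‖x‖ * (radialPart G x / ‖x‖) := by
  simp only [Helmholtz.dotProd, grad, hη.partialDeriv, radialPart, Finset.sum_div, Finset.mul_sum]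
  exact Finset.sum_congr rfl fun _ _ => by ring

theorem sum_coord_sq (x : E d) : ∑ i, x i * x i = ‖x‖ ^ 2 := by
  rw [EuclideanSpace.norm_sq_eq]
  exact Finset.sum_congr rfl fun i _ => by simp [sq]

theorem IsRadialCutoff.radialPart {η : ℝ → ℝ} (hη : IsRadialCutoff η) (x : E d) :
    radialPart (grad fun y => η ‖y‖) x = deriv η ‖x‖ * ‖x‖ := by
  have : ∀ i, x i * (deriv η ‖x‖ * (x i / ‖x‖)) = deriv η ‖x‖ / ‖x‖ * (x i * x i) := fun i => by
    ring
  simp only [Helmholtz.radialPart, grad, hη.partialDeriv, this, ← Finset.mul_sum, sum_coord_sq]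
  rcases eq_or_ne ‖x‖ 0 with h | h
  · simp [h]
  · field_simp

end

/-! ### Radial forms of the virial inequality -/

/-- The density whose integral over the sphere of radius `r` is the Pohozaev boundary term `K(r)`:
`r (|∂_r v|² - |∇_τ v|² + n v²) + (d - 2) v ∂_r v`. -/
noncomputable def virialDensity {d : ℕ} (n v : E d → ℝ) (Dv : Fin d → E d → ℝ) (x : E d) : ℝ :=
  2 * (radialPart Dv x * radialPart Dv x) / ‖x‖ - ‖x‖ * dotProd Dv Dv x
    + ‖x‖ * (n x * (v x * v x)) + (d - 2) * (v x * radialPart Dv x) / ‖x‖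

/-- The density whose integral over the sphere of radius `r` is the energy `F(r)` of the
one-dimensional profile `r^((d-1)/2) v`:
`|∂_r v + (d-1) v / (2r)|² + n v² - |∇_τ v|² - (d-1)(d-3) v² / (4r²)`. -/
noncomputable def profileDensity {d : ℕ} (n v : E d → ℝ) (Dv : Fin d → E d → ℝ) (x : E d) : ℝ :=
  2 * (radialPart Dv x * radialPart Dv x) / ‖x‖ ^ 2 - dotProd Dv Dv x + n x * (v x * v x)
    + (d - 1) * (v x * radialPart Dv x) / ‖x‖ ^ 2 + (d - 1) * (v x * v x) / (2 * ‖x‖ ^ 2)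

/-- The quadratic form `(r/2) n v² + r² |∇_τ v|² + (d-1)(d-3) v² / 4`; its spherical means have to
be nonnegative for the energy `F` to be almost increasing. -/
noncomputable def angularDensity {d : ℕ} (n v : E d → ℝ) (Dv : Fin d → E d → ℝ) (x : E d) : ℝ :=
  ‖x‖ / 2 * (n x * (v x * v x))
    + (‖x‖ ^ 2 * dotProd Dv Dv x - radialPart Dv x * radialPart Dv x)
    + (d - 1) * (d - 3) / 4 * (v x * v x)

/-- Smooth functions of the radius supported in a bounded part of `[R₀, ∞)`. -/
structure IsRadialTest (R₀ : ℝ) (χ : ℝ → ℝ) : Prop where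
  smooth : ContDiff ℝ ∞ χ
  zero : ∀ r ≤ R₀, χ r = 0
  bdd : ∃ R, ∀ r, R < r → χ r = 0

/-- Bounded measurable functions of the radius that vanish off `[a, R]`. -/
structure IsRadialWeight (a R : ℝ) (c : ℝ → ℝ) : Prop where
  measurable : Measurable c
  bound : ∃ C, ∀ r, |c r| ≤ C
  supp : ∀ r, c r ≠ 0 → a ≤ r ∧ r ≤ R

section

theorem IsRadialWeight.mul_left {a R : ℝ} {c e : ℝ → ℝ} (hc : IsRadialWeight a R c)
    (he : Measurable e) (hb : ∃ C, ∀ r, a ≤ r → |e r| ≤ C) :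
    IsRadialWeight a R (fun r => e r * c r) := by
  refine ⟨he.mul hc.1, ?_, fun r hr => hc.3 r (right_ne_zero_of_mul hr)⟩
  obtain ⟨C, hC⟩ := hb
  obtain ⟨C', hC'⟩ := hc.2
  refine ⟨|C| * C', fun r => ?_⟩
  rcases eq_or_ne (c r) 0 with h | h
  · rw [h, mul_zero, abs_zero]
    exact mul_nonneg (abs_nonneg _) ((abs_nonneg _).trans (hC' r))
  · rw [abs_mul]
    exact mul_le_mul (((hC r (hc.3 r h).1)).trans (le_abs_self C)) (hC' r) (abs_nonneg _)
      (abs_nonneg _)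

theorem IsRadialWeight.inv_pow {a R : ℝ} {c : ℝ → ℝ} (ha : 0 < a) (hc : IsRadialWeight a R c)
    (k : ℕ) : IsRadialWeight a R (fun r => (r ^ k)⁻¹ * c r) := by
  refine hc.mul_left (measurable_id.pow_const k).inv ⟨(a ^ k)⁻¹, fun r hr => ?_⟩
  have : 0 < r := ha.trans_le hr
  rw [abs_of_nonneg (by positivity)]
  gcongr

theorem IsRadialWeight.pow {a R : ℝ} {c : ℝ → ℝ} (ha : 0 < a) (hc : IsRadialWeight a R c)
    (k : ℕ) : IsRadialWeight a R (fun r => r ^ k * c r) := by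
  have h : IsRadialWeight a R (fun r => min |r| R ^ k * c r) := by
    refine hc.mul_left ((measurable_norm (α := ℝ).min measurable_const).pow_const k)
      ⟨|R| ^ k + a ^ k, fun r hr => ?_⟩
    rw [abs_pow]
    have : |min |r| R| ≤ |R| := by
      rcases le_total |r| R with h | h
      · rw [min_eq_left h, abs_abs]; exact h.trans (le_abs_self R)
      · rw [min_eq_right h]
    have h2 : 0 ≤ a ^ k := by positivity
    have h3 := pow_le_pow_left₀ (abs_nonneg _) this k
    linarith
  have e : (fun r => min |r| R ^ k * c r) = fun r => r ^ k * c r := by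
    ext r
    rcases eq_or_ne (c r) 0 with h0 | h0
    · simp [h0]
    · have h1 := hc.3 r h0
      rw [abs_of_nonneg (ha.le.trans h1.1), min_eq_left h1.2]
  rwa [e] at h

theorem IsRadialTest.deriv_eq_zero {R₀ : ℝ} {χ : ℝ → ℝ} (h : IsRadialTest R₀ χ) {r : ℝ}
    (hr : r < R₀) : deriv χ r = 0 := by
  have : χ =ᶠ[𝓝 r] fun _ => 0 := (eventually_lt_nhds hr).mono fun s hs => h.zero s hs.le
  rw [this.deriv_eq, deriv_const]

theorem IsRadialTest.hasCompactSupport {R₀ : ℝ} {χ : ℝ → ℝ} (h : IsRadialTest R₀ χ) :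
    HasCompactSupport χ := by
  obtain ⟨R, hR⟩ := h.bdd
  refine HasCompactSupport.intro (isCompact_Icc (a := R₀) (b := R)) fun x hx => ?_
  by_contra h0
  refine hx ⟨?_, ?_⟩
  · by_contra h1
    exact h0 (h.zero x (not_le.1 h1).le)
  · by_contra h1
    exact h0 (hR x (not_le.1 h1))

theorem IsRadialTest.exists_weight {R₀ : ℝ} {χ : ℝ → ℝ} (h : IsRadialTest R₀ χ) :
    ∃ R, IsRadialWeight R₀ R χ ∧ IsRadialWeight R₀ R (deriv χ) := by
  obtain ⟨R, hR⟩ := h.bdd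
  have hd : Continuous (deriv χ) := h.smooth.continuous_deriv (by norm_num)
  refine ⟨R, ⟨h.smooth.continuous.measurable, ?_, fun r hr => ⟨?_, ?_⟩⟩,
    ⟨hd.measurable, ?_, fun r hr => ⟨?_, ?_⟩⟩⟩
  · exact h.hasCompactSupport.exists_bound_of_continuous h.smooth.continuous
  · by_contra h1
    exact hr (h.zero r (not_le.1 h1).le)
  · by_contra h1
    exact hr (hR r (not_le.1 h1))
  · exact h.hasCompactSupport.deriv.exists_bound_of_continuous hd
  · by_contra h1
    exact hr (h.deriv_eq_zero (not_le.1 h1))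
  · by_contra h1
    have : χ =ᶠ[𝓝 r] fun _ => 0 := (eventually_gt_nhds (not_le.1 h1)).mono fun s hs => hR s hs
    exact hr (by rw [this.deriv_eq, deriv_const])

theorem IsRadialTest.div_pow {R₀ : ℝ} (hR₀ : 0 < R₀) {χ : ℝ → ℝ} (h : IsRadialTest R₀ χ) (k : ℕ) :
    IsRadialCutoff (fun r => χ r / r ^ k) := by
  refine ⟨?_, ⟨R₀, hR₀, fun r hr => ?_⟩, ?_⟩
  · rw [contDiff_iff_contDiffAt]
    intro r
    rcases lt_or_ge r R₀ with hr | hr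
    · have : (fun r => χ r / r ^ k) =ᶠ[𝓝 r] fun _ => 0 :=
        (eventually_lt_nhds hr).mono fun s hs => by simp [h.zero s hs.le]
      exact contDiffAt_const.congr_of_eventuallyEq this
    · exact h.smooth.contDiffAt.div (contDiffAt_id.pow k) (pow_ne_zero _ (hR₀.trans_le hr).ne')
  · simp [h.zero r hr.le, h.zero 0 hR₀.le]
  · obtain ⟨R, hR⟩ := h.bdd
    exact ⟨R, fun r hr => by simp [hR r hr]⟩

theorem IsRadialTest.deriv_div_pow {R₀ : ℝ} (hR₀ : 0 < R₀) {χ : ℝ → ℝ} (h : IsRadialTest R₀ χ)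
    (k : ℕ) (r : ℝ) :
    deriv (fun r => χ r / r ^ k) r = deriv χ r / r ^ k - k * χ r / r ^ (k + 1) := by
  rcases lt_or_ge r R₀ with hr | hr
  · have : (fun r => χ r / r ^ k) =ᶠ[𝓝 r] fun _ => 0 :=
      (eventually_lt_nhds hr).mono fun s hs => by simp [h.zero s hs.le]
    rw [this.deriv_eq, deriv_const, h.deriv_eq_zero hr, h.zero r hr.le]
    simp
  · have hr0 : r ≠ 0 := (hR₀.trans_le hr).ne'
    have h1 : HasDerivAt χ (deriv χ r) r := (h.smooth.differentiable (by norm_num) r).hasDerivAt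
    have h2 := h1.div (hasDerivAt_pow k r) (pow_ne_zero k hr0)
    rw [show (fun r => χ r / r ^ k) = χ / fun r => r ^ k from rfl, h2.deriv]
    rcases k with _ | k
    · simp
    · field_simp
      simp
      ring

variable {d : ℕ} {n v : E d → ℝ} {Dn Dv : Fin d → E d → ℝ} {w : ℕ → E d → ℝ}

theorem IsRadialWeight.integrable {a R : ℝ} {c : ℝ → ℝ} (hc : IsRadialWeight a R c) {h : E d → ℝ}
    (hh : MemLpLoc 1 h) : Integrable fun x => c ‖x‖ * h x := by
  obtain ⟨C, hC⟩ := hc.bound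
  have : LocBdd fun x : E d => c ‖x‖ := ⟨(hc.measurable.comp measurable_norm).aestronglyMeasurable,
    fun _ => ⟨C, Eventually.of_forall fun x => hC _⟩⟩
  refine hh.integrable_mul this (R := R) fun x hx => ?_
  by_contra h0
  exact absurd (hc.supp _ h0).2 (not_le.2 hx)

namespace SmoothApprox

/-- The virial inequality for a radial cut-off: `K' ≥ (2 - b) ∫_{|x|=r} n v²` in the weak sense. -/
theorem radial_virial [NeZero d] (h : SmoothApprox w v Dv fun x => -(n x * v x))
    (hpos : ∀ᵐ x : E d, 0 < n x) (hβ : betaConst n Dn < 1) (hDn : HasWeakGradientOn {0}ᶜ n Dn)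
    (hnb : LocBdd n) {η : ℝ → ℝ} (hη : IsRadialCutoff η) (hη0 : ∀ r, 0 ≤ η r) :
    ∫ x, (deriv η ‖x‖ * virialDensity n v Dv x
      + (2 - decreaseRate n Dn ‖x‖) * η ‖x‖ * (n x * (v x * v x))) ≤ 0 := by
  refine le_of_eq_of_le (integral_congr_ae (Eventually.of_forall fun x => ?_))
    (h.virial hpos hβ hDn hnb hη.isTestFunction fun x => hη0 ‖x‖)
  simp only [hη.dotProd, hη.radialPart, virialDensity]
  ring

/-- The energy identity for a radial cut-off. -/
theorem radial_energy (h : SmoothApprox w v Dv fun x => -(n x * v x)) {η : ℝ → ℝ}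
    (hη : IsRadialCutoff η) :
    ∫ x, (η ‖x‖ * (dotProd Dv Dv x - n x * (v x * v x))
      + deriv η ‖x‖ * (v x * radialPart Dv x / ‖x‖)) = 0 := by
  rw [← h.integral_energy hη.isTestFunction]
  refine integral_congr_ae (Eventually.of_forall fun x => ?_)
  simp only [hη.dotProd]
  ring

/-- The divergence theorem for the field `η(|x|) v² x`. -/
theorem radial_sq {g : E d → ℝ} (h : SmoothApprox w v Dv g) {η : ℝ → ℝ} (hη : IsRadialCutoff η) :
    ∫ x, (2 * η ‖x‖ * (v x * radialPart Dv x)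
      + (d * η ‖x‖ + ‖x‖ * deriv η ‖x‖) * (v x * v x)) = 0 := by
  have hT := hη.isTestFunction (d := d)
  have hψ : ∀ i : Fin d, IsTestFunction univ (fun x : E d => x i * η ‖x‖) := fun i =>
    ⟨(contDiff_coord i).mul hT.1, hT.2.1.mul_left, subset_univ _⟩
  obtain ⟨R, hR⟩ := hT.2.1.exists_radius
  have hz : ∀ x : E d, R < ‖x‖ → η ‖x‖ = 0 := fun x hx =>
    image_eq_zero_of_notMem_tsupport (f := fun x : E d => η ‖x‖) (hR x hx)
  have hz' : ∀ i, ∀ x : E d, R < ‖x‖ → Helmholtz.partialDeriv i (fun x => x i * η ‖x‖) x = 0 :=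
    fun i x hx => partialDeriv_eq_zero_of_notMem
      (fun hx' => hR x hx (tsupport_mul_subset_right (f := fun x : E d => x i) hx')) i
  have hi : ∀ i, Integrable fun x => 2 * (x i * η ‖x‖) * (v x * Dv i x)
      + Helmholtz.partialDeriv i (fun x => x i * η ‖x‖) x * (v x * v x) := fun i =>
    ((((h.memLpLoc.mul (h.memLpLoc_grad i)).bdd_mul
      (continuous_const.mul (hψ i).1.continuous).locBdd).add
      ((h.memLpLoc.mul h.memLpLoc).bdd_mul ((hψ i).grad_continuous i).locBdd)).integrable (R := R)
      fun x hx => by simp [hz x hx, grad, hz' i x hx])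
  have hs : ∑ i, ∫ x, (2 * (x i * η ‖x‖) * (v x * Dv i x)
      + Helmholtz.partialDeriv i (fun x => x i * η ‖x‖) x * (v x * v x)) = 0 :=
    Finset.sum_eq_zero fun i _ => h.integral_sq (hψ i) i
  rw [← integral_finsetSum _ fun i _ => hi i] at hs
  rw [← hs]
  refine integral_congr_ae (Eventually.of_forall fun x => ?_)
  simp only [partialDeriv_mul (contDiff_coord _) hT.1, hη.partialDeriv, partialDeriv_coord,
    if_true, Finset.sum_add_distrib, ← Finset.sum_mul]
  have e1 : ∑ i, 2 * (x i * η ‖x‖) * (v x * Dv i x) = 2 * η ‖x‖ * (v x * radialPart Dv x) := by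
    simp only [radialPart, Finset.mul_sum]
    exact Finset.sum_congr rfl fun _ _ => by ring
  have e2 : ∑ i, x i * (deriv η ‖x‖ * (x i / ‖x‖)) = ‖x‖ * deriv η ‖x‖ := by
    have : ∀ i, x i * (deriv η ‖x‖ * (x i / ‖x‖)) = deriv η ‖x‖ / ‖x‖ * (x i * x i) := fun i => by
      ring
    simp only [this, ← Finset.mul_sum, sum_coord_sq]
    rcases eq_or_ne ‖x‖ 0 with h | h
    · simp [h]
    · field_simp
  rw [e1, e2]
  simp only [mul_one, Finset.sum_const, Finset.card_univ, Fintype.card_fin, nsmul_eq_mul]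
  ring

/-- Pointwise form of the density of `F` as a square plus lower order terms. -/
theorem profileDensity_eq (x : E d) (hx : x ≠ 0) :
    profileDensity n v Dv x
      = (radialPart Dv x / ‖x‖ + (d - 1) * v x / (2 * ‖x‖)) ^ 2 + n x * (v x * v x)
        - (dotProd Dv Dv x - radialPart Dv x * radialPart Dv x / ‖x‖ ^ 2)
        - (d - 1) * (d - 3) * (v x * v x) / (4 * ‖x‖ ^ 2) := by
  have : ‖x‖ ≠ 0 := norm_ne_zero_iff.2 hx
  unfold profileDensity
  field_simp
  ring

theorem integrable_profileDensity (h : SmoothApprox w v Dv fun x => -(n x * v x))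
    (hnb : LocBdd n) {a R : ℝ} (ha : 0 < a) {c : ℝ → ℝ} (hc : IsRadialWeight a R c) :
    Integrable fun x => c ‖x‖ * profileDensity n v Dv x := by
  have mv := h.memLpLoc
  have mX := MemLpLoc.radialPart h.memLpLoc_grad
  have mS := MemLpLoc.dotProd h.memLpLoc_grad
  have i1 := (hc.inv_pow ha 2).integrable (mX.mul mX)
  have i2 := hc.integrable mS
  have i3 := hc.integrable ((mv.mul mv).bdd_mul hnb)
  have i4 := (hc.inv_pow ha 2).integrable (mv.mul mX)
  have i5 := (hc.inv_pow ha 2).integrable (mv.mul mv)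
  refine (((((i1.const_mul 2).sub i2).add i3).add (i4.const_mul (d - 1))).add
    (i5.const_mul ((d - 1) / 2))).congr (Eventually.of_forall fun x => ?_)
  simp only [Pi.add_apply, Pi.sub_apply, profileDensity]
  ring

theorem integrable_virialDensity (h : SmoothApprox w v Dv fun x => -(n x * v x))
    (hnb : LocBdd n) {a R : ℝ} (ha : 0 < a) {c : ℝ → ℝ} (hc : IsRadialWeight a R c) :
    Integrable fun x => c ‖x‖ * virialDensity n v Dv x := by
  have mv := h.memLpLoc
  have mX := MemLpLoc.radialPart h.memLpLoc_grad
  have mS := MemLpLoc.dotProd h.memLpLoc_grad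
  have i1 := (hc.inv_pow ha 1).integrable (mX.mul mX)
  have i2 := (hc.pow ha 1).integrable mS
  have i3 := (hc.pow ha 1).integrable ((mv.mul mv).bdd_mul hnb)
  have i4 := (hc.inv_pow ha 1).integrable (mv.mul mX)
  refine ((((i1.const_mul 2).sub i2).add i3).add (i4.const_mul (d - 2))).congr
    (Eventually.of_forall fun x => ?_)
  simp only [Pi.add_apply, Pi.sub_apply, virialDensity, pow_one]
  ring

theorem integrable_angularDensity (h : SmoothApprox w v Dv fun x => -(n x * v x))
    (hnb : LocBdd n) {a R : ℝ} (ha : 0 < a) {c : ℝ → ℝ} (hc : IsRadialWeight a R c) :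
    Integrable fun x => c ‖x‖ * angularDensity n v Dv x := by
  have mv := h.memLpLoc
  have mX := MemLpLoc.radialPart h.memLpLoc_grad
  have mS := MemLpLoc.dotProd h.memLpLoc_grad
  have i1 := hc.integrable (mX.mul mX)
  have i2 := (hc.pow ha 2).integrable mS
  have i3 := (hc.pow ha 1).integrable ((mv.mul mv).bdd_mul hnb)
  have i5 := hc.integrable (mv.mul mv)
  refine (((i3.const_mul (1 / 2)).add (i2.sub i1)).add
    (i5.const_mul ((d - 1) * (d - 3) / 4))).congr (Eventually.of_forall fun x => ?_)
  simp only [Pi.add_apply, Pi.sub_apply, angularDensity, pow_one]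
  ring

/-- The weak differential inequality for `F`, obtained from the virial inequality with the
cut-off `χ/r`, the energy identity with `χ/r` and the identity for `v²` with `χ/r³`. -/
theorem profile_inequality [NeZero d] (h : SmoothApprox w v Dv fun x => -(n x * v x))
    (hpos : ∀ᵐ x : E d, 0 < n x) (hβ : betaConst n Dn < 1) (hDn : HasWeakGradientOn {0}ᶜ n Dn)
    (hnb : LocBdd n) {R₀ : ℝ} (hR₀ : 0 < R₀) {χ : ℝ → ℝ} (hχ : IsRadialTest R₀ χ)
    (hχ0 : ∀ r, 0 ≤ χ r) :
    Integrable (fun x => deriv χ ‖x‖ * profileDensity n v Dv x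
      + χ ‖x‖ / ‖x‖ * (-(decreaseRate n Dn ‖x‖ * (n x * (v x * v x)))
        + 2 * (dotProd Dv Dv x - radialPart Dv x * radialPart Dv x / ‖x‖ ^ 2)
        + (d - 1) * (d - 3) * (v x * v x) / (2 * ‖x‖ ^ 2))) ∧
    ∫ x, (deriv χ ‖x‖ * profileDensity n v Dv x
      + χ ‖x‖ / ‖x‖ * (-(decreaseRate n Dn ‖x‖ * (n x * (v x * v x)))
        + 2 * (dotProd Dv Dv x - radialPart Dv x * radialPart Dv x / ‖x‖ ^ 2)
        + (d - 1) * (d - 3) * (v x * v x) / (2 * ‖x‖ ^ 2))) ≤ 0 := by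
  obtain ⟨R, hχw, hχw'⟩ := hχ.exists_weight
  have mv := h.memLpLoc
  have mX := MemLpLoc.radialPart h.memLpLoc_grad
  have mS := MemLpLoc.dotProd h.memLpLoc_grad
  have mn : MemLpLoc 1 fun x => n x * (v x * v x) := (mv.mul mv).bdd_mul hnb
  have hbw : ∀ {c : ℝ → ℝ}, IsRadialWeight R₀ R c →
      IsRadialWeight R₀ R fun r => decreaseRate n Dn r * c r := fun hc =>
    hc.mul_left (measurable_decreaseRate n Dn) ⟨1 / 2, fun r _ => by
      rw [abs_of_nonneg (decreaseRate_nonneg _ _ _)]; exact decreaseRate_le hβ r⟩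
  -- `χ / r` and `χ / r³` as cut-offs
  have hη1 := hχ.div_pow hR₀ 1
  have hη3 := hχ.div_pow hR₀ 3
  have k1 := h.radial_virial hpos hβ hDn hnb hη1 fun r => by
    rcases le_or_gt r R₀ with hr | hr
    · simp [hχ.zero r hr]
    · have := hR₀.trans hr
      exact div_nonneg (hχ0 r) (by positivity)
  have k2 := h.radial_energy hη1
  have k3 := h.radial_sq hη3
  simp only [hχ.deriv_div_pow hR₀] at k1 k2 k3
  simp only [pow_one, Nat.cast_one, one_mul, Nat.cast_ofNat] at k1 k2 k3
  have J : ∀ (k : ℕ) {g : E d → ℝ}, MemLpLoc 1 g → Integrable fun x => (‖x‖ ^ k)⁻¹ * χ ‖x‖ * g x :=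
    fun k _ hg => (hχw.inv_pow hR₀ k).integrable hg
  have J' : ∀ (k : ℕ) {g : E d → ℝ}, MemLpLoc 1 g →
      Integrable fun x => (‖x‖ ^ k)⁻¹ * deriv χ ‖x‖ * g x :=
    fun k _ hg => (hχw'.inv_pow hR₀ k).integrable hg
  have Jb : Integrable fun x => decreaseRate n Dn ‖x‖ * ((‖x‖ ^ 1)⁻¹ * χ ‖x‖) * (n x * (v x * v x)) :=
    (hbw (hχw.inv_pow hR₀ 1)).integrable mn
  have i1 : Integrable fun x => (deriv χ ‖x‖ / ‖x‖ - χ ‖x‖ / ‖x‖ ^ (1 + 1))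
        * virialDensity n v Dv x
      + (2 - decreaseRate n Dn ‖x‖) * (χ ‖x‖ / ‖x‖) * (n x * (v x * v x)) := by
    refine ((((h.integrable_virialDensity hnb hR₀ (hχw'.inv_pow hR₀ 1)).sub
      (h.integrable_virialDensity hnb hR₀ (hχw.inv_pow hR₀ 2))).add ((J 1 mn).const_mul 2)).sub
      Jb).congr (Eventually.of_forall fun x => ?_)
    simp only [Pi.add_apply, Pi.sub_apply, pow_one]
    ring
  have i2 : Integrable fun x => χ ‖x‖ / ‖x‖ * (dotProd Dv Dv x - n x * (v x * v x))
      + (deriv χ ‖x‖ / ‖x‖ - χ ‖x‖ / ‖x‖ ^ (1 + 1)) * (v x * radialPart Dv x / ‖x‖) := by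
    refine (((J 1 mS).sub (J 1 mn)).add ((J' 2 (mv.mul mX)).sub (J 3 (mv.mul mX)))).congr
      (Eventually.of_forall fun x => ?_)
    simp only [Pi.add_apply, Pi.sub_apply, pow_one]
    ring
  have i3 : Integrable fun x => 2 * (χ ‖x‖ / ‖x‖ ^ 3) * (v x * radialPart Dv x)
      + (d * (χ ‖x‖ / ‖x‖ ^ 3) + ‖x‖ * (deriv χ ‖x‖ / ‖x‖ ^ 3
        - 3 * χ ‖x‖ / ‖x‖ ^ (3 + 1))) * (v x * v x) := by
    refine ((((J 3 (mv.mul mX)).const_mul 2).add ((J 3 (mv.mul mv)).const_mul d)).add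
      ((J' 2 (mv.mul mv)).sub ((J 3 (mv.mul mv)).const_mul 3))).congr
      (Eventually.of_forall fun x => ?_)
    rcases eq_or_ne ‖x‖ 0 with h0 | h0
    · simp [h0]
    · simp only [Pi.add_apply, Pi.sub_apply]
      field_simp
      ring
  have e : ∀ x : E d, deriv χ ‖x‖ * profileDensity n v Dv x
      + χ ‖x‖ / ‖x‖ * (-(decreaseRate n Dn ‖x‖ * (n x * (v x * v x)))
        + 2 * (dotProd Dv Dv x - radialPart Dv x * radialPart Dv x / ‖x‖ ^ 2)
        + (d - 1) * (d - 3) * (v x * v x) / (2 * ‖x‖ ^ 2))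
      = 1 * (χ ‖x‖ / ‖x‖ * (dotProd Dv Dv x - n x * (v x * v x))
        + (deriv χ ‖x‖ / ‖x‖ - χ ‖x‖ / ‖x‖ ^ (1 + 1)) * (v x * radialPart Dv x / ‖x‖))
      + (d - 1) / 2 * (2 * (χ ‖x‖ / ‖x‖ ^ 3) * (v x * radialPart Dv x)
      + (d * (χ ‖x‖ / ‖x‖ ^ 3) + ‖x‖ * (deriv χ ‖x‖ / ‖x‖ ^ 3
        - 3 * χ ‖x‖ / ‖x‖ ^ (3 + 1))) * (v x * v x))
      + (((deriv χ ‖x‖ / ‖x‖ - χ ‖x‖ / ‖x‖ ^ (1 + 1)) * virialDensity n v Dv x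
      + (2 - decreaseRate n Dn ‖x‖) * (χ ‖x‖ / ‖x‖) * (n x * (v x * v x))) - 0) := by
    intro x
    rcases eq_or_ne ‖x‖ 0 with h0 | h0
    · have : deriv χ ‖x‖ = 0 := hχ.deriv_eq_zero (by rw [h0]; exact hR₀)
      rw [this]
      simp [h0, hχ.zero 0 hR₀.le]
    · unfold profileDensity virialDensity
      field_simp
      ring
  have key := integral_linear_combination i2 i3 i1 (integrable_zero (E d) ℝ volume) 1 ((d - 1) / 2)
  rw [k2, k3] at key
  simp only [e]
  refine ⟨((i2.const_mul 1).add (i3.const_mul _)).add (i1.sub (integrable_zero (E d) ℝ volume)), ?_⟩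
  refine key.trans_le ?_
  simpa using k1

/-- If spherical means of the angular density are nonnegative beyond `R₀`, then
`F' ≥ -(κ / r) F` there, with `κ = b + 1/r`. -/
theorem profile_growth [NeZero d] (h : SmoothApprox w v Dv fun x => -(n x * v x))
    (hpos : ∀ᵐ x : E d, 0 < n x) (hβ : betaConst n Dn < 1) (hDn : HasWeakGradientOn {0}ᶜ n Dn)
    (hnb : LocBdd n) {R₀ : ℝ} (hR₀ : 1 ≤ R₀)
    (hang : ∀ (R : ℝ) (c : ℝ → ℝ), IsRadialWeight R₀ R c → (∀ r, 0 ≤ c r) →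
      0 ≤ ∫ x, c ‖x‖ * angularDensity n v Dv x)
    {χ : ℝ → ℝ} (hχ : IsRadialTest R₀ χ) (hχ0 : ∀ r, 0 ≤ χ r) :
    ∫ x, deriv χ ‖x‖ * profileDensity n v Dv x
      ≤ ∫ x, χ ‖x‖ * ((decreaseRate n Dn ‖x‖ + 1 / ‖x‖) / ‖x‖) * profileDensity n v Dv x := by
  have hR₀' : 0 < R₀ := one_pos.trans_le hR₀
  obtain ⟨R, hχw, hχw'⟩ := hχ.exists_weight
  obtain ⟨iG, hG⟩ := h.profile_inequality hpos hβ hDn hnb hR₀' hχ hχ0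
  set κ : ℝ → ℝ := fun r => decreaseRate n Dn r + 1 / r with hκ
  have hκm : Measurable κ := (measurable_decreaseRate n Dn).add (measurable_const.div measurable_id)
  have hκ0 : ∀ r, R₀ ≤ r → 0 ≤ κ r ∧ κ r ≤ 3 / 2 := by
    intro r hr
    have h1 : 1 / r ≤ 1 := by
      rw [div_le_one (by linarith)]; linarith
    have h0 : 0 ≤ 1 / r := by
      have : 0 < r := by linarith
      positivity
    have h2 := decreaseRate_le hβ r
    have h3 := decreaseRate_nonneg n Dn r
    constructor <;> simp only [hκ] <;> linarith
  have wκ : IsRadialWeight R₀ R fun r => κ r * χ r :=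
    hχw.mul_left hκm ⟨3 / 2, fun r hr => by
      rw [abs_of_nonneg (hκ0 r hr).1]; exact (hκ0 r hr).2⟩
  have wκ' := wκ.inv_pow hR₀' 1
  -- the multiple of the angular form that is left after `κ F χ / r` has been split off
  have wc : IsRadialWeight R₀ R fun r => (r ^ 3)⁻¹ * ((2 - κ r) * χ r) :=
    IsRadialWeight.inv_pow hR₀' (hχw.mul_left (e := fun r => 2 - κ r) (measurable_const.sub hκm)
      ⟨2, fun r hr => by
      have := hκ0 r hr
      rw [abs_of_nonneg (by linarith)]; linarith⟩) 3
  have wc0 : ∀ r, 0 ≤ (r ^ 3)⁻¹ * ((2 - κ r) * χ r) := by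
    intro r
    rcases le_or_gt r R₀ with hr | hr
    · simp [hχ.zero r hr]
    · have := hκ0 r hr.le
      have h0 : 0 < r := hR₀'.trans hr
      exact mul_nonneg (by positivity) (mul_nonneg (by linarith) (hχ0 r))
  have i1 := h.integrable_profileDensity hnb hR₀' hχw'
  have i2 := h.integrable_profileDensity hnb hR₀' wκ'
  have i3 := h.integrable_angularDensity hnb hR₀' wc
  have hA := hang R _ wc wc0
  have e2 : ∫ x, χ ‖x‖ * ((decreaseRate n Dn ‖x‖ + 1 / ‖x‖) / ‖x‖) * profileDensity n v Dv x
      = ∫ x, (‖x‖ ^ 1)⁻¹ * (κ ‖x‖ * χ ‖x‖) * profileDensity n v Dv x := by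
    refine integral_congr_ae (Eventually.of_forall fun x => ?_)
    simp only [pow_one, hκ]
    ring
  rw [e2, ← sub_nonpos, ← integral_sub i1 i2]
  have hmono := integral_mono_ae (i1.sub i2) (iG.sub i3) ?_
  · refine hmono.trans ?_
    simp only [Pi.sub_apply]
    rw [integral_sub iG i3]
    linarith
  filter_upwards [hpos] with x hx
  simp only [Pi.sub_apply]
  rcases le_or_gt ‖x‖ R₀ with hr | hr
  · have hz := hχ.zero _ hr
    simp [hz]
  have h0 : 0 < ‖x‖ := hR₀'.trans hr
  have hx0 : x ≠ 0 := norm_pos_iff.1 h0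
  have hk := hκ0 _ hr.le
  have hχx := hχ0 ‖x‖
  have hb : decreaseRate n Dn ‖x‖ = κ ‖x‖ - 1 / ‖x‖ := by simp [hκ]
  rw [hb]
  have hnv : 0 ≤ n x * (v x * v x) := mul_nonneg hx.le (mul_self_nonneg _)
  -- the difference of both sides is a sum of two nonnegative terms
  have key : χ ‖x‖ / ‖x‖ * (-((κ ‖x‖ - 1 / ‖x‖) * (n x * (v x * v x)))
        + 2 * (dotProd Dv Dv x - radialPart Dv x * radialPart Dv x / ‖x‖ ^ 2)
        + (d - 1) * (d - 3) * (v x * v x) / (2 * ‖x‖ ^ 2))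
        - (‖x‖ ^ 3)⁻¹ * ((2 - κ ‖x‖) * χ ‖x‖) * angularDensity n v Dv x
        + (‖x‖ ^ 1)⁻¹ * (κ ‖x‖ * χ ‖x‖) * profileDensity n v Dv x
      = χ ‖x‖ / ‖x‖ * (κ ‖x‖
          * (radialPart Dv x / ‖x‖ + (d - 1) * v x / (2 * ‖x‖)) ^ 2)
        + χ ‖x‖ / ‖x‖ * (κ ‖x‖ / (2 * ‖x‖) * (n x * (v x * v x))) := by
    rw [profileDensity_eq x hx0]
    unfold angularDensity
    field_simp
    ring
  have p1 : 0 ≤ χ ‖x‖ / ‖x‖ * (κ ‖x‖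
          * (radialPart Dv x / ‖x‖ + (d - 1) * v x / (2 * ‖x‖)) ^ 2) :=
    mul_nonneg (div_nonneg hχx h0.le) (mul_nonneg hk.1 (sq_nonneg _))
  have p2 : 0 ≤ χ ‖x‖ / ‖x‖ * (κ ‖x‖ / (2 * ‖x‖) * (n x * (v x * v x))) :=
    mul_nonneg (div_nonneg hχx h0.le) (mul_nonneg (div_nonneg hk.1 (by positivity)) hnv)
  linarith

/-- The derivative of the spherical integral of `v²`, in terms of `F` and `K`. -/
theorem integral_deriv_mul_sq (h : SmoothApprox w v Dv fun x => -(n x * v x)) {R₀ : ℝ}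
    (hR₀ : 0 < R₀) {χ : ℝ → ℝ} (hχ : IsRadialTest R₀ χ) :
    ∫ x, deriv χ ‖x‖ * (v x * v x)
      = ∫ x, 2 * χ ‖x‖ * (virialDensity n v Dv x - ‖x‖ * profileDensity n v Dv x) := by
  obtain ⟨R, hχw, hχw'⟩ := hχ.exists_weight
  have mv := h.memLpLoc
  have mX := MemLpLoc.radialPart h.memLpLoc_grad
  have i1 := hχw'.integrable (mv.mul mv)
  have hk := h.radial_sq (hχ.div_pow hR₀ 1)
  have i2 : Integrable fun x => (‖x‖ ^ 1)⁻¹ * χ ‖x‖ * (2 * (v x * radialPart Dv x)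
      + (d - 1) * (v x * v x)) := by
    refine (hχw.inv_pow hR₀ 1).integrable (((mv.mul mX).bdd_mul continuous_const.locBdd).add
      ((mv.mul mv).bdd_mul continuous_const.locBdd))
  have e1 : (fun x : E d => 2 * (χ ‖x‖ / ‖x‖ ^ 1) * (v x * radialPart Dv x)
      + (d * (χ ‖x‖ / ‖x‖ ^ 1) + ‖x‖ * deriv (fun r => χ r / r ^ 1) ‖x‖) * (v x * v x))
      = fun x => deriv χ ‖x‖ * (v x * v x) + (‖x‖ ^ 1)⁻¹ * χ ‖x‖ * (2 * (v x * radialPart Dv x)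
      + (d - 1) * (v x * v x)) := by
    ext x
    rw [hχ.deriv_div_pow hR₀]
    rcases eq_or_ne ‖x‖ 0 with h0 | h0
    · have : deriv χ ‖x‖ = 0 := hχ.deriv_eq_zero (by rw [h0]; exact hR₀)
      rw [this]
      simp [h0]
    · field_simp
      push_cast
      ring
  rw [e1, integral_add i1 i2] at hk
  rw [eq_neg_of_add_eq_zero_left hk, ← integral_neg]
  refine integral_congr_ae (Eventually.of_forall fun x => ?_)
  rcases eq_or_ne ‖x‖ 0 with h0 | h0
  · simp [h0, hχ.zero 0 hR₀.le]
  · simp only [virialDensity, profileDensity]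
    field_simp
    ring

end SmoothApprox
end

/-! ### Integration over spheres -/

section

variable {d : ℕ}

/-- The integral of `h` over the sphere of radius `r`, written on the unit sphere. -/
noncomputable def sphereIntegral (h : E d → ℝ) (r : ℝ) : ℝ :=
  r ^ (d - 1) * ∫ y : Metric.sphere (0 : E d) 1, h (r • (y : E d))
    ∂(volume : Measure (E d)).toSphere

/-- The measure `r^(d-1) dr` on `(0, ∞)`, as a measure on `ℝ`. -/
noncomputable def radialMeasure (d : ℕ) : Measure ℝ :=
  (volume.restrict (Ioi 0)).withDensity fun r => ENNReal.ofReal (r ^ (d - 1))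

theorem map_volumeIoiPow : (Measure.volumeIoiPow (d - 1)).map Subtype.val = radialMeasure d := by
  unfold Measure.volumeIoiPow radialMeasure
  ext s hs
  have hm : MeasurableSet ((Subtype.val : Ioi (0 : ℝ) → ℝ) ⁻¹' s) := measurable_subtype_coe hs
  rw [Measure.map_apply measurable_subtype_coe hs, withDensity_apply _ hm, withDensity_apply _ hs,
    Measure.restrict_restrict hs, setLIntegral_subtype measurableSet_Ioi _ fun r =>
      ENNReal.ofReal (r ^ (d - 1)), Subtype.image_preimage_coe, inter_comm]

/-- Polar coordinates `x = r y` on `ℝ^d`, with `r` in all of `ℝ`: `radialMeasure` gives no mass to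
`r ≤ 0`. -/
theorem measurePreserving_polar [NeZero d] :
    MeasurePreserving (fun p : ℝ × Metric.sphere (0 : E d) 1 => p.1 • (p.2 : E d))
      ((radialMeasure d).prod (volume : Measure (E d)).toSphere) volume := by
  have hdim : Module.finrank ℝ (E d) = d := by simp
  have h1 := (volume : Measure (E d)).measurePreserving_homeomorphUnitSphereProd
  rw [hdim] at h1
  have h2 := h1.symm (e := (homeomorphUnitSphereProd (E d)).toMeasurableEquiv)
  have h3 : MeasurePreserving (Subtype.val : ({0}ᶜ : Set (E d)) → E d)
      (volume.comap Subtype.val) volume := by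
    refine ⟨measurable_subtype_coe, ?_⟩
    rw [map_comap_subtype_coe (measurableSet_singleton _).compl, restrict_compl_singleton]
  have h4 := (h3.comp h2).comp
    (Measure.measurePreserving_swap (μ := Measure.volumeIoiPow (d - 1))
      (ν := (volume : Measure (E d)).toSphere))
  have hm : Measurable (fun p : ℝ × Metric.sphere (0 : E d) 1 => p.1 • (p.2 : E d)) := by fun_prop
  refine ⟨hm, ?_⟩
  have hmap : (radialMeasure d).prod (volume : Measure (E d)).toSphere
      = ((Measure.volumeIoiPow (d - 1)).prod (volume : Measure (E d)).toSphere).map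
        (Prod.map Subtype.val id) := by
    rw [← map_volumeIoiPow, ← Measure.map_prod_map _ _ measurable_subtype_coe measurable_id,
      Measure.map_id]
  rw [hmap, Measure.map_map hm (measurable_subtype_coe.prodMap measurable_id)]
  exact h4.map_eq

theorem ae_radialMeasure {p : ℝ → Prop} :
    (∀ᵐ r ∂radialMeasure d, p r) ↔ ∀ᵐ r : ℝ, 0 < r → p r := by
  unfold radialMeasure
  rw [ae_withDensity_iff (by fun_prop), ae_restrict_iff' measurableSet_Ioi]
  refine ⟨fun h => h.mono fun r hr h0 => hr h0 ?_, fun h => h.mono fun r hr h0 _ => hr h0⟩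
  exact (ENNReal.ofReal_pos.2 (pow_pos h0 _)).ne'

instance : SFinite (radialMeasure d) := by unfold radialMeasure; infer_instance

/-- A property that holds almost everywhere holds almost everywhere on almost every sphere. -/
theorem ae_sphere [NeZero d] {p : E d → Prop} (h : ∀ᵐ x, p x) :
    ∀ᵐ r : ℝ, 0 < r →
      ∀ᵐ y : Metric.sphere (0 : E d) 1 ∂(volume : Measure (E d)).toSphere, p (r • (y : E d)) := by
  have h1 := measurePreserving_polar.quasiMeasurePreserving.ae h
  exact ae_radialMeasure.1 (Measure.ae_ae_of_ae_prod h1)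

theorem integrable_radialMeasure {g : ℝ → ℝ} :
    Integrable g (radialMeasure d) ↔ IntegrableOn (fun r => r ^ (d - 1) * g r) (Ioi 0) := by
  unfold radialMeasure
  rw [integrable_withDensity_iff_integrable_smul' (by fun_prop) (by simp), IntegrableOn]
  refine integrable_congr ?_
  filter_upwards [ae_restrict_mem measurableSet_Ioi] with r hr
  rw [ENNReal.toReal_ofReal (pow_nonneg (le_of_lt hr) _), smul_eq_mul]

theorem integral_radialMeasure {g : ℝ → ℝ} :
    ∫ r, g r ∂radialMeasure d = ∫ r in Ioi 0, r ^ (d - 1) * g r := by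
  unfold radialMeasure
  rw [integral_withDensity_eq_integral_toReal_smul (by fun_prop) (by simp)]
  refine integral_congr_ae ?_
  filter_upwards [ae_restrict_mem measurableSet_Ioi] with r hr
  rw [ENNReal.toReal_ofReal (pow_nonneg (le_of_lt hr) _), smul_eq_mul]

/-- Integration in polar coordinates. -/
theorem integral_sphereIntegral [NeZero d] {f : E d → ℝ} (hf : Integrable f) :
    IntegrableOn (sphereIntegral f) (Ioi 0) ∧ ∫ r in Ioi 0, sphereIntegral f r = ∫ x, f x := by
  have h1 : Integrable (fun p : ℝ × Metric.sphere (0 : E d) 1 => f (p.1 • (p.2 : E d)))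
      ((radialMeasure d).prod (volume : Measure (E d)).toSphere) :=
    measurePreserving_polar.integrable_comp_of_integrable hf
  refine ⟨integrable_radialMeasure.1 h1.integral_prod_left, ?_⟩
  have h2 := integral_map measurePreserving_polar.measurable.aemeasurable (f := f)
    (μ := (radialMeasure d).prod (volume : Measure (E d)).toSphere)
    (by rw [measurePreserving_polar.map_eq]; exact hf.1)
  rw [measurePreserving_polar.map_eq, integral_prod _ h1, integral_radialMeasure] at h2
  exact h2.symm

theorem sphereIntegral_norm_mul (c : ℝ → ℝ) (h : E d → ℝ) {r : ℝ} (hr : 0 < r) :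
    sphereIntegral (fun x => c ‖x‖ * h x) r = c r * sphereIntegral h r := by
  unfold sphereIntegral
  have : ∀ y : Metric.sphere (0 : E d) 1, ‖r • (y : E d)‖ = r := fun y => by
    rw [norm_smul, Real.norm_of_nonneg hr.le, norm_eq_of_mem_sphere, mul_one]
  simp only [this, integral_const_mul]
  ring

/-- `h` is integrable against every bounded radial weight supported in a bounded part of
`{|x| ≥ a}`. -/
def RadiallyIntegrable (a : ℝ) (h : E d → ℝ) : Prop :=
  ∀ (R : ℝ) (c : ℝ → ℝ), IsRadialWeight a R c → Integrable fun x => c ‖x‖ * h x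

/-- The spherical integrals of `h`, cut off at radius `a`. -/
noncomputable def sphereProfile (a : ℝ) (h : E d → ℝ) : ℝ → ℝ :=
  indicator (Ici a) (sphereIntegral h)

/-- Radially weighted integrals over `ℝ^d` are one-dimensional integrals of the spherical profile.
This turns the integral inequalities with radial cut-offs into weak inequalities on the half-line. -/
theorem IsRadialWeight.integral_sphereProfile [NeZero d] {a R : ℝ} (ha : 0 < a) {c : ℝ → ℝ}
    (hc : IsRadialWeight a R c) {h : E d → ℝ} (hh : RadiallyIntegrable a h) :
    (Integrable fun r => c r * sphereProfile a h r) ∧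
      ∫ r, c r * sphereProfile a h r = ∫ x, c ‖x‖ * h x := by
  obtain ⟨h1, h2⟩ := integral_sphereIntegral (hh R c hc)
  have e : (fun r => c r * sphereProfile a h r)
      = indicator (Ioi 0) (sphereIntegral fun x => c ‖x‖ * h x) := by
    ext r
    rcases le_or_gt r 0 with hr | hr
    · rw [indicator_of_notMem (s := Ioi (0 : ℝ)) (not_lt.2 hr), sphereProfile,
        indicator_of_notMem (s := Ici a) (not_le.2 (hr.trans_lt ha)), mul_zero]
    · rw [indicator_of_mem (mem_Ioi.2 hr), sphereIntegral_norm_mul c h hr]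
      by_cases hra : a ≤ r
      · rw [sphereProfile, indicator_of_mem (mem_Ici.2 hra)]
      · have : c r = 0 := by
          by_contra h0
          exact hra (hc.supp r h0).1
        rw [this, zero_mul, zero_mul]
  rw [e]
  exact ⟨h1.integrable_indicator measurableSet_Ioi, by
    rw [integral_indicator measurableSet_Ioi, h2]⟩

theorem locallyIntegrable_sphereProfile [NeZero d] {a : ℝ} (ha : 0 < a) {h : E d → ℝ}
    (hh : RadiallyIntegrable a h) : LocallyIntegrable (sphereProfile a h) := by
  rw [locallyIntegrable_iff]
  intro K hK
  obtain ⟨R, hR⟩ := hK.isBounded.subset_closedBall 0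
  have hw : IsRadialWeight a R (indicator (Icc a R) fun _ => 1) := by
    refine ⟨measurable_const.indicator measurableSet_Icc, ⟨1, fun r => ?_⟩, fun r hr => ?_⟩
    · by_cases h : r ∈ Icc a R <;> simp [h]
    · have h0 : r ∈ Icc a R := mem_of_indicator_ne_zero hr
      exact h0
  refine ((hw.integral_sphereProfile ha hh).1.integrableOn (s := K)).congr_fun (fun r hr => ?_)
    hK.measurableSet
  have hrR : r ≤ R := (le_abs_self r).trans (by simpa using hR hr)
  by_cases hra : a ≤ r
  · simp [hra, hrR]
  · simp [sphereProfile, hra]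

end

/-! ### Weak inequalities on the half-line -/

section

/-- A shrinking family of bump functions on `ℝ`. -/
noncomputable def lineBump (k : ℕ) : ContDiffBump (0 : ℝ) where
  rIn := 1 / (2 * (k + 1))
  rOut := 1 / (k + 1)
  rIn_pos := by positivity
  rIn_lt_rOut := one_div_lt_one_div_of_lt (by positivity)
    (by have : (0 : ℝ) < k + 1 := by positivity
        linarith)

/-- The mollifier of `lineBump`. -/
noncomputable def lineMollifier (k : ℕ) : ℝ → ℝ := (lineBump k).normed volume

/-- The primitive of `lineMollifier`, a smooth approximation of the Heaviside function. -/
noncomputable def smoothStep (k : ℕ) (t : ℝ) : ℝ := ∫ s in Iic t, lineMollifier k s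

theorem lineMollifier_contDiff (k : ℕ) : ContDiff ℝ ∞ (lineMollifier k) :=
  (lineBump k).contDiff_normed

theorem lineMollifier_nonneg (k : ℕ) (t : ℝ) : 0 ≤ lineMollifier k t := (lineBump k).nonneg_normed t

theorem lineMollifier_integrable (k : ℕ) : Integrable (lineMollifier k) :=
  (lineBump k).integrable_normed

theorem lineMollifier_eq_zero (k : ℕ) {t : ℝ} (ht : 1 / ((k : ℝ) + 1) ≤ |t|) :
    lineMollifier k t = 0 := by
  have h : t ∉ Function.support ((lineBump k).normed volume) := by
    rw [(lineBump k).support_normed_eq]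
    simpa [lineBump] using ht
  exact Function.notMem_support.1 h

theorem smoothStep_nonneg (k : ℕ) (t : ℝ) : 0 ≤ smoothStep k t :=
  setIntegral_nonneg measurableSet_Iic fun _ _ => lineMollifier_nonneg k _

theorem smoothStep_le_one (k : ℕ) (t : ℝ) : smoothStep k t ≤ 1 :=
  (setIntegral_le_integral (lineMollifier_integrable k)
    (Eventually.of_forall (lineMollifier_nonneg k))).trans_eq (lineBump k).integral_normed

theorem smoothStep_eq_zero (k : ℕ) {t : ℝ} (ht : t ≤ -(1 / ((k : ℝ) + 1))) : smoothStep k t = 0 :=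
  setIntegral_eq_zero_of_forall_eq_zero fun s hs => lineMollifier_eq_zero k (by
    have : s ≤ t := hs
    rw [abs_of_nonpos]
    · linarith
    · have : 0 < 1 / ((k : ℝ) + 1) := by positivity
      linarith)

theorem smoothStep_eq_one (k : ℕ) {t : ℝ} (ht : 1 / ((k : ℝ) + 1) ≤ t) : smoothStep k t = 1 := by
  refine (setIntegral_eq_integral_of_forall_compl_eq_zero fun s hs => ?_).trans
    (lineBump k).integral_normed
  have : t < s := not_le.1 hs
  exact lineMollifier_eq_zero k (by
    have h2 := le_abs_self s
    linarith)

theorem hasDerivAt_smoothStep (k : ℕ) (t : ℝ) :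
    HasDerivAt (smoothStep k) (lineMollifier k t) t := by
  have hc := (lineMollifier_contDiff k).continuous
  have e : smoothStep k = fun t => smoothStep k 0 + ∫ s in (0 : ℝ)..t, lineMollifier k s := by
    ext t
    have := intervalIntegral.integral_Iic_sub_Iic (μ := volume) (a := 0) (b := t)
      (lineMollifier_integrable k).integrableOn (lineMollifier_integrable k).integrableOn
    rw [← this]
    simp [smoothStep]
  rw [e]
  exact (intervalIntegral.integral_hasDerivAt_right (hc.intervalIntegrable 0 t)
    (hc.stronglyMeasurableAtFilter _ _) hc.continuousAt).const_add _

theorem smoothStep_contDiff (k : ℕ) : ContDiff ℝ ∞ (smoothStep k) := by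
  rw [contDiff_infty_iff_deriv]
  refine ⟨fun t => (hasDerivAt_smoothStep k t).differentiableAt, ?_⟩
  rw [show deriv (smoothStep k) = lineMollifier k from
    funext fun t => (hasDerivAt_smoothStep k t).deriv]
  exact lineMollifier_contDiff k

/-- `F r` is recovered at `r` by the mollifiers. -/
def IsMollifiedAt (F : ℝ → ℝ) (r : ℝ) : Prop :=
  Tendsto (fun k => ∫ t, lineMollifier k (t - r) * F t) atTop (𝓝 (F r))

/-- Almost every point is a Lebesgue point, hence satisfies `IsMollifiedAt`. -/
theorem ae_isMollifiedAt {F : ℝ → ℝ} (hF : LocallyIntegrable F) : ∀ᵐ r, IsMollifiedAt F r := by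
  have hlim : Tendsto (fun k => (lineBump k).rOut) atTop (𝓝 0) :=
    tendsto_one_div_add_atTop_nhds_zero_nat
  filter_upwards [ContDiffBump.ae_convolution_tendsto_right_of_locallyIntegrable (φ := lineBump)
    (K := 2) hlim (Eventually.of_forall fun k => by
      simp only [lineBump]
      have : (k : ℝ) + 1 ≠ 0 := by positivity
      field_simp
      rfl) hF] with r hr
  refine hr.congr fun k => ?_
  rw [convolution_eq_swap]
  refine integral_congr_ae (Eventually.of_forall fun t => ?_)
  simp only [ContinuousLinearMap.lsmul_apply, smul_eq_mul, lineMollifier]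
  rw [← (lineBump k).normed_neg, neg_sub]

/-- A weak differential inequality `-F' ≤ G` on `(R₀, ∞)` holds in integrated form. -/
theorem le_add_integral_of_weak {F G : ℝ → ℝ} {R₀ : ℝ} (hF : LocallyIntegrable F)
    (hG : LocallyIntegrable G)
    (h : ∀ χ, IsRadialTest R₀ χ → (∀ r, 0 ≤ χ r) → ∫ t, deriv χ t * F t ≤ ∫ t, χ t * G t)
    {r s : ℝ} (hr : R₀ < r) (hrs : r < s) (gr : IsMollifiedAt F r) (gs : IsMollifiedAt F s) :
    F r ≤ F s + ∫ t in r..s, G t := by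
  -- smooth approximations of the indicator function of `[r, s]`
  set χ : ℕ → ℝ → ℝ := fun k t => smoothStep k (t - r) - smoothStep k (t - s) with hχ
  have hε : Tendsto (fun k : ℕ => 1 / ((k : ℝ) + 1)) atTop (𝓝 0) :=
    tendsto_one_div_add_atTop_nhds_zero_nat
  have hε1 : ∀ k : ℕ, 1 / ((k : ℝ) + 1) ≤ 1 := fun k => by
    rw [div_le_one (by positivity)]
    have : (0 : ℝ) ≤ k := k.cast_nonneg
    linarith
  have hmono : ∀ k, Monotone (smoothStep k) := fun k =>
    monotone_of_deriv_nonneg (fun t => (hasDerivAt_smoothStep k t).differentiableAt) fun t => by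
      rw [(hasDerivAt_smoothStep k t).deriv]; exact lineMollifier_nonneg k t
  have hχ0 : ∀ k t, 0 ≤ χ k t := fun k t => sub_nonneg.2 (hmono k (by linarith))
  have hχ1 : ∀ k t, χ k t ≤ 1 := fun k t =>
    (sub_le_self _ (smoothStep_nonneg k _)).trans (smoothStep_le_one k _)
  have hsupp : ∀ k t, t ∉ Icc (r - 1) (s + 1) → χ k t = 0 := by
    intro k t ht
    have hk := hε1 k
    rcases lt_or_ge t (r - 1) with h1 | h1
    · simp only [hχ]
      rw [smoothStep_eq_zero k (by linarith), smoothStep_eq_zero k (by linarith), sub_zero]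
    · have h2 : s + 1 < t := by
        by_contra h3
        exact ht ⟨h1, not_lt.1 h3⟩
      simp only [hχ]
      rw [smoothStep_eq_one k (by linarith), smoothStep_eq_one k (by linarith), sub_self]
  have hd : ∀ k t, deriv (χ k) t = lineMollifier k (t - r) - lineMollifier k (t - s) := fun k t =>
    (((hasDerivAt_smoothStep k (t - r)).comp_sub_const t r).sub
      ((hasDerivAt_smoothStep k (t - s)).comp_sub_const t s)).deriv
  have htest : ∀ᶠ k in atTop, IsRadialTest R₀ (χ k) := by
    filter_upwards [hε.eventually (gt_mem_nhds (sub_pos.2 hr))] with k hk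
    refine ⟨((smoothStep_contDiff k).comp (contDiff_id.sub contDiff_const)).sub
      ((smoothStep_contDiff k).comp (contDiff_id.sub contDiff_const)), fun t ht => ?_,
      s + 1, fun t ht => hsupp k t fun h1 => not_lt.2 h1.2 ht⟩
    simp only [hχ]
    rw [smoothStep_eq_zero k (by linarith), smoothStep_eq_zero k (by linarith), sub_zero]
  have hI : ∀ (k : ℕ) (a : ℝ), Integrable fun t => lineMollifier k (t - a) * F t := fun k a => by
    refine hF.integrable_smul_left_of_hasCompactSupport (g := fun t => lineMollifier k (t - a))
      ((lineMollifier_contDiff k).continuous.comp (continuous_id.sub continuous_const)) ?_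
    refine HasCompactSupport.intro (isCompact_Icc (a := a - 1) (b := a + 1)) fun t ht => ?_
    refine lineMollifier_eq_zero k ((hε1 k).trans ?_)
    by_contra h1
    have := abs_le.1 (not_le.1 h1).le
    exact ht ⟨by linarith, by linarith⟩
  have hl : Tendsto (fun k => ∫ t, deriv (χ k) t * F t) atTop (𝓝 (F r - F s)) := by
    refine (gr.sub gs).congr fun k => ?_
    rw [← integral_sub (hI k r) (hI k s)]
    refine integral_congr_ae (Eventually.of_forall fun t => ?_)
    simp only [hd]
    ring
  have hr' : Tendsto (fun k => ∫ t, χ k t * G t) atTop (𝓝 (∫ t in r..s, G t)) := by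
    rw [intervalIntegral.integral_of_le hrs.le, ← integral_indicator measurableSet_Ioc]
    refine tendsto_integral_of_dominated_convergence
      (indicator (Icc (r - 1) (s + 1)) fun t => |G t|) (fun k => ?_) ?_ (fun k => ?_) ?_
    · have hc : Continuous (χ k) := ((smoothStep_contDiff k).continuous.comp
        (continuous_id.sub continuous_const)).sub ((smoothStep_contDiff k).continuous.comp
        (continuous_id.sub continuous_const))
      exact hc.aestronglyMeasurable.mul hG.aestronglyMeasurable
    · exact (integrable_indicator_iff measurableSet_Icc).2 (hG.integrableOn_isCompact isCompact_Icc).norm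
    · refine Eventually.of_forall fun t => ?_
      by_cases ht : t ∈ Icc (r - 1) (s + 1)
      · rw [indicator_of_mem ht, norm_mul, Real.norm_of_nonneg (hχ0 k t), Real.norm_eq_abs]
        exact mul_le_of_le_one_left (abs_nonneg _) (hχ1 k t)
      · rw [indicator_of_notMem ht, hsupp k t ht, zero_mul, norm_zero]
    · have hne : ∀ᵐ t : ℝ, t ≠ r ∧ t ≠ s :=
        (Measure.ae_ne volume r).and (Measure.ae_ne volume s)
      filter_upwards [hne] with t ht
      have hev : ∀ a : ℝ, t ≠ a → ∀ᶠ k in atTop, smoothStep k (t - a) = if a < t then 1 else 0 := by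
        intro a ha
        filter_upwards [hε.eventually (gt_mem_nhds (abs_pos.2 (sub_ne_zero.2 ha)))] with k hk
        split_ifs with hat
        · rw [abs_of_pos (sub_pos.2 hat)] at hk
          exact smoothStep_eq_one k hk.le
        · have : t < a := lt_of_le_of_ne (not_lt.1 hat) ha
          rw [abs_of_neg (sub_neg.2 this)] at hk
          exact smoothStep_eq_zero k (by linarith)
      refine tendsto_const_nhds.congr' ?_
      filter_upwards [hev r ht.1, hev s ht.2] with k h1 h2
      simp only [hχ, h1, h2]
      by_cases c1 : r < t <;> by_cases c2 : s < t
      · rw [indicator_of_notMem fun hh : t ∈ Ioc r s => not_lt.2 hh.2 c2]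
        simp [c1, c2]
      · rw [indicator_of_mem (show t ∈ Ioc r s from ⟨c1, not_lt.1 c2⟩)]
        simp [c1, c2]
      · exact absurd (hrs.trans c2) c1
      · rw [indicator_of_notMem fun hh : t ∈ Ioc r s => c1 hh.1]
        simp [c1, c2]
  have := le_of_tendsto_of_tendsto hl hr' (htest.mono fun k hk => h _ hk (hχ0 k))
  linarith

/-- A Gronwall type argument: if `F` satisfies `F r ≤ F s + ∫ κ F` with an integrable `κ` of small
integral, and `F` becomes small at arbitrarily large radii, then `F ≤ 0`. -/
theorem nonpos_of_le_add_integral {F κ : ℝ → ℝ} {R₀ : ℝ}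
    (hF : LocallyIntegrable F) (hκ : Measurable κ) (hκ0 : ∀ r, R₀ < r → 0 ≤ κ r)
    (hκ1 : ∀ r, R₀ < r → κ r ≤ 1)
    (hint : ∀ s, R₀ < s → ∫ t in R₀..s, κ t ≤ 3 / 4)
    {L : Set ℝ} (hL : ∀ᵐ r, r ∈ L)
    (h : ∀ r ∈ L, ∀ s ∈ L, R₀ < r → r < s → F r ≤ F s + ∫ t in r..s, κ t * F t)
    (hsmall : ∀ δ > 0, ∃ᶠ s in atTop ⊓ ae (volume : Measure ℝ), F s < δ) {r : ℝ} (hr : R₀ < r)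
    (hrL : r ∈ L) : F r ≤ 0 := by
  refine le_of_forall_pos_le_add fun δ hδ => ?_
  have hev : ∀ᶠ s in atTop ⊓ ae (volume : Measure ℝ), r < s ∧ s ∈ L :=
    ((eventually_gt_atTop r).filter_mono inf_le_left).and
      (Filter.Eventually.filter_mono inf_le_right hL)
  obtain ⟨s, hs, hrs, hsL⟩ := ((hsmall (δ / 4) (by positivity)).and_eventually hev).exists
  have hRs : R₀ < s := hr.trans hrs
  have iF : IntegrableOn F (Ioc R₀ s) :=
    (hF.integrableOn_isCompact isCompact_Icc).mono_set Ioc_subset_Icc_self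
  have iF' : IntegrableOn (fun t => max (F t) 0) (Ioc R₀ s) := iF.pos_part
  have hκb : ∀ᵐ t ∂volume.restrict (Ioc R₀ s), ‖κ t‖ ≤ 1 := by
    filter_upwards [ae_restrict_mem measurableSet_Ioc] with t ht
    rw [Real.norm_of_nonneg (hκ0 t ht.1)]
    exact hκ1 t ht.1
  have iκF : IntegrableOn (fun t => κ t * F t) (Ioc R₀ s) :=
    Integrable.bdd_mul iF hκ.aestronglyMeasurable hκb
  have iκF' : IntegrableOn (fun t => κ t * max (F t) 0) (Ioc R₀ s) :=
    Integrable.bdd_mul iF' hκ.aestronglyMeasurable hκb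
  have iκ : IntegrableOn κ (Ioc R₀ s) := by
    have := Integrable.bdd_mul (integrableOn_const (C := (1 : ℝ)) (s := Ioc R₀ s) (μ := volume)
      measure_Ioc_lt_top.ne) hκ.aestronglyMeasurable hκb
    simpa [IntegrableOn] using this
  -- `F ≤ δ/4 + I` on `(R₀, s)`; integrating this against `κ` gives `I ≤ (δ/4 + I) 3/4`, so
  -- `I ≤ 3δ/4`
  set I := ∫ t in Ioc R₀ s, κ t * max (F t) 0 with hI
  have hI0 : 0 ≤ I := setIntegral_nonneg measurableSet_Ioc fun t ht =>
    mul_nonneg (hκ0 t ht.1) (le_max_right _ _)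
  have hbound : ∀ t ∈ L, R₀ < t → t < s → F t ≤ δ / 4 + I := by
    intro t htL ht hts
    have h1 := h t htL s hsL ht hts
    have h2 : ∫ τ in t..s, κ τ * F τ ≤ I := by
      rw [intervalIntegral.integral_of_le hts.le]
      have hsub : Ioc t s ⊆ Ioc R₀ s := Ioc_subset_Ioc_left ht.le
      calc ∫ τ in Ioc t s, κ τ * F τ ≤ ∫ τ in Ioc t s, κ τ * max (F τ) 0 :=
            setIntegral_mono_on (iκF.mono_set hsub) (iκF'.mono_set hsub) measurableSet_Ioc
              fun τ hτ => mul_le_mul_of_nonneg_left (le_max_left _ _) (hκ0 τ (hsub hτ).1)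
        _ ≤ I := setIntegral_mono_set iκF' (by
            filter_upwards [ae_restrict_mem measurableSet_Ioc] with τ hτ
            exact mul_nonneg (hκ0 τ hτ.1) (le_max_right _ _)) hsub.eventuallyLE
    linarith
  have hI3 : I ≤ (δ / 4 + I) * (3 / 4) := by
    calc I ≤ ∫ t in Ioc R₀ s, κ t * (δ / 4 + I) := by
          refine integral_mono_ae iκF' (iκ.mul_const _) ?_
          filter_upwards [ae_restrict_mem measurableSet_Ioc, ae_restrict_of_ae hL,
            ae_restrict_of_ae (Measure.ae_ne volume s)] with t ht htL hts
          refine mul_le_mul_of_nonneg_left (max_le ?_ (by positivity)) (hκ0 t ht.1)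
          exact hbound t htL ht.1 (lt_of_le_of_ne ht.2 hts)
      _ = (δ / 4 + I) * ∫ t in R₀..s, κ t := by
          rw [integral_mul_const, intervalIntegral.integral_of_le hRs.le, mul_comm]
      _ ≤ _ := mul_le_mul_of_nonneg_left (hint s hRs) (by positivity)
  have := hbound r hrL hr hrs
  linarith

end

/-! ### Uniqueness under positivity of the angular form -/

section

variable {d : ℕ} {n v : E d → ℝ} {Dn Dv : Fin d → E d → ℝ} {w : ℕ → E d → ℝ}

/-- `∫₀^∞ b(r) dr / r ≤ ∑ β_j`, since `∫ dr / r ≤ 1` over each interval `[2^j, 2^(j+1))`. -/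
theorem lintegral_decreaseRate_div_le (hβ : betaConst n Dn < 1) :
    ∫⁻ r in Ioi (0 : ℝ), ENNReal.ofReal (decreaseRate n Dn r / r) ≤ ENNReal.ofReal (1 / 2) := by
  have hU : Ioi (0 : ℝ) = ⋃ j : ℤ, Ico ((2 : ℝ) ^ j) ((2 : ℝ) ^ (j + 1)) := by
    ext r
    simp only [mem_Ioi, mem_iUnion, mem_Ico]
    exact ⟨fun hr => ⟨_, (floor_logb_eq_iff hr _).1 rfl⟩,
      fun ⟨j, hj, _⟩ => lt_of_lt_of_le (by positivity) hj⟩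
  have hpiece : ∀ j : ℤ, ∫⁻ r in Ico ((2 : ℝ) ^ j) ((2 : ℝ) ^ (j + 1)),
      ENNReal.ofReal (decreaseRate n Dn r / r) ≤ ENNReal.ofReal (annulusDecrease n Dn j) := by
    intro j
    have h2 : (0 : ℝ) < 2 ^ j := by positivity
    calc ∫⁻ r in Ico ((2 : ℝ) ^ j) ((2 : ℝ) ^ (j + 1)), ENNReal.ofReal (decreaseRate n Dn r / r)
        ≤ ∫⁻ _ in Ico ((2 : ℝ) ^ j) ((2 : ℝ) ^ (j + 1)),
            ENNReal.ofReal (annulusDecrease n Dn j / 2 ^ j) := by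
          refine setLIntegral_mono measurable_const fun r hr => ENNReal.ofReal_le_ofReal ?_
          rw [decreaseRate_of_mem n Dn hr.1 hr.2]
          exact div_le_div_of_nonneg_left (annulusDecrease_nonneg _ _ _) h2 hr.1
      _ = ENNReal.ofReal (annulusDecrease n Dn j) := by
          rw [setLIntegral_const, Real.volume_Ico, ← ENNReal.ofReal_mul
            (div_nonneg (annulusDecrease_nonneg _ _ _) h2.le), zpow_add_one₀ two_ne_zero]
          congr 1
          field_simp
          ring
  rw [hU]
  refine (lintegral_iUnion_le _ _).trans ((ENNReal.tsum_le_tsum hpiece).trans ?_)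
  rw [← ENNReal.ofReal_tsum_of_nonneg (annulusDecrease_nonneg n Dn) (annulusDecrease_tsum_lt hβ).1]
  exact ENNReal.ofReal_le_ofReal (annulusDecrease_tsum_lt hβ).2.le

/-- The total rate in the growth inequality for `F` is less than `1` beyond `R₀ ≥ 4`: the part `b`
contributes at most `1/2` and the part `1/r` at most `∫_{R₀}^∞ dr / r² ≤ 1/4`. -/
theorem integral_rate_le (hβ : betaConst n Dn < 1) {R₀ s : ℝ} (hR₀ : 4 ≤ R₀) (hs : R₀ < s) :
    ∫ t in R₀..s, (decreaseRate n Dn t + 1 / t) / t ≤ 3 / 4 := by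
  have hpos : ∀ t ∈ Ioc R₀ s, 0 < t := fun t ht => by linarith [ht.1]
  have hsub : Ioc R₀ s ⊆ Ioi 0 := fun t ht => hpos t ht
  have hm : Measurable fun t => decreaseRate n Dn t / t :=
    (measurable_decreaseRate n Dn).div measurable_id
  have hl : ∫⁻ t in Ioc R₀ s, ENNReal.ofReal (decreaseRate n Dn t / t) ≤ ENNReal.ofReal (1 / 2) :=
    (lintegral_mono_set hsub).trans (lintegral_decreaseRate_div_le hβ)
  have hnn : 0 ≤ᵐ[volume.restrict (Ioc R₀ s)] fun t => decreaseRate n Dn t / t := by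
    filter_upwards [ae_restrict_mem measurableSet_Ioc] with t ht
    exact div_nonneg (decreaseRate_nonneg _ _ _) (hpos t ht).le
  have i1 : IntegrableOn (fun t => decreaseRate n Dn t / t) (Ioc R₀ s) := by
    refine ⟨hm.aestronglyMeasurable, ?_⟩
    rw [hasFiniteIntegral_iff_ofReal hnn]
    exact hl.trans_lt ENNReal.ofReal_lt_top
  have h1 : ∫ t in Ioc R₀ s, decreaseRate n Dn t / t ≤ 1 / 2 := by
    rw [integral_eq_lintegral_of_nonneg_ae hnn hm.aestronglyMeasurable]
    exact ENNReal.toReal_le_of_le_ofReal (by norm_num) hl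
  have hd : ∀ t ∈ uIcc R₀ s, HasDerivAt (fun t : ℝ => -t⁻¹) (1 / t / t) t := by
    intro t ht
    rw [uIcc_of_le hs.le] at ht
    have : t ≠ 0 := by linarith [ht.1]
    refine (hasDerivAt_inv this).neg.congr_deriv ?_
    field_simp
  have hcont : ContinuousOn (fun t : ℝ => 1 / t / t) (uIcc R₀ s) := by
    intro t ht
    rw [uIcc_of_le hs.le] at ht
    have : t ≠ 0 := by linarith [ht.1]
    exact ((continuousAt_const.div continuousAt_id this).div continuousAt_id
      this).continuousWithinAt
  have i2 : IntervalIntegrable (fun t : ℝ => 1 / t / t) volume R₀ s := hcont.intervalIntegrable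
  have h2 : ∫ t in R₀..s, 1 / t / t ≤ 1 / 4 := by
    rw [intervalIntegral.integral_eq_sub_of_hasDerivAt hd i2]
    have : s⁻¹ ≥ 0 := by
      have : 0 < s := by linarith
      positivity
    have h4 : R₀⁻¹ ≤ 1 / 4 := by
      rw [inv_eq_one_div]
      exact one_div_le_one_div_of_le (by norm_num) hR₀
    linarith
  simp only [add_div]
  rw [intervalIntegral.integral_add ((intervalIntegrable_iff_integrableOn_Ioc_of_le hs.le).2 i1) i2,
    intervalIntegral.integral_of_le hs.le]
  linarith

theorem radialPart_sq_le (G : Fin d → E d → ℝ) (x : E d) :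
    radialPart G x * radialPart G x ≤ ‖x‖ ^ 2 * dotProd G G x := by
  have := Finset.sum_mul_sq_le_sq_mul_sq Finset.univ (fun i => x i) (fun i => G i x)
  rw [← sum_coord_sq]
  simpa only [radialPart, dotProd, sq] using this

theorem dotProd_self_nonneg (G : Fin d → E d → ℝ) (x : E d) : 0 ≤ dotProd G G x :=
  Finset.sum_nonneg fun i _ => mul_self_nonneg (G i x)

theorem sphereIntegral_mono {f g : E d → ℝ} {r : ℝ} (hr : 0 ≤ r)
    (hf : Integrable (fun y : Metric.sphere (0 : E d) 1 => f (r • (y : E d)))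
      (volume : Measure (E d)).toSphere)
    (hg : Integrable (fun y : Metric.sphere (0 : E d) 1 => g (r • (y : E d)))
      (volume : Measure (E d)).toSphere)
    (h : ∀ᵐ y : Metric.sphere (0 : E d) 1 ∂(volume : Measure (E d)).toSphere,
      f (r • (y : E d)) ≤ g (r • (y : E d))) : sphereIntegral f r ≤ sphereIntegral g r :=
  mul_le_mul_of_nonneg_left (integral_mono_ae hf hg h) (pow_nonneg hr _)

/-- A radially integrable function is integrable on almost every sphere, so that its spherical
integrals there are genuine. -/
theorem RadiallyIntegrable.ae_integrable_sphere [NeZero d] {a : ℝ} (ha : 0 < a) {h : E d → ℝ}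
    (hh : RadiallyIntegrable a h) : ∀ᵐ r : ℝ, a ≤ r →
      Integrable (fun y : Metric.sphere (0 : E d) 1 => h (r • (y : E d)))
        (volume : Measure (E d)).toSphere := by
  have key : ∀ N : ℕ, ∀ᵐ r : ℝ, a ≤ r → r ≤ N →
      Integrable (fun y : Metric.sphere (0 : E d) 1 => h (r • (y : E d)))
        (volume : Measure (E d)).toSphere := by
    intro N
    have hw : IsRadialWeight a N (indicator (Icc a N) fun _ => 1) := by
      refine ⟨measurable_const.indicator measurableSet_Icc, ⟨1, fun r => ?_⟩, fun r hr => ?_⟩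
      · by_cases h : r ∈ Icc a (N : ℝ) <;> simp [h]
      · have h0 : r ∈ Icc a (N : ℝ) := mem_of_indicator_ne_zero hr
        exact h0
    have h1 := measurePreserving_polar.integrable_comp_of_integrable (hh N _ hw)
    filter_upwards [ae_radialMeasure.1 h1.prod_right_ae] with r hr har hrN
    have h2 := hr (ha.trans_le har)
    refine h2.congr (Eventually.of_forall fun y => ?_)
    have : ‖r • (y : E d)‖ = r := by
      rw [norm_smul, Real.norm_of_nonneg (ha.trans_le har).le, norm_eq_of_mem_sphere, mul_one]
    simp [this, har, hrN]
  filter_upwards [ae_all_iff.2 key] with r hr har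
  obtain ⟨N, hN⟩ := exists_nat_ge r
  exact hr N har hN

theorem MemLpLoc.radiallyIntegrable {h : E d → ℝ} (hh : MemLpLoc 1 h) (a : ℝ) :
    RadiallyIntegrable a h := fun _ _ hc => hc.integrable hh

/-- For `|x| ≥ 1` and a bounded potential the density of `F` is dominated by the density of the
energy in the lower limit. -/
theorem profileDensity_le {x : E d} (hx : 1 ≤ ‖x‖) {M : ℝ} (hM : n x ≤ M) :
    profileDensity n v Dv x ≤ (|M| + d + 2) * (dotProd Dv Dv x + v x * v x) := by
  have hr : (1 : ℝ) ≤ ‖x‖ ^ 2 := one_le_pow₀ hx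
  have hr0 : 0 < ‖x‖ ^ 2 := by positivity
  have hX : radialPart Dv x * radialPart Dv x / ‖x‖ ^ 2 ≤ dotProd Dv Dv x :=
    (div_le_iff₀' hr0).2 (radialPart_sq_le Dv x)
  have hS := dotProd_self_nonneg Dv x
  have hv := mul_self_nonneg (v x)
  have hnv : n x * (v x * v x) ≤ |M| * (v x * v x) :=
    mul_le_mul_of_nonneg_right (hM.trans (le_abs_self M)) hv
  have hX4 : radialPart Dv x * radialPart Dv x / ‖x‖ ^ 2 / ‖x‖ ^ 2 ≤ dotProd Dv Dv x :=
    (div_le_self (div_nonneg (mul_self_nonneg _) hr0.le) hr).trans hX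
  have hvX : v x * radialPart Dv x / ‖x‖ ^ 2 ≤ (v x * v x + dotProd Dv Dv x) / 2 := by
    have e : radialPart Dv x * radialPart Dv x / ‖x‖ ^ 2 / ‖x‖ ^ 2
        = (radialPart Dv x / ‖x‖ ^ 2) * (radialPart Dv x / ‖x‖ ^ 2) := by
      field_simp
    rw [mul_div_assoc]
    nlinarith [mul_self_nonneg (v x - radialPart Dv x / ‖x‖ ^ 2)]
  have hvr : v x * v x / ‖x‖ ^ 2 ≤ v x * v x := div_le_self hv hr
  rcases Nat.eq_zero_or_pos d with rfl | hd
  · have hx0 : x = 0 := Subsingleton.elim _ _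
    simp [hx0] at hx
    linarith
  have hd1 : (0 : ℝ) ≤ d - 1 := by
    have : (1 : ℝ) ≤ d := by exact_mod_cast hd
    linarith
  have h1 := mul_le_mul_of_nonneg_left hvX hd1
  have h2 := mul_le_mul_of_nonneg_left hvr hd1
  have e : profileDensity n v Dv x = 2 * (radialPart Dv x * radialPart Dv x / ‖x‖ ^ 2)
      - dotProd Dv Dv x + n x * (v x * v x) + (d - 1) * (v x * radialPart Dv x / ‖x‖ ^ 2)
      + (d - 1) * (v x * v x / ‖x‖ ^ 2) / 2 := by
    unfold profileDensity
    field_simp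
  rw [e]
  have hM0 := abs_nonneg M
  nlinarith [mul_nonneg hM0 hS, mul_nonneg hd1 hS, mul_nonneg hd1 hv]

namespace SmoothApprox

/-- The spherical integrals of the Pohozaev density dominate the weighted mass of any smaller
ball. -/
theorem mass_le_sphereProfile [NeZero d] (h : SmoothApprox w v Dv fun x => -(n x * v x))
    (hpos : ∀ᵐ x : E d, 0 < n x) (hβ : betaConst n Dn < 1) (hDn : HasWeakGradientOn {0}ᶜ n Dn)
    (hnb : LocBdd n) {R₀ R₁ : ℝ} (hR₀ : 0 < R₀) (hR : R₀ ≤ R₁) {r : ℝ} (hr : R₁ < r)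
    (hgood : IsMollifiedAt (sphereProfile R₀ (virialDensity n v Dv)) r) :
    ∫ x in Metric.closedBall 0 R₁, n x * (v x * v x)
      ≤ sphereProfile R₀ (virialDensity n v Dv) r := by
  have hε : Tendsto (fun k : ℕ => 1 / ((k : ℝ) + 1)) atTop (𝓝 0) :=
    tendsto_one_div_add_atTop_nhds_zero_nat
  refine ge_of_tendsto hgood ?_
  filter_upwards [hε.eventually (gt_mem_nhds (sub_pos.2 hr))] with k hk
  have mn : MemLpLoc 1 fun x => n x * (v x * v x) := (h.memLpLoc.mul h.memLpLoc).bdd_mul hnb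
  have hεk : 1 / ((k : ℝ) + 1) ≤ 1 := by
    rw [div_le_one (by positivity)]
    linarith [k.cast_nonneg (α := ℝ)]
  -- a smooth cut-off of the ball of radius `r`
  set η : ℝ → ℝ := fun t => 1 - smoothStep k (t - r) with hη
  have hd : ∀ t, deriv η t = -lineMollifier k (t - r) := fun t =>
    (((hasDerivAt_smoothStep k (t - r)).comp_sub_const t r).const_sub 1).deriv
  have hη1 : ∀ t ≤ R₁, η t = 1 := fun t ht => by
    simp only [hη]
    rw [smoothStep_eq_zero k (by linarith), sub_zero]
  have hη0 : ∀ t, 0 ≤ η t := fun t => sub_nonneg.2 (smoothStep_le_one k _)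
  have hηle : ∀ t, η t ≤ 1 := fun t => sub_le_self _ (smoothStep_nonneg k _)
  have hηz : ∀ t, r + 1 < t → η t = 0 := fun t ht => by
    simp only [hη]
    rw [smoothStep_eq_one k (by linarith), sub_self]
  have hcut : IsRadialCutoff η := by
    refine ⟨contDiff_const.sub ((smoothStep_contDiff k).comp (contDiff_id.sub contDiff_const)),
      ⟨R₁, hR₀.trans_le hR, fun t ht => ?_⟩, r + 1, hηz⟩
    rw [hη1 t ht.le, hη1 0 (hR₀.trans_le hR).le]
  have hw : IsRadialWeight R₀ (r + 1) fun t => lineMollifier k (t - r) := by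
    have hcont := (lineMollifier_contDiff k).continuous
    refine ⟨hcont.measurable.comp (measurable_id.sub_const r), ?_, fun t ht => ?_⟩
    · obtain ⟨C, hC⟩ := ((lineBump k).hasCompactSupport_normed
        (μ := volume)).exists_bound_of_continuous hcont
      exact ⟨C, fun t => hC _⟩
    · have h1 : |t - r| < 1 / ((k : ℝ) + 1) := by
        by_contra h2
        exact ht (lineMollifier_eq_zero k (not_lt.1 h2))
      have := abs_lt.1 h1
      constructor <;> linarith
  have hV := h.radial_virial hpos hβ hDn hnb hcut hη0
  have iV : Integrable fun x : E d => lineMollifier k (‖x‖ - r) * virialDensity n v Dv x :=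
    h.integrable_virialDensity hnb hR₀ hw
  rw [(hw.integral_sphereProfile hR₀ fun _ _ hc => h.integrable_virialDensity hnb hR₀ hc).2]
  have hηc : Continuous η := hcut.smooth.continuous
  have im : Integrable fun x : E d => (2 - decreaseRate n Dn ‖x‖) * η ‖x‖ * (n x * (v x * v x)) := by
    have hb : LocBdd fun x : E d => (2 - decreaseRate n Dn ‖x‖) * η ‖x‖ := by
      refine ⟨(((measurable_const.sub ((measurable_decreaseRate n Dn).comp measurable_norm))).mul
        (hηc.measurable.comp measurable_norm)).aestronglyMeasurable,
        fun _ => ⟨2, Eventually.of_forall fun x => ?_⟩⟩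
      have h1 := decreaseRate_nonneg n Dn ‖x‖
      have h2 := decreaseRate_le hβ ‖x‖
      rw [Real.norm_of_nonneg (mul_nonneg (by linarith) (hη0 _))]
      nlinarith [hη0 ‖x‖, hηle ‖x‖]
    exact (mn.bdd_mul hb).integrable (R := r + 1) fun x hx => by simp [hηz _ hx]
  have hsum : ∫ x, (deriv η ‖x‖ * virialDensity n v Dv x
      + (2 - decreaseRate n Dn ‖x‖) * η ‖x‖ * (n x * (v x * v x)))
      = (∫ x, (2 - decreaseRate n Dn ‖x‖) * η ‖x‖ * (n x * (v x * v x)))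
        - ∫ x : E d, lineMollifier k (‖x‖ - r) * virialDensity n v Dv x := by
    rw [← integral_sub im iV]
    refine integral_congr_ae (Eventually.of_forall fun x => ?_)
    simp only [hd]
    ring
  rw [hsum] at hV
  have hle : ∫ x in Metric.closedBall 0 R₁, n x * (v x * v x)
      ≤ ∫ x, (2 - decreaseRate n Dn ‖x‖) * η ‖x‖ * (n x * (v x * v x)) := by
    rw [← integral_indicator Metric.isClosed_closedBall.measurableSet]
    refine integral_mono_ae ((integrable_indicator_iff Metric.isClosed_closedBall.measurableSet).2
      (memLp_one_iff_integrable.1 (mn R₁))) im ?_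
    filter_upwards [hpos] with x hx
    have h1 := decreaseRate_nonneg n Dn ‖x‖
    have h2 := decreaseRate_le hβ ‖x‖
    have hnv : 0 ≤ n x * (v x * v x) := mul_nonneg hx.le (mul_self_nonneg _)
    by_cases hx1 : x ∈ Metric.closedBall (0 : E d) R₁
    · rw [indicator_of_mem hx1, hη1 _ (by simpa using hx1)]
      nlinarith
    · rw [indicator_of_notMem hx1]
      exact mul_nonneg (mul_nonneg (by linarith) (hη0 _)) hnv
  linarith

/-- Under positivity of the angular form beyond `R₀`, the spherical integrals `F` are nonpositive
there as soon as the energy is small on a sequence of spheres. -/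
theorem sphereProfile_nonpos [NeZero d] (h : SmoothApprox w v Dv fun x => -(n x * v x))
    (hpos : ∀ᵐ x : E d, 0 < n x) (hβ : betaConst n Dn < 1) (hDn : HasWeakGradientOn {0}ᶜ n Dn)
    (hnb : LocBdd n) {M : ℝ} (hM : ∀ᵐ x : E d, n x ≤ M) {R₀ : ℝ} (hR₀ : 4 ≤ R₀)
    (hang : ∀ (R : ℝ) (c : ℝ → ℝ), IsRadialWeight R₀ R c → (∀ r, 0 ≤ c r) →
      0 ≤ ∫ x, c ‖x‖ * angularDensity n v Dv x)
    (hsmall : ∀ δ > 0, ∃ᶠ s in atTop ⊓ ae (volume : Measure ℝ),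
      sphereIntegral (fun x => dotProd Dv Dv x + v x * v x) s < δ) :
    ∀ᵐ r, R₀ < r → sphereProfile R₀ (profileDensity n v Dv) r ≤ 0 := by
  have hR₀' : 0 < R₀ := by linarith
  have hrad : RadiallyIntegrable R₀ (profileDensity n v Dv) := fun _ _ hc =>
    h.integrable_profileDensity hnb hR₀' hc
  have hF := locallyIntegrable_sphereProfile hR₀' hrad
  have mS : MemLpLoc 1 fun x => dotProd Dv Dv x + v x * v x :=
    (MemLpLoc.dotProd h.memLpLoc_grad).add (h.memLpLoc.mul h.memLpLoc)
  set F := sphereProfile R₀ (profileDensity n v Dv) with hFdef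
  set κ : ℝ → ℝ := indicator (Ici R₀) fun r => (decreaseRate n Dn r + 1 / r) / r with hκ
  have hκm : Measurable κ := (((measurable_decreaseRate n Dn).add
    (measurable_const.div measurable_id)).div measurable_id).indicator measurableSet_Ici
  have hκb : ∀ r, 0 ≤ κ r ∧ κ r ≤ 1 := by
    intro r
    by_cases hr : R₀ ≤ r
    · have h1 := decreaseRate_nonneg n Dn r
      have h2 := decreaseRate_le hβ r
      have hr1 : 0 < r := by linarith
      have h3 : 1 / r ≤ 1 := by
        rw [div_le_one hr1]; linarith
      have h4 : 0 ≤ 1 / r := by positivity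
      simp only [hκ, indicator_of_mem (mem_Ici.2 hr)]
      exact ⟨div_nonneg (by linarith) hr1.le, (div_le_one hr1).2 (by linarith)⟩
    · simp [hκ, hr]
  have hG : LocallyIntegrable fun t => κ t * F t := by
    rw [locallyIntegrable_iff]
    intro K hK
    exact Integrable.bdd_mul (hF.integrableOn_isCompact hK) hκm.aestronglyMeasurable
      (c := 1) (Eventually.of_forall fun t => by
        rw [Real.norm_of_nonneg (hκb t).1]; exact (hκb t).2)
  have hweak : ∀ χ, IsRadialTest R₀ χ → (∀ r, 0 ≤ χ r) →
      ∫ t, deriv χ t * F t ≤ ∫ t, χ t * (κ t * F t) := by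
    intro χ hχ hχ0
    obtain ⟨R, hw, hw'⟩ := hχ.exists_weight
    have hwκ : IsRadialWeight R₀ R fun r => κ r * χ r := hw.mul_left hκm ⟨1, fun r _ => by
      rw [abs_of_nonneg (hκb r).1]; exact (hκb r).2⟩
    have e : (fun t => χ t * (κ t * F t)) = fun t => κ t * χ t * F t := by
      ext t; ring
    rw [(hw'.integral_sphereProfile hR₀' hrad).2, e, (hwκ.integral_sphereProfile hR₀' hrad).2]
    refine (h.profile_growth hpos hβ hDn hnb (by linarith) hang hχ hχ0).trans_eq ?_
    refine integral_congr_ae (Eventually.of_forall fun x => ?_)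
    by_cases hx : R₀ ≤ ‖x‖
    · simp only [hκ, indicator_of_mem (mem_Ici.2 hx)]
      ring
    · simp [hχ.zero _ (not_le.1 hx).le]
  have hκi : ∀ s, R₀ < s → ∫ t in R₀..s, κ t ≤ 3 / 4 := by
    intro s hs
    refine (intervalIntegral.integral_congr fun t ht => ?_).trans_le (integral_rate_le hβ hR₀ hs)
    rw [uIcc_of_le hs.le] at ht
    simp only [hκ, indicator_of_mem (mem_Ici.2 ht.1)]
  have hFsmall : ∀ δ > 0, ∃ᶠ s in atTop ⊓ ae (volume : Measure ℝ), F s < δ := by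
    intro δ hδ
    have hC : 0 < |M| + d + 2 := by positivity
    have hmem : ∀ᶠ s in atTop ⊓ ae (volume : Measure ℝ),
        F s ≤ (|M| + d + 2) * sphereIntegral (fun x => dotProd Dv Dv x + v x * v x) s := by
      have h1 : ∀ᶠ s in atTop ⊓ ae (volume : Measure ℝ), R₀ < s :=
        (eventually_gt_atTop R₀).filter_mono inf_le_left
      have h2 := (hrad.ae_integrable_sphere hR₀').filter_mono
        (inf_le_right : atTop ⊓ ae (volume : Measure ℝ) ≤ _)
      have h3 := ((mS.radiallyIntegrable R₀).ae_integrable_sphere hR₀').filter_mono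
        (inf_le_right : atTop ⊓ ae (volume : Measure ℝ) ≤ _)
      have h4 := (ae_sphere hM).filter_mono
        (inf_le_right : atTop ⊓ ae (volume : Measure ℝ) ≤ _)
      filter_upwards [h1, h2, h3, h4] with s s1 s2 s3 s4
      have hs0 : 0 < s := hR₀'.trans s1
      have e : (|M| + d + 2) * sphereIntegral (fun x => dotProd Dv Dv x + v x * v x) s
          = sphereIntegral (fun x => (|M| + d + 2) * (dotProd Dv Dv x + v x * v x)) s := by
        unfold sphereIntegral
        rw [integral_const_mul]
        ring
      rw [e, hFdef, sphereProfile, indicator_of_mem (mem_Ici.2 s1.le)]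
      refine sphereIntegral_mono hs0.le (s2 s1.le) ((s3 s1.le).const_mul _) ?_
      filter_upwards [s4 hs0] with y hy
      refine profileDensity_le ?_ hy
      rw [norm_smul, Real.norm_of_nonneg hs0.le, norm_eq_of_mem_sphere, mul_one]
      linarith
    refine ((hsmall (δ / (|M| + d + 2)) (by positivity)).and_eventually hmem).mono ?_
    rintro s ⟨s1, s2⟩
    refine s2.trans_lt ?_
    rwa [lt_div_iff₀' hC] at s1
  filter_upwards [ae_isMollifiedAt hF] with r hr hRr
  exact nonpos_of_le_add_integral hF hκm (fun r _ => (hκb r).1) (fun r _ => (hκb r).2) hκi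
    (L := {r | IsMollifiedAt F r}) (ae_isMollifiedAt hF)
    (fun r hr s hs hRr hrs => le_add_integral_of_weak hF hG hweak hRr hrs hr hs) hFsmall hRr hr

/-- The weighted mass of every ball vanishes, because `q = ∫_{|x|=r} v²` is nonnegative while
`q' ≤ -2 k₀` at infinity. -/
theorem mass_nonpos [NeZero d] (h : SmoothApprox w v Dv fun x => -(n x * v x))
    (hpos : ∀ᵐ x : E d, 0 < n x) (hβ : betaConst n Dn < 1) (hDn : HasWeakGradientOn {0}ᶜ n Dn)
    (hnb : LocBdd n) {R₀ R₁ : ℝ} (hR₀ : 0 < R₀) (hR : R₀ ≤ R₁)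
    (hFneg : ∀ᵐ r, R₀ < r → sphereProfile R₀ (profileDensity n v Dv) r ≤ 0) :
    ∫ x in Metric.closedBall 0 R₁, n x * (v x * v x) ≤ 0 := by
  have hradF : RadiallyIntegrable R₀ (profileDensity n v Dv) := fun _ _ hc =>
    h.integrable_profileDensity hnb hR₀ hc
  have hradK : RadiallyIntegrable R₀ (virialDensity n v Dv) := fun _ _ hc =>
    h.integrable_virialDensity hnb hR₀ hc
  have hradq : RadiallyIntegrable R₀ fun x => v x * v x :=
    (h.memLpLoc.mul h.memLpLoc).radiallyIntegrable R₀
  set F := sphereProfile R₀ (profileDensity n v Dv) with hF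
  set K := sphereProfile R₀ (virialDensity n v Dv) with hK
  set q := sphereProfile R₀ fun x => v x * v x with hq
  set k₀ := ∫ x in Metric.closedBall 0 R₁, n x * (v x * v x) with hk₀
  have liK := locallyIntegrable_sphereProfile hR₀ hradK
  have liq := locallyIntegrable_sphereProfile hR₀ hradq
  have hq0 : ∀ r, 0 ≤ q r := fun r => by
    by_cases hr : R₀ ≤ r
    · simp only [hq, sphereProfile, indicator_of_mem (mem_Ici.2 hr), sphereIntegral]
      exact mul_nonneg (pow_nonneg (hR₀.le.trans hr) _)
        (integral_nonneg fun y => mul_self_nonneg _)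
    · simp [hq, sphereProfile, hr]
  have hweak : ∀ χ, IsRadialTest R₁ χ → (∀ r, 0 ≤ χ r) →
      ∫ t, deriv χ t * -q t ≤ ∫ t, χ t * (-2 * k₀) := by
    intro χ hχ hχ0
    have hχ' : IsRadialTest R₀ χ := ⟨hχ.smooth, fun r hr => hχ.zero r (hr.trans hR), hχ.bdd⟩
    obtain ⟨R, hw, hw'⟩ := hχ'.exists_weight
    obtain ⟨iK, eK⟩ := hw.integral_sphereProfile hR₀ hradK
    obtain ⟨iF, eF⟩ := (hw.pow hR₀ 1).integral_sphereProfile hR₀ hradF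
    have eq := (hw'.integral_sphereProfile hR₀ hradq).2
    have i1 := hradK R _ hw
    have i2 := hradF R _ (hw.pow hR₀ 1)
    have e1 : ∫ t, deriv χ t * -q t
        = -(2 * ((∫ t, χ t * K t) - ∫ t, t ^ 1 * χ t * F t)) := by
      simp only [mul_neg]
      rw [integral_neg, eq, h.integral_deriv_mul_sq hR₀ hχ', eK, eF, ← integral_sub i1 i2,
        ← integral_const_mul]
      congr 1
      refine integral_congr_ae (Eventually.of_forall fun x => ?_)
      simp only [pow_one]
      ring
    rw [e1, ← integral_sub iK iF, ← integral_const_mul, ← integral_neg]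
    have iχ : Integrable χ := hχ.smooth.continuous.integrable_of_hasCompactSupport
      hχ.hasCompactSupport
    refine integral_mono_ae ((iK.sub iF).const_mul 2).neg (iχ.mul_const _) ?_
    filter_upwards [hFneg, ae_isMollifiedAt liK] with t ht hK'
    rcases le_or_gt t R₁ with h1 | h1
    · simp [hχ.zero t h1]
    · have h2 := ht (hR.trans_lt h1)
      have h3 : k₀ ≤ K t := h.mass_le_sphereProfile hpos hβ hDn hnb hR₀ hR h1 hK'
      have ht0 : 0 < t := (hR₀.trans_le hR).trans h1
      have h4 : 0 ≤ χ t * (K t - k₀) := mul_nonneg (hχ0 t) (sub_nonneg.2 h3)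
      have h5 : 0 ≤ χ t * (t * -F t) := mul_nonneg (hχ0 t) (mul_nonneg ht0.le (by linarith))
      simp only [pow_one]
      linarith
  have hgood := ae_isMollifiedAt (F := fun t => -q t) liq.neg
  have hev : ∀ a : ℝ, ∃ s, a < s ∧ IsMollifiedAt (fun t => -q t) s := fun a => by
    have : (ae (volume.restrict (Ioi a))).NeBot := ae_neBot.2 (by simp)
    obtain ⟨s, hs, hs'⟩ := ((ae_restrict_mem measurableSet_Ioi).and
      (ae_restrict_of_ae (s := Ioi a) hgood)).exists
    exact ⟨s, hs, hs'⟩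
  obtain ⟨r, hr, gr⟩ := hev R₁
  by_contra! hk
  -- with slope at most `-2 k₀` the function `q` would be negative at such an `s`
  obtain ⟨s, hs, gs⟩ := hev (r + q r / k₀)
  have hrs : r < s := lt_of_le_of_lt (le_add_of_nonneg_right (div_nonneg (hq0 r) hk.le)) hs
  have key := le_add_integral_of_weak liq.neg (locallyIntegrable_const (-2 * k₀)) hweak hr hrs gr gs
  rw [intervalIntegral.integral_const, smul_eq_mul] at key
  have h1 : q r < (s - r) * k₀ := by
    rw [← div_lt_iff₀ hk]; linarith
  have := hq0 s
  have := hq0 r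
  simp only [Pi.neg_apply] at key
  nlinarith

/-- A solution vanishes if its angular form is nonnegative on large spheres and its energy is small
on a sequence of spheres. -/
theorem eq_zero_of_angular_nonneg [NeZero d] (h : SmoothApprox w v Dv fun x => -(n x * v x))
    (hpos : ∀ᵐ x : E d, 0 < n x) (hβ : betaConst n Dn < 1) (hDn : HasWeakGradientOn {0}ᶜ n Dn)
    (hnb : LocBdd n) {M : ℝ} (hM : ∀ᵐ x : E d, n x ≤ M) {R₀ : ℝ} (hR₀ : 4 ≤ R₀)
    (hang : ∀ (R : ℝ) (c : ℝ → ℝ), IsRadialWeight R₀ R c → (∀ r, 0 ≤ c r) →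
      0 ≤ ∫ x, c ‖x‖ * angularDensity n v Dv x)
    (hsmall : ∀ δ > 0, ∃ᶠ s in atTop ⊓ ae (volume : Measure ℝ),
      sphereIntegral (fun x => dotProd Dv Dv x + v x * v x) s < δ) :
    ∀ᵐ x, v x = 0 := by
  have hF := h.sphereProfile_nonpos hpos hβ hDn hnb hM hR₀ hang hsmall
  have mn : MemLpLoc 1 fun x => n x * (v x * v x) := (h.memLpLoc.mul h.memLpLoc).bdd_mul hnb
  have key : ∀ N : ℕ, ∀ᵐ x : E d, x ∈ Metric.closedBall (0 : E d) (R₀ + N) → v x = 0 := by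
    intro N
    have h1 := h.mass_nonpos hpos hβ hDn hnb (R₁ := R₀ + N) (by linarith)
      (le_add_of_nonneg_right N.cast_nonneg) hF
    have hnn : 0 ≤ᵐ[volume.restrict (Metric.closedBall (0 : E d) (R₀ + N))]
        fun x => n x * (v x * v x) := ae_restrict_of_ae <| by
      filter_upwards [hpos] with x hx
      exact mul_nonneg hx.le (mul_self_nonneg _)
    have h2 := (integral_eq_zero_iff_of_nonneg_ae hnn (memLp_one_iff_integrable.1 (mn _))).1
      (le_antisymm h1 (integral_nonneg_of_ae hnn))
    rw [← ae_restrict_iff' Metric.isClosed_closedBall.measurableSet]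
    filter_upwards [h2, ae_restrict_of_ae hpos] with x hx hx0
    simpa [hx0.ne'] using hx
  filter_upwards [ae_all_iff.2 key] with x hx
  obtain ⟨N, hN⟩ := exists_nat_ge ‖x‖
  exact hx N (by simp; linarith)

end SmoothApprox
end

/-! ### Real and imaginary parts of a solution -/

section

variable {d : ℕ} {n : E d → ℝ} {u : E d → ℂ} {Du : Fin d → E d → ℂ}

theorem IsTestFunction.integrable_smul {φ : E d → ℝ} (hφ : IsTestFunction univ φ)
    {F : Type*} [NormedAddCommGroup F] [NormedSpace ℝ F] {f : E d → F}
    (hf : LocallyIntegrable f) : Integrable fun x => φ x • f x :=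
  hf.integrable_smul_left_of_hasCompactSupport hφ.1.continuous hφ.2.1

theorem IsTestFunction.integrable_partialDeriv_smul {φ : E d → ℝ} (hφ : IsTestFunction univ φ)
    {F : Type*} [NormedAddCommGroup F] [NormedSpace ℝ F] {f : E d → F}
    (hf : LocallyIntegrable f) (i : Fin d) : Integrable fun x => partialDeriv i φ x • f x := by
  refine hf.integrable_smul_left_of_hasCompactSupport (hφ.grad_continuous i) ?_
  refine HasCompactSupport.intro hφ.2.1.isCompact fun x hx => ?_
  exact partialDeriv_eq_zero_of_notMem hx i

theorem HasWeakGradientOn.clm_comp (L : ℂ →L[ℝ] ℝ) (h : HasWeakGradientOn univ u Du) :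
    HasWeakGradientOn univ (fun x => L (u x)) fun i x => L (Du i x) := by
  obtain ⟨h1, h2, h3⟩ := h
  have hl : ∀ {f : E d → ℂ}, LocallyIntegrableOn f univ →
      LocallyIntegrableOn (fun x => L (f x)) univ := fun {f} hf x hx => by
    obtain ⟨s, hs, hi⟩ := hf x hx
    exact ⟨s, hs, L.integrable_comp hi⟩
  refine ⟨hl h1, fun i => hl (h2 i), fun φ hφ i => ?_⟩
  have e1 := L.integral_comp_comm
    (hφ.integrable_partialDeriv_smul (locallyIntegrableOn_univ.1 h1) i)
  have e2 := L.integral_comp_comm (hφ.integrable_smul (locallyIntegrableOn_univ.1 (h2 i)))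
  simp only [map_smul] at e1 e2
  rw [e1, e2, h3 φ hφ i, map_neg]

theorem IsHelmholtzSolution.clm_comp (L : ℂ →L[ℝ] ℝ) (h : IsHelmholtzSolution n u Du)
    (hDu : HasWeakGradientOn univ u Du) {φ : E d → ℝ} (hφ : IsTestFunction univ φ) :
    ∑ i, ∫ x, partialDeriv i φ x * L (Du i x) = -∫ x, φ x * -(n x * L (u x)) := by
  have h1 := congrArg L (h.2 φ hφ)
  have e1 : ∀ i, ∫ x, partialDeriv i φ x * L (Du i x) = L (∫ x, partialDeriv i φ x • Du i x) :=
    fun i => by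
      rw [← L.integral_comp_comm
        (hφ.integrable_partialDeriv_smul (locallyIntegrableOn_univ.1 (hDu.2.1 i)) i)]
      simp only [map_smul, smul_eq_mul]
  have e2 : ∫ x, φ x * -(n x * L (u x)) = -L (∫ x, φ x • (n x • u x)) := by
    rw [← L.integral_comp_comm (hφ.integrable_smul h.1), ← integral_neg]
    simp only [map_smul, smul_eq_mul, mul_neg]
  rw [map_add, map_neg, map_sum, map_zero] at h1
  simp only [e1, e2]
  linarith

theorem IsLocallyL2.clm_comp (L : ℂ →L[ℝ] ℝ) (h : IsLocallyL2 u) :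
    MemLpLoc 2 fun x => L (u x) := fun R =>
  L.comp_memLp' (h _ (isCompact_closedBall 0 R))

/-- The spherical energy of a real or imaginary part is at most that of the complex function. No
integrability is needed: the Bochner integral is at most the lower integral in any case. -/
theorem sphereIntegral_lt_of_sphereEnergy_lt (L : ℂ →L[ℝ] ℝ) (hL : ∀ z, |L z| ≤ ‖z‖) {s δ : ℝ}
    (hs : 0 < s) (hδ : 0 < δ) (h : sphereEnergy u Du s < ENNReal.ofReal δ) :
    sphereIntegral (fun x => dotProd (fun i x => L (Du i x)) (fun i x => L (Du i x)) x
      + L (u x) * L (u x)) s < δ := by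
  have hp : 0 ≤ s ^ (d - 1) := pow_nonneg hs.le _
  refine (le_abs_self _).trans_lt ?_
  rw [← ENNReal.ofReal_lt_ofReal_iff hδ]
  refine lt_of_le_of_lt ?_ h
  unfold sphereIntegral sphereEnergy
  rw [abs_mul, abs_of_nonneg hp, ENNReal.ofReal_mul hp]
  gcongr
  rw [← Real.norm_eq_abs, ofReal_norm]
  refine (enorm_integral_le_lintegral_enorm _).trans (lintegral_mono fun y => ?_)
  have hz : ∀ z : ℂ, ‖L z * L z‖ₑ ≤ ‖z‖ₑ ^ 2 := fun z => by
    have : ‖L z‖ₑ ≤ ‖z‖ₑ := by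
      rw [enorm_le_iff_norm_le, Real.norm_eq_abs]
      exact hL z
    rw [enorm_mul, sq]
    gcongr
  refine (enorm_add_le _ _).trans (add_le_add ?_ (hz _))
  unfold dotProd
  exact (enorm_sum_le _ _).trans (Finset.sum_le_sum fun i _ => hz _)

end

/-! ### Polar coordinates and a Poincaré inequality on the circle -/

section

/-- The point with polar coordinates `(r, θ)`. -/
noncomputable def circlePoint (r θ : ℝ) : E 2 := !₂[r * Real.cos θ, r * Real.sin θ]

theorem circlePoint_eq (p : ℝ × ℝ) :
    circlePoint p.1 p.2 = Complex.orthonormalBasisOneI.repr (Complex.polarCoord.symm p) := by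
  have e : Complex.polarCoord.symm p = ⟨p.1 * Real.cos p.2, p.1 * Real.sin p.2⟩ := by
    rw [Complex.polarCoord_symm_apply, mul_add, ← mul_assoc, ← Complex.ofReal_mul,
      ← Complex.ofReal_mul, Complex.mk_eq_add_mul_I]
  ext i
  rw [Complex.orthonormalBasisOneI_repr_apply, e]
  fin_cases i <;> simp [circlePoint]

theorem norm_circlePoint {r : ℝ} (hr : 0 ≤ r) (θ : ℝ) : ‖circlePoint r θ‖ = r := by
  rw [circlePoint_eq (r, θ), LinearIsometryEquiv.norm_map, Complex.norm_polarCoord_symm,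
    abs_of_nonneg hr]

theorem circlePoint_mul (s r θ : ℝ) : circlePoint (s * r) θ = s • circlePoint r θ := by
  ext i
  fin_cases i <;> simp [circlePoint, mul_assoc]

theorem measurable_circlePoint : Measurable fun p : ℝ × ℝ => circlePoint p.1 p.2 := by
  have : Continuous fun p : ℝ × ℝ => circlePoint p.1 p.2 := by
    unfold circlePoint
    fun_prop
  exact this.measurable

/-- Integration in plane polar coordinates. As for the Bochner integral in general, both sides are
zero when `f` is not integrable. -/
theorem integral_polar (f : E 2 → ℝ) :
    ∫ x, f x = ∫ p in Ioi (0 : ℝ) ×ˢ Ioo (-Real.pi) Real.pi, p.1 * f (circlePoint p.1 p.2) := by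
  have h1 := (Complex.orthonormalBasisOneI.measurePreserving_repr).integral_comp
    Complex.orthonormalBasisOneI.repr.toHomeomorph.measurableEmbedding f
  have h2 := Complex.integral_comp_polarCoord_symm fun z =>
    f (Complex.orthonormalBasisOneI.repr z)
  rw [← h1]
  simp only [circlePoint_eq]
  exact h2.symm

/-- A property that holds almost everywhere in the plane holds almost everywhere on almost every
circle. -/
theorem ae_polar {p : E 2 → Prop} (h : ∀ᵐ x, p x) :
    ∀ᵐ r : ℝ, 0 < r → ∀ᵐ θ ∂volume.restrict (Ioo (-Real.pi) Real.pi), p (circlePoint r θ) := by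
  obtain ⟨t, ht, htm, ht0⟩ := exists_measurable_superset_of_null (ae_iff.1 h)
  have h2 := Complex.lintegral_comp_polarCoord_symm fun z =>
    t.indicator (fun _ => 1) (Complex.orthonormalBasisOneI.repr z)
  have h1 := (Complex.orthonormalBasisOneI.measurePreserving_repr).lintegral_comp_emb
    Complex.orthonormalBasisOneI.repr.toHomeomorph.measurableEmbedding
    (t.indicator fun _ => (1 : ℝ≥0∞))
  rw [lintegral_indicator htm, lintegral_const, Measure.restrict_apply_univ, ht0, mul_zero] at h1
  rw [h1, lintegral_eq_zero_iff] at h2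
  · have h3 : ∀ᵐ q : ℝ × ℝ ∂(volume.restrict (Ioi (0 : ℝ))).prod
        (volume.restrict (Ioo (-Real.pi) Real.pi)), p (circlePoint q.1 q.2) := by
      rw [Measure.prod_restrict]
      have hT : MeasurableSet (Ioi (0 : ℝ) ×ˢ Ioo (-Real.pi) Real.pi) :=
        measurableSet_Ioi.prod measurableSet_Ioo
      filter_upwards [h2, ae_restrict_mem hT] with q hq hqT
      by_contra hc
      have hmem : circlePoint q.1 q.2 ∈ t := ht hc
      rw [← circlePoint_eq, indicator_of_mem hmem] at hq
      have : 0 < ENNReal.ofReal q.1 := ENNReal.ofReal_pos.2 hqT.1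
      simp only [smul_eq_mul, mul_one, Pi.zero_apply] at hq
      exact this.ne' hq
    exact (ae_restrict_iff' measurableSet_Ioi).1 (Measure.ae_ae_of_ae_prod h3)
  · simp only [← circlePoint_eq]
    exact (ENNReal.measurable_ofReal.comp measurable_fst).smul
      ((measurable_const.indicator htm).comp measurable_circlePoint)

/-- A Poincaré type inequality on the circle: a weight `0 ≤ N ≤ 1` that is close to `1` in the mean
controls the mean square of every `f`, up to the energy of `f`. -/
theorem circle_inequality {f f' N : ℝ → ℝ} (hf : ∀ θ, HasDerivAt f (f' θ) θ) (hf' : Continuous f')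
    (hN : Measurable N) (hN0 : ∀ θ, 0 ≤ N θ) (hN1 : ∀ θ, N θ ≤ 1)
    (hdef : ∫ θ in Ioo (-Real.pi) Real.pi, (1 - N θ) ≤ 1 / 8) :
    0 ≤ ∫ θ in Ioo (-Real.pi) Real.pi, (N θ * (f θ * f θ) + f' θ * f' θ - f θ * f θ / 4) := by
  set I := Ioo (-Real.pi) Real.pi with hI
  have hπ := Real.pi_pos
  have hπ3 := Real.pi_gt_three
  have hπ4 := Real.pi_le_four
  have hvol : volume.real I = 2 * Real.pi := by
    rw [hI, Real.volume_real_Ioo_of_le (by linarith)]; ring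
  have hfc : Continuous f := continuous_iff_continuousAt.2 fun θ => (hf θ).continuousAt
  have hint : ∀ {g : ℝ → ℝ}, Continuous g → IntegrableOn g I := fun hg =>
    (hg.integrableOn_Icc).mono_set Ioo_subset_Icc_self
  have hNb : ∀ {g : ℝ → ℝ}, Continuous g → IntegrableOn (fun θ => N θ * g θ) I := fun hg =>
    Integrable.bdd_mul (c := 1) (hint hg) hN.aestronglyMeasurable (Eventually.of_forall fun θ => by
      rw [Real.norm_of_nonneg (hN0 θ)]; exact hN1 θ)
  set A := ∫ θ in I, f θ * f θ with hA
  set B := ∫ θ in I, f' θ * f' θ with hB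
  set V := ∫ θ in I, |f' θ| with hV
  have iA : IntegrableOn (fun θ => f θ * f θ) I := hint (hfc.mul hfc)
  have iB : IntegrableOn (fun θ => f' θ * f' θ) I := hint (hf'.mul hf')
  have iV : IntegrableOn (fun θ => |f' θ|) I := hint hf'.abs
  have hA0 : 0 ≤ A := setIntegral_nonneg measurableSet_Ioo fun θ _ => mul_self_nonneg _
  have hB0 : 0 ≤ B := setIntegral_nonneg measurableSet_Ioo fun θ _ => mul_self_nonneg _
  have hc : ∀ c : ℝ, ∫ _ in I, c = 2 * Real.pi * c := fun c => by
    rw [setIntegral_const, hvol, smul_eq_mul]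
  have iconst : ∀ c : ℝ, IntegrableOn (fun _ : ℝ => c) I := fun c => hint continuous_const
  -- the Cauchy-Schwarz inequality for `|f'|`
  have hCS : V ^ 2 ≤ 2 * Real.pi * B := by
    have h0 : 0 ≤ ∫ θ in I, (|f' θ| - V / (2 * Real.pi)) ^ 2 :=
      setIntegral_nonneg measurableSet_Ioo fun θ _ => sq_nonneg _
    have e : ∫ θ in I, (|f' θ| - V / (2 * Real.pi)) ^ 2
        = B - V / Real.pi * V + 2 * Real.pi * (V / (2 * Real.pi)) ^ 2 := by
      have e1 : V / Real.pi * V = ∫ θ in I, V / Real.pi * |f' θ| := (integral_const_mul _ _).symm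
      rw [← hc, e1, hB, ← integral_sub iB (iV.const_mul _),
        ← integral_add (f := fun θ => f' θ * f' θ - V / Real.pi * |f' θ|)
          (iB.sub (iV.const_mul _)) (iconst _)]
      refine integral_congr_ae (Eventually.of_forall fun θ => ?_)
      simp only
      have : f' θ * f' θ = |f' θ| * |f' θ| := (abs_mul_abs_self _).symm
      rw [this]
      field_simp
      ring
    rw [e] at h0
    have e2 : B - V / Real.pi * V + 2 * Real.pi * (V / (2 * Real.pi)) ^ 2
        = B - V ^ 2 / (2 * Real.pi) := by
      field_simp
      ring
    rw [e2, sub_nonneg, div_le_iff₀ (by positivity)] at h0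
    linarith
  have hosc : ∀ θ ∈ I, ∀ θ' ∈ I, |f θ - f θ'| ≤ V := by
    intro θ hθ θ' hθ'
    have h1 : ∫ t in θ'..θ, f' t = f θ - f θ' :=
      intervalIntegral.integral_eq_sub_of_hasDerivAt (fun t _ => hf t)
        (hf'.intervalIntegrable _ _)
    rw [← h1, ← Real.norm_eq_abs]
    refine intervalIntegral.norm_integral_le_integral_norm_uIoc.trans ?_
    refine setIntegral_mono_set iV (Eventually.of_forall fun t => abs_nonneg _) ?_
    refine LE.le.eventuallyLE fun t ht => ?_
    rw [mem_uIoc] at ht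
    rcases ht with ht | ht
    · exact ⟨hθ'.1.trans ht.1, ht.2.trans_lt hθ.2⟩
    · exact ⟨hθ.1.trans ht.1, ht.2.trans_lt hθ'.2⟩
  -- the mean value over `θ'` bounds `f²` pointwise
  have hsup : ∀ θ ∈ I, f θ * f θ ≤ A / Real.pi + 4 * Real.pi * B := by
    intro θ hθ
    have h1 : ∫ _ in I, f θ * f θ ≤ ∫ θ' in I, (2 * (f θ' * f θ') + 2 * V ^ 2) := by
      refine setIntegral_mono_on (iconst _) ((iA.const_mul 2).add (iconst _)) measurableSet_Ioo
        fun θ' hθ' => ?_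
      have h2 : (f θ - f θ') ^ 2 ≤ V ^ 2 := sq_le_sq' (by
        have := neg_abs_le (f θ - f θ'); linarith [hosc θ hθ θ' hθ'])
        ((le_abs_self _).trans (hosc θ hθ θ' hθ'))
      nlinarith [sq_nonneg (f θ - 2 * f θ')]
    rw [hc, integral_add (iA.const_mul 2) (iconst _), integral_const_mul, hc] at h1
    rw [← hA] at h1
    have h3 : f θ * f θ * Real.pi ≤ A + 4 * Real.pi ^ 2 * B := by nlinarith
    have : f θ * f θ ≤ (A + 4 * Real.pi ^ 2 * B) / Real.pi := by
      rwa [le_div_iff₀ hπ]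
    refine this.trans_eq ?_
    field_simp
  have iN : IntegrableOn (fun θ => N θ * (f θ * f θ)) I := hNb (hfc.mul hfc)
  have hD : ∫ θ in I, (1 - N θ) * (f θ * f θ) ≤ 1 / 8 * (A / Real.pi + 4 * Real.pi * B) := by
    have hC0 : 0 ≤ A / Real.pi + 4 * Real.pi * B := by positivity
    have i1 : IntegrableOn (fun θ => (1 - N θ)) I := by
      have := (iconst 1).sub (hNb (continuous_const (y := (1 : ℝ))))
      simpa [Pi.sub_def] using this
    calc ∫ θ in I, (1 - N θ) * (f θ * f θ)
        ≤ ∫ θ in I, (1 - N θ) * (A / Real.pi + 4 * Real.pi * B) := by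
          refine setIntegral_mono_on ?_ (i1.mul_const _) measurableSet_Ioo fun θ hθ =>
            mul_le_mul_of_nonneg_left (hsup θ hθ) (sub_nonneg.2 (hN1 θ))
          refine (iA.sub iN).congr (Eventually.of_forall fun θ => ?_)
          simp only [Pi.sub_apply]
          ring
      _ = (∫ θ in I, (1 - N θ)) * (A / Real.pi + 4 * Real.pi * B) := integral_mul_const _ _
      _ ≤ _ := mul_le_mul_of_nonneg_right hdef hC0
  have eD : ∫ θ in I, (1 - N θ) * (f θ * f θ) = A - ∫ θ in I, N θ * (f θ * f θ) := by
    rw [hA, ← integral_sub iA iN]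
    refine integral_congr_ae (Eventually.of_forall fun θ => ?_)
    simp only
    ring
  have hQ0 : 0 ≤ ∫ θ in I, N θ * (f θ * f θ) :=
    setIntegral_nonneg measurableSet_Ioo fun θ _ => mul_nonneg (hN0 θ) (mul_self_nonneg _)
  rw [integral_sub (f := fun θ => N θ * (f θ * f θ) + f' θ * f' θ) (iN.add iB) (iA.div_const 4), integral_add iN iB, integral_div, ← hA, ← hB]
  rw [eD] at hD
  -- `∫ N f² ≥ A - A/24 - 2B`; as `∫ N f²` is also nonnegative, half of this bound may be used, and
  -- `(23/48) A - B` suffices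
  have h1 : A / Real.pi ≤ A / 3 := div_le_div_of_nonneg_left hA0 (by norm_num) hπ3.le
  have h2 : 4 * Real.pi * B ≤ 16 * B := by nlinarith
  linarith

/-- The integral of `1 - min (1, m n)` over the angles of the circle of radius `r`. It measures how
much of the circle lies in the region where `m n` is small. -/
noncomputable def circleDefect (n : E 2 → ℝ) (m r : ℝ) : ℝ :=
  ∫ θ in Ioo (-Real.pi) Real.pi, (1 - min 1 (m * n (circlePoint r θ)))

variable {n : E 2 → ℝ}

theorem integrableOn_circleDefect (hn : Measurable n) (hn0 : ∀ x, 0 ≤ n x) {m : ℝ} (hm : 0 ≤ m)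
    (r : ℝ) : IntegrableOn (fun θ => 1 - min 1 (m * n (circlePoint r θ)))
      (Ioo (-Real.pi) Real.pi) := by
  have hmeas : Measurable fun θ => 1 - min 1 (m * n (circlePoint r θ)) :=
    measurable_const.sub (measurable_const.min (measurable_const.mul
      (hn.comp (measurable_circlePoint.comp measurable_prodMk_left))))
  refine Measure.integrableOn_of_bounded (M := 1) measure_Ioo_lt_top.ne hmeas.aestronglyMeasurable
    (Eventually.of_forall fun θ => ?_)
  have h1 : 0 ≤ min 1 (m * n (circlePoint r θ)) := le_min zero_le_one (mul_nonneg hm (hn0 _))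
  have h2 : min 1 (m * n (circlePoint r θ)) ≤ 1 := min_le_left _ _
  rw [Real.norm_of_nonneg (by linarith)]
  linarith

theorem measurable_circleDefect (hn : Measurable n) (m : ℝ) : Measurable (circleDefect n m) := by
  have hmeas : Measurable (Function.uncurry fun r θ => 1 - min 1 (m * n (circlePoint r θ))) :=
    measurable_const.sub (measurable_const.min (measurable_const.mul
      (hn.comp measurable_circlePoint)))
  exact hmeas.stronglyMeasurable.integral_prod_right.measurable

theorem circleDefect_anti (hn : Measurable n) (hn0 : ∀ x, 0 ≤ n x) {m m' : ℝ} (hm : 0 ≤ m)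
    (hmm : m ≤ m') (r : ℝ) : circleDefect n m' r ≤ circleDefect n m r :=
  integral_mono (integrableOn_circleDefect hn hn0 (hm.trans hmm) r)
    (integrableOn_circleDefect hn hn0 hm r) fun θ => by
      have := mul_le_mul_of_nonneg_right hmm (hn0 (circlePoint r θ))
      have := min_le_min_left 1 this
      simp only
      linarith

theorem tendsto_circleDefect (hn : Measurable n) (hn0 : ∀ x, 0 ≤ n x) {r : ℝ}
    (hr : ∀ᵐ θ ∂volume.restrict (Ioo (-Real.pi) Real.pi), 0 < n (circlePoint r θ)) :
    Tendsto (fun m : ℕ => circleDefect n (m / 2) r) atTop (𝓝 0) := by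
  have h0 : (0 : ℝ) = ∫ _ in Ioo (-Real.pi) Real.pi, (0 : ℝ) := by simp
  rw [h0]
  refine tendsto_integral_of_dominated_convergence (fun _ => 1)
    (fun m => (integrableOn_circleDefect hn hn0 (by positivity) r).1)
    (integrableOn_const measure_Ioo_lt_top.ne) (fun m => Eventually.of_forall fun θ => ?_) ?_
  · have h1 : 0 ≤ min 1 ((m : ℝ) / 2 * n (circlePoint r θ)) :=
      le_min zero_le_one (mul_nonneg (by positivity) (hn0 _))
    have h2 := min_le_left 1 ((m : ℝ) / 2 * n (circlePoint r θ))
    rw [Real.norm_of_nonneg (by linarith)]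
    linarith
  · filter_upwards [hr] with θ hθ
    refine tendsto_const_nhds.congr' ?_
    have : Tendsto (fun m : ℕ => (m : ℝ) / 2 * n (circlePoint r θ)) atTop atTop :=
      (tendsto_natCast_atTop_atTop.atTop_div_const (by norm_num)).atTop_mul_const hθ
    filter_upwards [this.eventually_ge_atTop 1] with m hm
    rw [min_eq_left hm, sub_self]

/-- A potential that increases along rays up to a factor is not degenerate on large circles: on most
of the circle of radius `r` it is at least `2 / r`. -/
theorem exists_circleDefect_le (hn : Measurable n) (hn0 : ∀ x, 0 ≤ n x) (hpos : ∀ᵐ x, 0 < n x)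
    (hmono : ∀ s : ℝ, 1 ≤ s → ∀ᵐ x, n x ≤ 2 * n (s • x)) :
    ∃ R₀, 4 ≤ R₀ ∧ ∀ᵐ r, R₀ ≤ r → circleDefect n (r / 2) r ≤ 1 / 8 := by
  set S : Set (ℝ × ℝ) := {p | 1 ≤ p.1 → 0 < p.2 →
    ∀ m : ℕ, circleDefect n m (p.1 * p.2) ≤ circleDefect n (m / 2) p.2} with hS
  have hSm : MeasurableSet S := by
    have e : S = {p : ℝ × ℝ | 1 ≤ p.1}ᶜ ∪ ({p : ℝ × ℝ | 0 < p.2}ᶜ ∪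
        ⋂ m : ℕ, {p : ℝ × ℝ | circleDefect n m (p.1 * p.2) ≤ circleDefect n (m / 2) p.2}) := by
      ext p
      simp only [hS, mem_ofPred_eq, mem_union, mem_compl_iff, mem_iInter]
      tauto
    rw [e]
    refine (measurableSet_le measurable_const measurable_fst).compl.union
      ((measurableSet_lt measurable_const measurable_snd).compl.union
        (MeasurableSet.iInter fun m => measurableSet_le
          ((measurable_circleDefect hn _).comp (measurable_fst.mul measurable_snd))
          ((measurable_circleDefect hn _).comp measurable_snd)))
  have h1 : ∀ᵐ l : ℝ, ∀ᵐ s : ℝ, (l, s) ∈ S := by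
    refine Eventually.of_forall fun l => ?_
    rcases lt_or_ge l 1 with hl | hl
    · exact Eventually.of_forall fun s h => absurd h (not_le.2 hl)
    · filter_upwards [ae_polar (hmono l hl)] with s hs _ hs0 m
      refine integral_mono_ae (integrableOn_circleDefect hn hn0 m.cast_nonneg _)
        (integrableOn_circleDefect hn hn0 (by positivity) _) ?_
      filter_upwards [hs hs0] with θ hθ
      simp only [circlePoint_mul]
      have : (m : ℝ) / 2 * n (circlePoint s θ) ≤ m * n (l • circlePoint s θ) := by
        have := mul_le_mul_of_nonneg_left hθ (m.cast_nonneg (α := ℝ))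
        linarith
      have := min_le_min_left 1 this
      linarith
  have h2 : ∀ᵐ s : ℝ, ∀ᵐ l : ℝ, (l, s) ∈ S := (Measure.ae_ae_comm (p := fun l s => (l, s) ∈ S)
    hSm).1 h1
  have hne : (ae (volume.restrict (Ioo (1 : ℝ) 2))).NeBot := ae_neBot.2 (by simp)
  -- for each factor `l` the circles of radii `s` and `l s` can be compared for almost every `s`; by
  -- Fubini a single good `s` in `(1, 2)` serves almost every `l`, i.e. almost every radius `r = l s`
  obtain ⟨s, hsm, hs2, hsp⟩ := ((ae_restrict_mem measurableSet_Ioo).and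
    ((ae_restrict_of_ae (s := Ioo (1 : ℝ) 2) h2).and
      (ae_restrict_of_ae (s := Ioo (1 : ℝ) 2) (ae_polar hpos)))).exists
  have hs0 : 0 < s := one_pos.trans hsm.1
  -- with `m` fixed by the circle of radius `s`, `r / 2 ≥ m` is all that is needed of `r`
  obtain ⟨m, hm⟩ := ((tendsto_circleDefect hn hn0 (hsp hs0)).eventually
    (gt_mem_nhds (show (0 : ℝ) < 1 / 8 by norm_num))).exists
  refine ⟨max 4 (2 * m), le_max_left _ _, ?_⟩
  have h3 := (Measure.quasiMeasurePreserving_smul (volume : Measure ℝ)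
    (inv_ne_zero hs0.ne')).ae hs2
  filter_upwards [h3] with r hr hRr
  have hr4 : 4 ≤ r := (le_max_left _ _).trans hRr
  have hrm : 2 * (m : ℝ) ≤ r := (le_max_right _ _).trans hRr
  have e : s⁻¹ • r * s = r := by
    rw [smul_eq_mul]
    field_simp
  have h4 := hr (by
    rw [smul_eq_mul, inv_mul_eq_div, le_div_iff₀ hs0]
    linarith [hsm.2]) hs0 m
  simp only [e] at h4
  exact ((circleDefect_anti hn hn0 m.cast_nonneg (by linarith) r).trans h4).trans hm.le

theorem hasDerivAt_circlePoint (r θ : ℝ) :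
    HasDerivAt (circlePoint r) (!₂[-(r * Real.sin θ), r * Real.cos θ] : E 2) θ := by
  have h : HasDerivAt (fun θ => ![r * Real.cos θ, r * Real.sin θ])
      ![-(r * Real.sin θ), r * Real.cos θ] θ := by
    rw [hasDerivAt_pi]
    intro i
    fin_cases i
    · simpa using (Real.hasDerivAt_cos θ).const_mul r
    · simpa using (Real.hasDerivAt_sin θ).const_mul r
  exact (PiLp.hasFDerivAt_toLp (𝕜 := ℝ) 2 _).comp_hasDerivAt θ h

/-- On a circle where the defect of `(r/2) n` is small the integral of the angular form of a smooth
function is nonnegative, even with `(r/2) n` replaced by its minimum with `1`. -/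
theorem circle_angular_nonneg (hn : Measurable n) (hn0 : ∀ x, 0 ≤ n x) {r : ℝ} (hr : 0 < r)
    (hdef : circleDefect n (r / 2) r ≤ 1 / 8) {w : E 2 → ℝ} (hw : ContDiff ℝ ∞ w) :
    0 ≤ ∫ θ in Ioo (-Real.pi) Real.pi,
      (min 1 (r / 2 * n (circlePoint r θ)) * (w (circlePoint r θ) * w (circlePoint r θ))
        + (r ^ 2 * dotProd (grad w) (grad w) (circlePoint r θ)
          - radialPart (grad w) (circlePoint r θ) * radialPart (grad w) (circlePoint r θ))
        - w (circlePoint r θ) * w (circlePoint r θ) / 4) := by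
  have hcp : Continuous (circlePoint r) :=
    continuous_iff_continuousAt.2 fun θ => (hasDerivAt_circlePoint r θ).continuousAt
  have hg : ∀ i, Continuous (grad w i) := fun i => (ContDiff.partialDeriv hw i).continuous
  set f' : ℝ → ℝ := fun θ => -(r * Real.sin θ) * grad w 0 (circlePoint r θ)
    + r * Real.cos θ * grad w 1 (circlePoint r θ) with hf'
  have hf'c : Continuous f' := by
    have h0 := (hg 0).comp hcp
    have h1 := (hg 1).comp hcp
    exact ((continuous_const.mul Real.continuous_sin).neg.mul h0).add
      ((continuous_const.mul Real.continuous_cos).mul h1)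
  have hf : ∀ θ, HasDerivAt (fun θ => w (circlePoint r θ)) (f' θ) θ := by
    intro θ
    have h1 := ((hw.differentiable (by norm_num) (circlePoint r θ)).hasFDerivAt).comp_hasDerivAt θ
      (hasDerivAt_circlePoint r θ)
    refine h1.congr_deriv ?_
    rw [← sum_coord_mul_apply, Fin.sum_univ_two]
    rfl
  have key := circle_inequality (N := fun θ => min 1 (r / 2 * n (circlePoint r θ))) hf hf'c
    (measurable_const.min (measurable_const.mul (hn.comp hcp.measurable)))
    (fun θ => le_min zero_le_one (mul_nonneg (by positivity) (hn0 _)))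
    (fun θ => min_le_left _ _) hdef
  refine key.trans_eq (integral_congr_ae (Eventually.of_forall fun θ => ?_))
  simp only [hf', dotProd, radialPart, Fin.sum_univ_two]
  have e0 : (circlePoint r θ) 0 = r * Real.cos θ := by simp [circlePoint]
  have e1 : (circlePoint r θ) 1 = r * Real.sin θ := by simp [circlePoint]
  rw [e0, e1]
  have h1 := Real.sin_sq_add_cos_sq θ
  have h2 : Real.sin θ ^ 2 = 1 - Real.cos θ ^ 2 := by linarith
  ring_nf
  rw [h2]
  ring

end

/-! ### Positivity of the angular form -/

section

variable {d : ℕ} {n : E d → ℝ} {Dn : Fin d → E d → ℝ}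

/-- A representative of the potential that is measurable and nonnegative everywhere, so that it can
be restricted to individual circles. -/
theorem exists_measurable_nonneg_potential [NeZero d] (hnm : AEStronglyMeasurable n volume)
    (hpos : ∀ᵐ x : E d, 0 < n x) (hβ : betaConst n Dn < 1) (hDn : HasWeakGradientOn {0}ᶜ n Dn) :
    ∃ n' : E d → ℝ, Measurable n' ∧ (∀ x, 0 ≤ n' x) ∧ n' =ᵐ[volume] n ∧ (∀ᵐ x, 0 < n' x) ∧
      ∀ s : ℝ, 1 ≤ s → ∀ᵐ x, n' x ≤ 2 * n' (s • x) := by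
  have he : (fun x => max (hnm.mk n x) 0) =ᵐ[volume] n := by
    filter_upwards [hnm.ae_eq_mk, hpos] with x h1 h2
    rw [← h1, max_eq_left h2.le]
  refine ⟨_, hnm.stronglyMeasurable_mk.measurable.max measurable_const, fun x => le_max_right _ _,
    he, ?_, fun s hs => ?_⟩
  · filter_upwards [he, hpos] with x h1 h2
    rwa [h1]
  · have hs0 : s ≠ 0 := by linarith
    filter_upwards [he, (Measure.quasiMeasurePreserving_smul (volume : Measure (E d)) hs0).ae he,
      ae_le_two_mul_comp_smul hpos hβ hDn hs] with x h1 h2 h3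
    rw [h1, h2]
    exact h3

theorem MemLpLoc.angularDensity {v : E d → ℝ} {Dv : Fin d → E d → ℝ} (hv : MemLpLoc 2 v)
    (hDv : ∀ i, MemLpLoc 2 (Dv i)) (hnb : LocBdd n) : MemLpLoc 1 (angularDensity n v Dv) := by
  have mX := MemLpLoc.radialPart hDv
  have mS := MemLpLoc.dotProd hDv
  have hvv := hv.mul hv
  exact (((hvv.bdd_mul hnb).bdd_mul (continuous_norm.div_const 2).locBdd).add
    ((mS.bdd_mul (continuous_norm.pow 2).locBdd).sub (mX.mul mX))).add
    (hvv.bdd_mul continuous_const.locBdd)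

theorem ConvLoc.angularDensity {v : E d → ℝ} {Dv : Fin d → E d → ℝ} {w : ℕ → E d → ℝ}
    (hw : ConvLoc 2 w v) (hDw : ∀ i, ConvLoc 2 (fun k => grad (w k) i) (Dv i)) (hnb : LocBdd n) :
    ConvLoc 1 (fun k => angularDensity n (w k) (grad (w k))) (angularDensity n v Dv) := by
  have mX := ConvLoc.radialPart hDw
  have mS := ConvLoc.dotProd hDw
  have hvv := hw.mul hw
  exact ((((hvv.bdd_mul hnb).bdd_mul (continuous_norm.div_const 2).locBdd).add le_rfl
    (((mS.bdd_mul (continuous_norm.pow 2).locBdd).sub le_rfl (mX.mul mX)))).add le_rfl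
    (hvv.bdd_mul continuous_const.locBdd))

/-- For `d ≥ 3` all three terms of the angular form are nonnegative, the middle one by the
Cauchy-Schwarz inequality `|x · ∇v| ≤ |x| |∇v|`. -/
theorem angularDensity_nonneg_of_three_le (hd : 3 ≤ d) {v : E d → ℝ} {Dv : Fin d → E d → ℝ}
    {x : E d} (hx : 0 ≤ n x) : 0 ≤ angularDensity n v Dv x := by
  have hd3 : (3 : ℝ) ≤ d := by exact_mod_cast hd
  have h1 := radialPart_sq_le Dv x
  have h2 := mul_self_nonneg (v x)
  unfold angularDensity
  have h3 : 0 ≤ ‖x‖ / 2 * (n x * (v x * v x)) :=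
    mul_nonneg (by positivity) (mul_nonneg hx h2)
  have h4 : (0 : ℝ) ≤ (d - 1) * (d - 3) / 4 * (v x * v x) :=
    mul_nonneg (div_nonneg (mul_nonneg (by linarith) (by linarith)) (by norm_num)) h2
  linarith

/-- In dimension two the angular form of a smooth function has nonnegative means over large
circles, because the potential is not too small on most of each of these circles. -/
theorem integral_angularDensity_nonneg_of_contDiff {n n' : E 2 → ℝ} (hn' : Measurable n')
    (hn0 : ∀ x, 0 ≤ n' x) (he : n' =ᵐ[volume] n) (hnb : LocBdd n) {R₀ R : ℝ}
    (hdef : ∀ᵐ r, R₀ ≤ r → circleDefect n' (r / 2) r ≤ 1 / 8) {c : ℝ → ℝ}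
    (hc : IsRadialWeight R₀ R c) (hc0 : ∀ r, 0 ≤ c r) {w : E 2 → ℝ} (hw : ContDiff ℝ ∞ w) :
    0 ≤ ∫ x, c ‖x‖ * angularDensity n w (grad w) x := by
  have hwm : MemLpLoc 2 w := hw.continuous.memLpLoc
  have hgm : ∀ i, MemLpLoc 2 (grad w i) := fun i => (ContDiff.partialDeriv hw i).continuous.memLpLoc
  set N : E 2 → ℝ := fun x => min 1 (‖x‖ / 2 * n' x) with hN
  have hN0 : ∀ x, 0 ≤ N x := fun x => le_min zero_le_one (mul_nonneg (by positivity) (hn0 x))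
  have hNb : LocBdd N := by
    refine ⟨(measurable_const.min ((measurable_norm.div_const 2).mul hn')).aestronglyMeasurable,
      fun _ => ⟨1, Eventually.of_forall fun x => ?_⟩⟩
    rw [Real.norm_of_nonneg (hN0 x)]
    exact min_le_left _ _
  set g : E 2 → ℝ := fun x => N x * (w x * w x)
    + (‖x‖ ^ 2 * dotProd (grad w) (grad w) x - radialPart (grad w) x * radialPart (grad w) x)
    - w x * w x / 4 with hg
  have mg : MemLpLoc 1 g := by
    have mX := MemLpLoc.radialPart hgm
    have mS := MemLpLoc.dotProd hgm
    have hvv := hwm.mul hwm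
    refine (((hvv.bdd_mul hNb).add
      ((mS.bdd_mul (continuous_norm.pow 2).locBdd).sub (mX.mul mX))).sub
      (hvv.bdd_mul (continuous_const (y := (1 / 4 : ℝ))).locBdd)).congr
      (Eventually.of_forall fun x => ?_)
    simp only [hg, Pi.pow_apply]
    ring
  have hle : ∫ x, c ‖x‖ * g x ≤ ∫ x, c ‖x‖ * angularDensity n w (grad w) x := by
    refine integral_mono_ae (hc.integrable mg) (hc.integrable (hwm.angularDensity hgm hnb)) ?_
    filter_upwards [he] with x hx
    refine mul_le_mul_of_nonneg_left ?_ (hc0 _)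
    have h1 : N x ≤ ‖x‖ / 2 * n x := by
      rw [← hx]; exact min_le_right _ _
    have h2 := mul_le_mul_of_nonneg_right h1 (mul_self_nonneg (w x))
    simp only [hg, angularDensity]
    push_cast
    linarith
  refine le_trans ?_ hle
  rw [integral_polar]
  -- Fubini needs integrability in polar coordinates; without it the integral is zero by convention
  by_cases hi : Integrable (fun p : ℝ × ℝ => p.1 * (c ‖circlePoint p.1 p.2‖ * g (circlePoint p.1 p.2)))
    (volume.restrict (Ioi (0 : ℝ) ×ˢ Ioo (-Real.pi) Real.pi))
  swap
  · rw [integral_undef hi]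
  have hprod : (volume : Measure (ℝ × ℝ)).restrict (Ioi (0 : ℝ) ×ˢ Ioo (-Real.pi) Real.pi)
      = (volume.restrict (Ioi 0)).prod (volume.restrict (Ioo (-Real.pi) Real.pi)) :=
    (Measure.prod_restrict _ _).symm
  rw [hprod] at hi ⊢
  rw [integral_prod _ hi]
  refine integral_nonneg_of_ae ?_
  filter_upwards [ae_restrict_mem measurableSet_Ioi, ae_restrict_of_ae hdef] with r hr hdr
  have hr0 : 0 < r := hr
  simp only [norm_circlePoint hr0.le, Pi.zero_apply]
  rw [integral_const_mul, integral_const_mul]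
  rcases eq_or_ne (c r) 0 with h0 | h0
  · simp [h0]
  have key := circle_angular_nonneg hn' hn0 hr0 (hdr (hc.supp r h0).1) hw
  refine mul_nonneg hr0.le (mul_nonneg (hc0 r) (key.trans_eq ?_))
  simp only [hg, hN, norm_circlePoint hr0.le]

/-- The angular form is nonnegative in the mean beyond a radius depending only on `n`. -/
theorem exists_radius_angularDensity_nonneg [NeZero d] (hd : 2 ≤ d) (hnb : LocBdd n)
    (hpos : ∀ᵐ x : E d, 0 < n x) (hβ : betaConst n Dn < 1) (hDn : HasWeakGradientOn {0}ᶜ n Dn) :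
    ∃ R₀, 4 ≤ R₀ ∧ ∀ (w : ℕ → E d → ℝ) (v : E d → ℝ) (Dv : Fin d → E d → ℝ) (g : E d → ℝ),
      SmoothApprox w v Dv g → ∀ (R : ℝ) (c : ℝ → ℝ), IsRadialWeight R₀ R c → (∀ r, 0 ≤ c r) →
        0 ≤ ∫ x, c ‖x‖ * angularDensity n v Dv x := by
  rcases hd.eq_or_lt with rfl | hd3
  · obtain ⟨n', hm, h0, he, hp, hs⟩ := exists_measurable_nonneg_potential hnb.1 hpos hβ hDn
    obtain ⟨R₀, hR₀, hdef⟩ := exists_circleDefect_le hm h0 hp hs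
    refine ⟨R₀, hR₀, fun w v Dv g h R c hc hc0 => ?_⟩
    have hcb : LocBdd fun x : E 2 => c ‖x‖ := by
      obtain ⟨C, hC⟩ := hc.bound
      exact ⟨(hc.measurable.comp measurable_norm).aestronglyMeasurable,
        fun _ => ⟨C, Eventually.of_forall fun x => hC _⟩⟩
    have hz : ∀ (x : E 2), R < ‖x‖ → c ‖x‖ = 0 := fun x hx => by
      by_contra hx0
      exact not_lt.2 (hc.supp _ hx0).2 hx
    refine ge_of_tendsto' (((ConvLoc.angularDensity h.conv h.conv_grad hnb).bdd_mul
      hcb).tendsto_integral (R := R) (fun k x hx => by simp [hz x hx])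
      fun x hx => by simp [hz x hx]) fun k => ?_
    exact integral_angularDensity_nonneg_of_contDiff hm h0 he hnb hdef hc hc0 (h.smooth k)
  · refine ⟨4, le_rfl, fun w v Dv g h R c hc hc0 => integral_nonneg_of_ae ?_⟩
    filter_upwards [hpos] with x hx
    exact mul_nonneg (hc0 _) (angularDensity_nonneg_of_three_le hd3 hx.le)

end

end Helmholtz

/-- Uniqueness for the Helmholtz equation. The functions `u`, `∇u` are only defined almost
everywhere, so their spherical integrals are defined for almost every radius, and the lower limit
is taken along `r → ∞` up to null sets of radii; it is the ordinary lower limit when the spherical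
integral is continuous in `r`. -/
theorem theorem4p1 (d : ℕ) (hd : 2 ≤ d)
    (n n₁ n₂ : Helmholtz.E d → ℝ) (Dn : Fin d → Helmholtz.E d → ℝ) (c₀ : ℝ)
    (hn : n =ᵐ[volume] fun x => n₁ x + n₂ x)
    (hn₁ : AEStronglyMeasurable n₁ volume)
    (hn₂ : MemLp n₂ ⊤ volume)
    (hpos : ∀ᵐ x ∂(volume : Measure (Helmholtz.E d)), 0 < n x)
    (hc₀ : 0 < c₀)
    (hform : ∀ φ : Helmholtz.E d → ℝ, Helmholtz.IsTestFunction univ φ →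
      eLpNorm (fun x => Real.sqrt |n₁ x| * φ x) 2 volume
        ≤ ENNReal.ofReal (1 - c₀) * eLpNorm (fun x => fderiv ℝ φ x) 2 volume)
    (hDn : Helmholtz.HasWeakGradientOn {0}ᶜ n Dn)
    (hβ : Helmholtz.betaConst n Dn < 1)
    (u : Helmholtz.E d → ℂ) (Du : Fin d → Helmholtz.E d → ℂ)
    (hDu : Helmholtz.HasWeakGradientOn univ u Du)
    (hu_loc : Helmholtz.IsLocallyL2 u)
    (hDu_loc : ∀ i, Helmholtz.IsLocallyL2 (Du i))
    (hsol : Helmholtz.IsHelmholtzSolution n u Du)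
    (hliminf : liminf (Helmholtz.sphereEnergy u Du)
      (atTop ⊓ ae (volume : Measure ℝ)) = 0) :
    u =ᵐ[volume] 0 := by
  have : NeZero d := ⟨by omega⟩
  have hM := Helmholtz.ae_potential_le hn hn₂ hpos hc₀ hform hβ hDn
  have hnm : AEStronglyMeasurable n volume := (hn₁.add hn₂.1).congr hn.symm
  have hnb : Helmholtz.LocBdd n := by
    refine ⟨hnm, fun _ => ⟨2 * (eLpNorm n₂ ⊤ volume).toReal, ae_restrict_of_ae ?_⟩⟩
    filter_upwards [hM, hpos] with x h1 h2
    rwa [Real.norm_of_nonneg h2.le]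
  obtain ⟨R₀, hR₀, hang⟩ :=
    Helmholtz.exists_radius_angularDensity_nonneg hd hnb hpos hβ hDn
  -- a real-linear functional of `u` solves the same equation
  have key : ∀ L : ℂ →L[ℝ] ℝ, (∀ z, |L z| ≤ ‖z‖) → ∀ᵐ x, L (u x) = 0 := by
    intro L hL
    have mv := hu_loc.clm_comp L
    have happ := Helmholtz.smoothApprox_mollify mv (fun i => (hDu_loc i).clm_comp L)
      ((mv.bdd_mul hnb).neg) (hDu.clm_comp L) fun φ hφ => hsol.clm_comp L hDu hφ
    refine happ.eq_zero_of_angular_nonneg hpos hβ hDn hnb hM hR₀ (hang _ _ _ _ happ) fun δ hδ => ?_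
    have h1 : ∃ᶠ s in atTop ⊓ ae (volume : Measure ℝ),
        Helmholtz.sphereEnergy u Du s < ENNReal.ofReal δ :=
      frequently_lt_of_liminf_lt (h := by rw [hliminf]; exact ENNReal.ofReal_pos.2 hδ)
    refine (h1.and_eventually ((eventually_gt_atTop 0).filter_mono inf_le_left)).mono ?_
    rintro s ⟨hs, hs0⟩
    exact Helmholtz.sphereIntegral_lt_of_sphereEnergy_lt L hL hs0 hδ hs
  filter_upwards [key Complex.reCLM Complex.abs_re_le_norm,
    key Complex.imCLM Complex.abs_im_le_norm] with x h1 h2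
  exact Complex.ext h1 h2
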